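/- For integers $b\ge 2$ and $d\ge 1$, let $\Sigma=\{0,\dots,b-1\}^d$ and let $\star\notin\Sigma$ be a further letter. All automata are deterministic B\"uchi automata $A=(Q,\Sigma\cup\{\star\},\delta,q_0,F)$ with $Q$ finite and $\delta:Q\times(\Sigma\cup\{\star\})\to Q$ total; an $\omega$-word is accepted if its run from $q_0$ visits some state of $F$ infinitely often. The automaton is weak if any two states that are accessible from each other are either both in $F$ or both outside $F$ (that is, $F$ is a union of strongly connected components). An $\omega$-word $v\star w$ with $v\in\Sigma^*$ and $w\in\Sigma^\omega$ encodes the vector $r\in(\mathbb R^{\ge0})^d$ with components $$r_f=\sum_{i=0}^{|v|-1} b^{|v|-1-i}\,v[i]_f+\sum_{i=0}^{\infty} b^{-i-1}\,w[i]_f\qquad(0\le f<d).$$ A language is $d$-parallel if it is a subset of $\Sigma^*\star\Sigma^\omega$. It is saturated if, whenever it contains one encoding of a vector $r$, it contains all encodings of $r$. The automaton $A$ is a Real Vector Automaton (RVA) if the language it accepts is $d$-parallel and saturated. **Theorem.** There are a single program $P$ for a random access machine and a constant $C$ such that, for all $b\ge2$, $d\ge1$, $n\ge1$ and every weak deterministic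 B\"uchi automaton $A$ with $n$ states over the alphabet $\Sigma\cup\{\star\}$, the program $P$ on input $A$ halts and decides correctly whether $A$ is an RVA, after at most $C\,n\log(n+1)\,d\,b^d$ steps and using at most $C\,n\,b^d$ memory cells (that is, in time $O(n\log(n)\,d\,b^d)$ for $n\ge 2$ and space $O(n\,b^d)$). Here the input consists of $b$, $d$, $n$, $q_0$, the table of $\delta$ and the array of Booleans describing $F$. Each cell holds one natural number; reading or writing a cell, a comparison, and an arithmetic operation ($+$, truncated $-$, $\times$, integer quotient, remainder) each cost one step; and all numbers that occur in the computation are at most $(n\,b^d)^C$. -/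

import Mathlib

/-! ### Deterministic Büchi automata -/

/-- A deterministic Büchi automaton with alphabet `α` and set of states `Q`. -/
structure BuchiAutomaton (α Q : Type*) where
  step : Q → α → Q
  init : Q
  accept : Set Q

namespace BuchiAutomaton

variable {α Q : Type*}

/-- The run of the automaton on an `ω`-word. -/
def run (A : BuchiAutomaton α Q) (w : ℕ → α) : ℕ → Q
  | 0 => A.init
  | i + 1 => A.step (A.run w i) (w i)

/-- The `ω`-language of the automaton: some accepting state occurs infinitely often in the run. -/
def language (A : BuchiAutomaton α Q) : Set (ℕ → α) :=
  {w | ∃ q ∈ A.accept, {i | A.run w i = q}.Infinite}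

/-- `A.Accessible q q'`: some nonempty finite word leads from `q` to `q'`. -/
def Accessible (A : BuchiAutomaton α Q) : Q → Q → Prop :=
  Relation.TransGen (fun q q' => ∃ a, A.step q a = q')

/-- Weakness: `accept` is a union of strongly connected components. A state on no cycle is a
component of its own, so it may or may not be accepting. -/
def IsWeak (A : BuchiAutomaton α Q) : Prop :=
  ∀ q q', A.Accessible q q' → A.Accessible q' q → (q ∈ A.accept ↔ q' ∈ A.accept)

end BuchiAutomaton

/-! ### Parallel encodings of vectors of non-negative reals -/

/-- The parallel alphabet `{0,…,b-1}^d ∪ {⋆}`; the letter `⋆` is `none`. -/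
abbrev ParLetter (b d : ℕ) : Type := Option (Fin d → Fin b)

/-- The `ω`-word `v ⋆ w`, for a finite word `v` and an `ω`-word `w` over `{0,…,b-1}^d`. -/
def starWord {b d : ℕ} (v : List (Fin d → Fin b)) (w : ℕ → Fin d → Fin b) : ℕ → ParLetter b d :=
  fun i =>
    if h : i < v.length then some v[i]
    else if i = v.length then none
    else some (w (i - (v.length + 1)))

/-- The `d`-vector of reals encoded by `v ⋆ w`: in each component, the natural number whose
base-`b` digits (most significant first) are given by `v`, plus the real
`∑ i, w i / b ^ (i + 1)`. -/
noncomputable def starValue {b d : ℕ} (v : List (Fin d → Fin b)) (w : ℕ → Fin d → Fin b) :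
    Fin d → ℝ :=
  fun f => (Nat.ofDigits b ((v.map fun a => (a f : ℕ)).reverse) : ℝ)
    + Real.ofDigits (fun i => w i f)

/-- `u` is an encoding in base `b` of the vector `r`. -/
def IsParEncoding {b d : ℕ} (u : ℕ → ParLetter b d) (r : Fin d → ℝ) : Prop :=
  ∃ v w, u = starWord v w ∧ starValue v w = r

/-- `d`-parallel languages: all words have the form `v ⋆ w`. -/
def IsParallelLanguage {b d : ℕ} (L : Set (ℕ → ParLetter b d)) : Prop :=
  ∀ u ∈ L, ∃ v w, u = starWord v w

/-- The set of vectors of reals that have an encoding in `L`. -/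
def realSet {b d : ℕ} (L : Set (ℕ → ParLetter b d)) : Set (Fin d → ℝ) :=
  {r | ∃ u ∈ L, IsParEncoding u r}

/-- `L` contains all the encodings of every vector that has an encoding in `L`. -/
def IsSaturated {b d : ℕ} (L : Set (ℕ → ParLetter b d)) : Prop :=
  ∀ r ∈ realSet L, ∀ u, IsParEncoding u r → u ∈ L

/-- Real Vector Automata: the language is `d`-parallel and saturated. -/
def IsRVA {b d : ℕ} {Q : Type*} (A : BuchiAutomaton (ParLetter b d) Q) : Prop :=
  IsParallelLanguage A.language ∧ IsSaturated A.language

/-! ### A random access machine with step count, bounded memory and bounded words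

Programs are structured programs over integer variables and integer arrays. A program mentions
finitely many variables and arrays. It is executed on a machine where each array has `S` cells and
where every number that is computed has to be at most `W`; an execution that leaves these bounds
is stuck. Every elementary operation costs one step. -/

namespace RAM

/-- Arithmetic operations on natural numbers; `sub` is truncated, comparisons yield `0` or `1`. -/
inductive Op
  | add | sub | mul | div | mod | lt | eq

def Op.apply : Op → ℕ → ℕ → ℕ
  | add, x, y => x + y
  | sub, x, y => x - y
  | mul, x, y => x * y
  | div, x, y => x / y
  | mod, x, y => x % y
  | lt, x, y => if x < y then 1 else 0
  | eq, x, y => if x = y then 1 else 0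

/-- Expressions: constants, variables, array cells `a[e]`, and arithmetic operations. -/
inductive Expr
  | lit (k : ℕ)
  | var (x : ℕ)
  | get (a : ℕ) (e : Expr)
  | bin (o : Op) (e₁ e₂ : Expr)

/-- Structured programs. -/
inductive Cmd
  | skip
  | assign (x : ℕ) (e : Expr)
  | store (a : ℕ) (i e : Expr)
  | seq (c₁ c₂ : Cmd)
  | branch (e : Expr) (c₁ c₂ : Cmd)
  | loop (e : Expr) (c : Cmd)

/-- The contents of the memory. -/
structure State where
  var : ℕ → ℕ
  arr : ℕ → ℕ → ℕ

def State.setVar (s : State) (x v : ℕ) : State :=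
  { s with var := Function.update s.var x v }

def State.setArr (s : State) (a i v : ℕ) : State :=
  { s with arr := Function.update s.arr a (Function.update (s.arr a) i v) }

namespace Expr

/-- The number of steps of an evaluation: one for each node. -/
def cost : Expr → ℕ
  | lit _ => 1
  | var _ => 1
  | get _ e => e.cost + 1
  | bin _ e₁ e₂ => e₁.cost + e₂.cost + 1

def eval (s : State) : Expr → ℕ
  | lit k => k
  | var x => s.var x
  | get a e => s.arr a (e.eval s)
  | bin o e₁ e₂ => o.apply (e₁.eval s) (e₂.eval s)

/-- The evaluation only reads array cells with index below `S`, and the value of the expression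
and all intermediate values are at most `W`. -/
def Safe (S W : ℕ) (s : State) : Expr → Prop
  | lit k => k ≤ W
  | var x => s.var x ≤ W
  | get a e => e.Safe S W s ∧ e.eval s < S ∧ s.arr a (e.eval s) ≤ W
  | bin o e₁ e₂ => e₁.Safe S W s ∧ e₂.Safe S W s ∧ o.apply (e₁.eval s) (e₂.eval s) ≤ W

/-- The variables mentioned. -/
def vars : Expr → Finset ℕ
  | lit _ => ∅
  | var x => {x}
  | get _ e => e.vars
  | bin _ e₁ e₂ => e₁.vars ∪ e₂.vars

/-- The arrays mentioned. -/
def arrays : Expr → Finset ℕ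
  | lit _ => ∅
  | var _ => ∅
  | get a e => insert a e.arrays
  | bin _ e₁ e₂ => e₁.arrays ∪ e₂.arrays

end Expr

namespace Cmd

/-- The variables mentioned. -/
def vars : Cmd → Finset ℕ
  | skip => ∅
  | assign x e => insert x e.vars
  | store _ i e => i.vars ∪ e.vars
  | seq c₁ c₂ => c₁.vars ∪ c₂.vars
  | branch e c₁ c₂ => e.vars ∪ c₁.vars ∪ c₂.vars
  | loop e c => e.vars ∪ c.vars

/-- The arrays mentioned. -/
def arrays : Cmd → Finset ℕ
  | skip => ∅
  | assign _ e => e.arrays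
  | store a i e => insert a (i.arrays ∪ e.arrays)
  | seq c₁ c₂ => c₁.arrays ∪ c₂.arrays
  | branch e c₁ c₂ => e.arrays ∪ c₁.arrays ∪ c₂.arrays
  | loop e c => e.arrays ∪ c.arrays

/-- The number of memory cells of a machine that runs `c` with arrays of `S` cells
(the cells that hold the input are counted). -/
def space (c : Cmd) (S : ℕ) : ℕ := c.vars.card + c.arrays.card * S

end Cmd

/-- `Exec S W c s t s'`: on the machine with arrays of `S` cells and words bounded by `W`, the
program `c` started in the memory `s` halts after `t` steps with the memory `s'`. -/
inductive Exec (S W : ℕ) : Cmd → State → ℕ → State → Prop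
  | skip (s : State) : Exec S W .skip s 1 s
  | assign (s : State) (x : ℕ) (e : Expr) (he : e.Safe S W s) :
      Exec S W (.assign x e) s (e.cost + 1) (s.setVar x (e.eval s))
  | store (s : State) (a : ℕ) (i e : Expr) (hi : i.Safe S W s) (hS : i.eval s < S)
      (he : e.Safe S W s) :
      Exec S W (.store a i e) s (i.cost + e.cost + 1) (s.setArr a (i.eval s) (e.eval s))
  | seq {s s₁ s₂ : State} {t₁ t₂ : ℕ} {c₁ c₂ : Cmd}
      (h₁ : Exec S W c₁ s t₁ s₁) (h₂ : Exec S W c₂ s₁ t₂ s₂) :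
      Exec S W (.seq c₁ c₂) s (t₁ + t₂) s₂
  | branch_true {s s' : State} {t : ℕ} {e : Expr} {c₁ c₂ : Cmd} (he : e.Safe S W s)
      (hne : e.eval s ≠ 0) (h : Exec S W c₁ s t s') :
      Exec S W (.branch e c₁ c₂) s (e.cost + 1 + t) s'
  | branch_false {s s' : State} {t : ℕ} {e : Expr} {c₁ c₂ : Cmd} (he : e.Safe S W s)
      (hz : e.eval s = 0) (h : Exec S W c₂ s t s') :
      Exec S W (.branch e c₁ c₂) s (e.cost + 1 + t) s'
  | loop_true {s s₁ s₂ : State} {t₁ t₂ : ℕ} {e : Expr} {c : Cmd} (he : e.Safe S W s)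
      (hne : e.eval s ≠ 0) (h₁ : Exec S W c s t₁ s₁) (h₂ : Exec S W (.loop e c) s₁ t₂ s₂) :
      Exec S W (.loop e c) s (e.cost + 1 + t₁ + t₂) s₂
  | loop_false {s : State} {e : Expr} {c : Cmd} (he : e.Safe S W s) (hz : e.eval s = 0) :
      Exec S W (.loop e c) s (e.cost + 1) s

end RAM

/-! ### The input of the machine -/

/-- The letters are numbered from `0` to `b ^ d`: the digit vector `a` has number
`∑ i, a i * b ^ i`, and `⋆` has number `b ^ d`. This is the letter number `k`. -/
def letterOfCode (b d k : ℕ) : ParLetter b d :=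
  if h : k < b ^ d then some (finFunctionFinEquiv.symm ⟨k, h⟩) else none

open Classical in
/-- The initial memory on input `A`: the variables `0,1,2,3` hold `b`, `d`, the number of states,
and the initial state; array `0` holds the transition table, with the image of the state `q` under
the letter number `k` at index `q * (b ^ d + 1) + k`; array `1` holds the set of accepting states
as an array of Booleans. All other variables and cells are `0`. -/
noncomputable def inputState {b d n : ℕ} (A : BuchiAutomaton (ParLetter b d) (Fin n)) :
    RAM.State where
  var
    | 0 => b
    | 1 => d
    | 2 => n
    | 3 => A.init
    | _ => 0
  arr
    | 0 => fun i =>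
        if h : i / (b ^ d + 1) < n then
          A.step ⟨i / (b ^ d + 1), h⟩ (letterOfCode b d (i % (b ^ d + 1)))
        else 0
    | 1 => fun i => if h : i < n then (if (⟨i, h⟩ : Fin n) ∈ A.accept then 1 else 0) else 0
    | _ => fun _ => 0

/-! The value of `v ⋆ w` is `b ^ |v|` times the real number whose digits are those of `v` followed
by those of `w` (`starValue_eq`). Two digit sequences with the same value are equal or have the
forms `u a (b-1) (b-1) …` and `u (a+1) 0 0 …` (`Real.eq_or_isDualAt_of_ofDigits_eq`). Hence any two
encodings of a vector are linked by zero padding, which brings both stars to the same position,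
followed by at most one exchange of dual expansions in each component. Being an RVA thus amounts to
local conditions (`isRVA_iff`): every accepted word has exactly one star, a zero letter in front
does not change membership, and neither does an exchange of dual expansions in a single component
`f`.

For fixed `f` these conditions are two equivalences of states in a product automaton with `6 n`
states and `2 (b ^ d + 1)` letters (`IsTableOf.componentTest_iff`). A letter of the product is a
letter of `A` with a switch bit. Mode 0 simulates `A`; the modes 1, 2, 3 simulate `A` and count
stars, where 1 and 3 reject. An active switch at a digit `a < b - 1` of component `f` turns mode 0
into mode 4, where `A` reads `a` and from then on `b - 1` in this component; it turns the modes 1,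
2, 3 into mode 5, where `A` reads `a + 1` and then `0`. The initial state in mode 0 is equivalent to
the one in mode 1 iff the language is parallel and invariant under exchanges in `f`. Invariance
under padding is the equivalence, in mode 0, of the initial state and its successor under the zero
letter. Modes never decrease, so the product inherits weakness (`IsTableOf.isWeakTable`).

Equivalence in a weak automaton is tested with colours. A colouring does not increase along
transitions, is odd exactly on accepting cycles, and is as small as possible (`IsColouring`).
Equivalent states have equal colours (`IsColouring.eq_of_tableEquiv`), and a congruence that
respects colours identifies only equivalent states (`IsColouring.tableEquiv_of_congruence`). So it
suffices to close the seed pairs under transitions, in the manner of Hopcroft and Karp, and to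
compare the colours of all pairs met (`RAM.HkState.iff`). Only pairs that join two classes of a
disjoint-set forest are queued, so there are `O(N)` pairs; each of the `O(N L)` letter steps climbs
twice in the forest, and union by rank makes a climb logarithmic. This is the source of the factor
`log n`.

The colours come from one path-based depth-first search that completes strongly connected components
after all their successors. A component receives the greatest colour of the completed targets, plus
one if it has a cycle and the parity is wrong (`Scc.Inv.remove`). `Scc.potential` shows that the
search takes `O(N L)` steps and also bounds the colours.

On the machine, `RAM.Runs` keeps all stored numbers below a bound `V` linear in `n b ^ d`, while
intermediate values stay below `V ^ 16`. The `d` components are tested one after the other in the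
same arrays, so that `d` enters the time but not the space (`RAM.runs_program`). -/

namespace RAM

/-! ### A calculus for executions with costs -/

/-- Evaluation on a memory bounded by `V` gives at most `V ^ weight`. -/
def Expr.weight : Expr → ℕ
  | .lit k => k + 1
  | .var _ => 1
  | .get _ e => e.weight
  | .bin _ e₁ e₂ => e₁.weight + e₂.weight

/-- All cells that the evaluation reads have index below `S`. -/
def Expr.Idx (S : ℕ) (s : State) : Expr → Prop
  | .lit _ => True
  | .var _ => True
  | .get _ e => e.Idx S s ∧ e.eval s < S
  | .bin _ e₁ e₂ => e₁.Idx S s ∧ e₂.Idx S s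

/-- All numbers in the memory are at most `V`. -/
structure Bdd (V : ℕ) (s : State) : Prop where
  two_le : 2 ≤ V
  var_le : ∀ x, s.var x ≤ V
  arr_le : ∀ a i, s.arr a i ≤ V

/-- The extra 1 in the weight of a constant is needed here: with positive weights each bound `V ^
weight` is at least 2, as `Op.apply_le` requires. -/
theorem Expr.weight_pos (e : Expr) : 1 ≤ e.weight := by
  induction e with
  | lit k => simp [weight]
  | var x => simp [weight]
  | get a e ih => simpa [weight] using ih
  | bin o e₁ e₂ ih₁ ih₂ => simp only [weight]; omega

/-- Sums are dominated by products once both bounds are at least 2, so a product bound serves all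
operations and weights add up. -/
theorem Op.apply_le (o : Op) (x y : ℕ) {X Y : ℕ} (hx : x ≤ X) (hy : y ≤ Y) (hX : 2 ≤ X)
    (hY : 2 ≤ Y) : o.apply x y ≤ X * Y := by
  have h1 : X ≤ X * Y := Nat.le_mul_of_pos_right _ (by omega)
  have h2 : Y ≤ X * Y := Nat.le_mul_of_pos_left _ (by omega)
  have h3 : X + Y ≤ X * Y := by nlinarith
  cases o <;> simp only [Op.apply]
  · omega
  · omega
  · exact Nat.mul_le_mul hx hy
  · exact (Nat.div_le_self _ _).trans (hx.trans h1)
  · exact (Nat.mod_le _ _).trans (hx.trans h1)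
  · split <;> omega
  · split <;> omega

theorem Op.apply_lt_ne_zero {x y : ℕ} : Op.lt.apply x y ≠ 0 ↔ x < y := by
  simp only [Op.apply]; split <;> simp_all

theorem Op.apply_lt_eq_zero {x y : ℕ} : Op.lt.apply x y = 0 ↔ y ≤ x := by
  simp only [Op.apply]; split <;> simp_all

theorem Op.apply_eq_ne_zero {x y : ℕ} : Op.eq.apply x y ≠ 0 ↔ x = y := by
  simp only [Op.apply]; split <;> simp_all

theorem Op.apply_eq_eq_zero {x y : ℕ} : Op.eq.apply x y = 0 ↔ x ≠ y := by
  simp only [Op.apply]; split <;> simp_all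

theorem Expr.eval_le {V : ℕ} {s : State} (h : Bdd V s) (e : Expr) : e.eval s ≤ V ^ e.weight := by
  have hV := h.two_le
  induction e with
  | lit k =>
    calc k ≤ 2 ^ k := Nat.lt_two_pow_self.le
      _ ≤ V ^ k := Nat.pow_le_pow_left hV k
      _ ≤ V ^ (k + 1) := Nat.pow_le_pow_right (by omega) (by omega)
  | var x => simpa [weight, eval] using h.var_le x
  | get a e ih =>
    exact (h.arr_le a _).trans (Nat.le_self_pow (Nat.one_le_iff_ne_zero.mp e.weight_pos) V)
  | bin o e₁ e₂ ih₁ ih₂ =>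
    simp only [weight, eval, pow_add]
    have h1 : V ≤ V ^ e₁.weight := Nat.le_self_pow (Nat.one_le_iff_ne_zero.mp e₁.weight_pos) V
    have h2 : V ≤ V ^ e₂.weight := Nat.le_self_pow (Nat.one_le_iff_ne_zero.mp e₂.weight_pos) V
    exact o.apply_le _ _ ih₁ ih₂ (hV.trans h1) (hV.trans h2)

/-- Subexpressions have no larger weight, so a single exponent covers all intermediate values; only
the array indices remain to be checked. -/
theorem Expr.Idx.safe {S V k : ℕ} {s : State} (h : Bdd V s) {e : Expr} (he : e.Idx S s)
    (hk : e.weight ≤ k) : e.Safe S (V ^ k) s := by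
  have hV := h.two_le
  have key : ∀ e : Expr, e.weight ≤ k → e.eval s ≤ V ^ k := fun e he =>
    (e.eval_le h).trans (Nat.pow_le_pow_right (by omega) he)
  induction e with
  | lit j => exact key (.lit j) hk
  | var x => exact key (.var x) hk
  | get a e ih => exact ⟨ih he.1 hk, he.2, key (.get a e) hk⟩
  | bin o e₁ e₂ ih₁ ih₂ =>
    simp only [weight] at hk
    exact ⟨ih₁ he.1 (by omega), ih₂ he.2 (by omega), key (.bin o e₁ e₂) (by simpa [weight])⟩

namespace Cmd

/-- The maximal weight of the expressions of a program. -/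
def weight : Cmd → ℕ
  | skip => 0
  | assign _ e => e.weight
  | store _ i e => max i.weight e.weight
  | seq c₁ c₂ => max c₁.weight c₂.weight
  | branch e c₁ c₂ => max e.weight (max c₁.weight c₂.weight)
  | loop e c => max e.weight c.weight

/-- The effect of a program without loops. -/
def run : Cmd → State → State
  | skip, s => s
  | assign x e, s => s.setVar x (e.eval s)
  | store a i e, s => s.setArr a (i.eval s) (e.eval s)
  | seq c₁ c₂, s => c₂.run (c₁.run s)
  | branch e c₁ c₂, s => if e.eval s ≠ 0 then c₁.run s else c₂.run s
  | loop _ _, s => s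

/-- The program has no loops, accesses cells with index below `S`, and assigns values at most `V`. -/
def Ok (S V : ℕ) : Cmd → State → Prop
  | skip, _ => True
  | assign _ e, s => e.Idx S s ∧ e.eval s ≤ V
  | store _ i e, s => i.Idx S s ∧ e.Idx S s ∧ i.eval s < S ∧ e.eval s ≤ V
  | seq c₁ c₂, s => c₁.Ok S V s ∧ c₂.Ok S V (c₁.run s)
  | branch e c₁ c₂, s =>
      e.Idx S s ∧ (e.eval s ≠ 0 → c₁.Ok S V s) ∧ (e.eval s = 0 → c₂.Ok S V s)
  | loop _ _, _ => False

/-- A bound for the cost of a program without loops. -/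
def time : Cmd → ℕ
  | skip => 1
  | assign _ e => e.cost + 1
  | store _ i e => i.cost + e.cost + 1
  | seq c₁ c₂ => c₁.time + c₂.time
  | branch e c₁ c₂ => e.cost + 1 + max c₁.time c₂.time
  | loop _ _ => 0

/-- The program may write the variable `x`. -/
def writesVar (x : ℕ) : Cmd → Bool
  | skip => false
  | assign y _ => x == y
  | store _ _ _ => false
  | seq c₁ c₂ => c₁.writesVar x || c₂.writesVar x
  | branch _ c₁ c₂ => c₁.writesVar x || c₂.writesVar x
  | loop _ c => c.writesVar x

/-- The program may write the array `a`. -/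
def writesArr (a : ℕ) : Cmd → Bool
  | skip => false
  | assign _ _ => false
  | store b _ _ => a == b
  | seq c₁ c₂ => c₁.writesArr a || c₂.writesArr a
  | branch _ c₁ c₂ => c₁.writesArr a || c₂.writesArr a
  | loop _ c => c.writesArr a

end Cmd

theorem Exec.var_eq {S W : ℕ} {c : Cmd} {s s' : State} {t : ℕ} (h : Exec S W c s t s') {x : ℕ}
    (hx : c.writesVar x = false) : s'.var x = s.var x := by
  induction h with
  | skip s => rfl
  | assign s y e he =>
    have : x ≠ y := by simpa [Cmd.writesVar] using hx
    simp [State.setVar, this]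
  | store s a i e => rfl
  | seq _ _ ih₁ ih₂ =>
    simp only [Cmd.writesVar, Bool.or_eq_false_iff] at hx
    rw [ih₂ hx.2, ih₁ hx.1]
  | branch_true _ _ _ ih =>
    simp only [Cmd.writesVar, Bool.or_eq_false_iff] at hx
    exact ih hx.1
  | branch_false _ _ _ ih =>
    simp only [Cmd.writesVar, Bool.or_eq_false_iff] at hx
    exact ih hx.2
  | loop_true _ _ _ _ ih₁ ih₂ => rw [ih₂ hx, ih₁ hx]
  | loop_false => rfl

theorem Exec.arr_eq {S W : ℕ} {c : Cmd} {s s' : State} {t : ℕ} (h : Exec S W c s t s') {a : ℕ}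
    (ha : c.writesArr a = false) : s'.arr a = s.arr a := by
  induction h with
  | skip s => rfl
  | assign s y e he => rfl
  | store s b i e =>
    have : a ≠ b := by simpa [Cmd.writesArr] using ha
    simp [State.setArr, this]
  | seq _ _ ih₁ ih₂ =>
    simp only [Cmd.writesArr, Bool.or_eq_false_iff] at ha
    rw [ih₂ ha.2, ih₁ ha.1]
  | branch_true _ _ _ ih =>
    simp only [Cmd.writesArr, Bool.or_eq_false_iff] at ha
    exact ih ha.1
  | branch_false _ _ _ ih =>
    simp only [Cmd.writesArr, Bool.or_eq_false_iff] at ha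
    exact ih ha.2
  | loop_true _ _ _ _ ih₁ ih₂ => rw [ih₂ ha, ih₁ ha]
  | loop_false => rfl

theorem Bdd.setVar {V : ℕ} {s : State} (h : Bdd V s) {x v : ℕ} (hv : v ≤ V) :
    Bdd V (s.setVar x v) :=
  ⟨h.two_le, fun y => by
    simp only [State.setVar, Function.update_apply]; split
    exacts [hv, h.var_le y], h.arr_le⟩

theorem Bdd.setArr {V : ℕ} {s : State} (h : Bdd V s) {a i v : ℕ} (hv : v ≤ V) :
    Bdd V (s.setArr a i v) :=
  ⟨h.two_le, h.var_le, fun b j => by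
    simp only [State.setArr, Function.update_apply]; split
    · simp only [Function.update_apply]; split
      exacts [hv, h.arr_le _ _]
    · exact h.arr_le _ _⟩

/-- Without loops, the effect, the cost and the side conditions are computed by recursion on the
syntax, so that `simp` can reduce them to arithmetic. -/
theorem Cmd.Ok.exec {S V k : ℕ} {c : Cmd} {s : State} (hok : c.Ok S V s) (h : Bdd V s)
    (hk : c.weight ≤ k) :
    ∃ t ≤ c.time, Exec S (V ^ k) c s t (c.run s) ∧ Bdd V (c.run s) := by
  induction c generalizing s with
  | skip => exact ⟨1, le_rfl, .skip s, h⟩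
  | assign x e => exact ⟨_, le_rfl, .assign s x e (hok.1.safe h hk), h.setVar hok.2⟩
  | store a i e =>
    simp only [weight, max_le_iff] at hk
    exact ⟨_, le_rfl, .store s a i e (hok.1.safe h hk.1) hok.2.2.1 (hok.2.1.safe h hk.2),
      h.setArr hok.2.2.2⟩
  | seq c₁ c₂ ih₁ ih₂ =>
    simp only [weight, max_le_iff] at hk
    obtain ⟨t₁, ht₁, he₁, hb₁⟩ := ih₁ hok.1 h hk.1
    obtain ⟨t₂, ht₂, he₂, hb₂⟩ := ih₂ hok.2 hb₁ hk.2
    exact ⟨t₁ + t₂, Nat.add_le_add ht₁ ht₂, .seq he₁ he₂, hb₂⟩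
  | branch e c₁ c₂ ih₁ ih₂ =>
    simp only [weight, max_le_iff] at hk
    obtain ⟨hi, h1, h2⟩ := hok
    have hs := hi.safe (k := k) h hk.1
    by_cases hz : e.eval s = 0
    · obtain ⟨t, ht, he, hb⟩ := ih₂ (h2 hz) h hk.2.2
      have hr : (branch e c₁ c₂).run s = c₂.run s := by simp [run, hz]
      rw [hr]
      exact ⟨_, by simp only [time]; omega, .branch_false hs hz he, hb⟩
    · obtain ⟨t, ht, he, hb⟩ := ih₁ (h1 hz) h hk.2.1
      have hr : (branch e c₁ c₂).run s = c₁.run s := by simp [run, hz]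
      rw [hr]
      exact ⟨_, by simp only [time]; omega, .branch_true hs hz he, hb⟩
  | loop e c => exact hok.elim

/-- On a memory bounded by `V`, the program halts in a memory bounded by `V`, such that the cost
and the final memory satisfy `Q`. -/
def Runs (S V : ℕ) (c : Cmd) (s : State) (Q : ℕ → State → Prop) : Prop :=
  Bdd V s → ∃ t s', Exec S (V ^ 16) c s t s' ∧ Bdd V s' ∧ Q t s'

namespace Runs

variable {S V : ℕ} {c c₁ c₂ : Cmd} {s : State} {Q Q' : ℕ → State → Prop}

/-- The exponent 16 in `Runs` is large enough for the weights of all expressions of the program; for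
concrete code this is decided by evaluation. -/
theorem flat (hok : c.Ok S V s) (hQ : ∀ t ≤ c.time, Q t (c.run s))
    (hk : c.weight ≤ 16 := by decide) : Runs S V c s Q := fun h =>
  let ⟨t, ht, he, hb⟩ := hok.exec h hk
  ⟨t, _, he, hb, hQ t ht⟩

theorem mono (h : Runs S V c s Q) (hQ : ∀ t s', Bdd V s' → Q t s' → Q' t s') :
    Runs S V c s Q' := fun hb =>
  let ⟨t, s', he, hb', hq⟩ := h hb
  ⟨t, s', he, hb', hQ t s' hb' hq⟩

theorem seq (h : Runs S V c₁ s fun t₁ s₁ => Runs S V c₂ s₁ fun t₂ s₂ => Q (t₁ + t₂) s₂) :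
    Runs S V (c₁.seq c₂) s Q := fun hb =>
  let ⟨t₁, _, he₁, hb₁, h₂⟩ := h hb
  let ⟨t₂, s₂, he₂, hb₂, hq⟩ := h₂ hb₁
  ⟨t₁ + t₂, s₂, .seq he₁ he₂, hb₂, hq⟩

theorem branch {e : Expr} (hi : e.Idx S s)
    (h₁ : e.eval s ≠ 0 → Runs S V c₁ s fun t s' => Q (e.cost + 1 + t) s')
    (h₂ : e.eval s = 0 → Runs S V c₂ s fun t s' => Q (e.cost + 1 + t) s')
    (hk : e.weight ≤ 16 := by decide) :
    Runs S V (.branch e c₁ c₂) s Q := fun hb => by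
  by_cases hz : e.eval s = 0
  · obtain ⟨t, s', he, hb', hq⟩ := h₂ hz hb
    exact ⟨_, s', .branch_false (hi.safe hb hk) hz he, hb', hq⟩
  · obtain ⟨t, s', he, hb', hq⟩ := h₁ hz hb
    exact ⟨_, s', .branch_true (hi.safe hb hk) hz he, hb', hq⟩

/-- Loops with an invariant and a potential that pays for the cost. -/
theorem loop {e : Expr} {Inv : State → Prop} (Φ : State → ℕ) (hs : Inv s)
    (hi : ∀ s, Bdd V s → Inv s → e.Idx S s)
    (h : ∀ s, Bdd V s → Inv s → e.eval s ≠ 0 →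
      Runs S V c s fun t s' => Inv s' ∧ e.cost + 1 + t + Φ s' ≤ Φ s)
    (hk : e.weight ≤ 16 := by decide) :
    Runs S V (.loop e c) s
      fun t s' => Inv s' ∧ e.eval s' = 0 ∧ t + Φ s' ≤ Φ s + (e.cost + 1) := by
  intro hb
  -- The guard costs at least one step, so the potential strictly decreases and gives termination
  -- together with the cost.
  induction hn : Φ s using Nat.strong_induction_on generalizing s with
  | _ n ih =>
    by_cases hz : e.eval s = 0
    · exact ⟨_, s, .loop_false ((hi s hb hs).safe hb hk) hz, hb, hs, hz, by omega⟩
    · obtain ⟨t, s₁, he, hb₁, hs₁, ht⟩ := h s hb hs hz hb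
      obtain ⟨t₂, s₂, he₂, hb₂, hs₂, hz₂, ht₂⟩ := ih (Φ s₁) (by omega) hs₁ hb₁ rfl
      exact ⟨_, s₂, .loop_true ((hi s hb hs).safe hb hk) hz he he₂, hb₂, hs₂, hz₂, by omega⟩

/-- What a program cannot write is read off its syntax by computation, so specifications need to
mention only the cells that change. -/
theorem frame (h : Runs S V c s Q) :
    Runs S V c s fun t s' => Q t s' ∧ (∀ x, c.writesVar x = false → s'.var x = s.var x) ∧
      ∀ a, c.writesArr a = false → s'.arr a = s.arr a := fun hb =>
  let ⟨t, s', he, hb', hq⟩ := h hb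
  ⟨t, s', he, hb', hq, fun _ hx => he.var_eq hx, fun _ ha => he.arr_eq ha⟩

end Runs

end RAM


section Colouring

open Filter

/-! ### Colourings of weak automata given by transition tables -/

/-- The run from the state `x` on the word `w` for the transition function `T`. -/
def tableRun (T : ℕ → ℕ → ℕ) (x : ℕ) (w : ℕ → ℕ) : ℕ → ℕ
  | 0 => x
  | i + 1 => T (tableRun T x w i) (w i)

/-- There is a transition from `x` to `y` under a letter below `L`. -/
def TableEdge (T : ℕ → ℕ → ℕ) (L x y : ℕ) : Prop := ∃ l < L, T x l = y

/-- The word `w` is accepted from the state `x`. -/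
def TableAccepts (T : ℕ → ℕ → ℕ) (acc : ℕ → Prop) (x : ℕ) (w : ℕ → ℕ) : Prop :=
  ∃ᶠ i in atTop, acc (tableRun T x w i)

/-- The same words over the letters below `L` are accepted from `x` and from `y`. -/
def TableEquiv (T : ℕ → ℕ → ℕ) (L : ℕ) (acc : ℕ → Prop) (x y : ℕ) : Prop :=
  ∀ w : ℕ → ℕ, (∀ i, w i < L) → (TableAccepts T acc x w ↔ TableAccepts T acc y w)

/-- A table of a weak automaton with states below `N` and letters below `L`. -/
structure IsWeakTable (T : ℕ → ℕ → ℕ) (N L : ℕ) (acc : ℕ → Prop) : Prop where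
  pos : 0 < L
  lt : ∀ x < N, ∀ l < L, T x l < N
  weak : ∀ x < N, ∀ y < N, Relation.TransGen (TableEdge T L) x y →
    Relation.TransGen (TableEdge T L) y x → (acc x ↔ acc y)

/-- The number of alternations between accepting and rejecting cycles that a run can still make. -/
structure IsColouring (T : ℕ → ℕ → ℕ) (N L : ℕ) (acc : ℕ → Prop) (c : ℕ → ℕ) : Prop where
  anti : ∀ x < N, ∀ l < L, c (T x l) ≤ c x
  parity : ∀ x < N, Relation.TransGen (TableEdge T L) x x → (Odd (c x) ↔ acc x)
  witness : ∀ x < N, 1 ≤ c x → ∃ r, Relation.ReflTransGen (TableEdge T L) x r ∧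
    Relation.TransGen (TableEdge T L) r r ∧ (Odd (c x) ↔ acc r) ∧
    (2 ≤ c x → ∃ y, Relation.ReflTransGen (TableEdge T L) r y ∧ c y + 1 = c x)

section

variable {T : ℕ → ℕ → ℕ} {N L : ℕ} {acc : ℕ → Prop} {c : ℕ → ℕ}

theorem tableRun_add (x : ℕ) (w : ℕ → ℕ) (i j : ℕ) :
    tableRun T x w (i + j) = tableRun T (tableRun T x w i) (fun k => w (i + k)) j := by
  induction j with
  | zero => rfl
  | succ j ih => rw [← add_assoc, tableRun, ih, tableRun]

theorem tableRun_congr {x : ℕ} {w w' : ℕ → ℕ} {i : ℕ} (h : ∀ j < i, w j = w' j) :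
    tableRun T x w i = tableRun T x w' i := by
  induction i with
  | zero => rfl
  | succ i ih =>
    rw [tableRun, tableRun, ih fun j hj => h j (by omega), h i (by omega)]

theorem tableAccepts_tableRun (x : ℕ) (w : ℕ → ℕ) (i : ℕ) :
    TableAccepts T acc (tableRun T x w i) (fun k => w (i + k)) ↔ TableAccepts T acc x w := by
  simp only [TableAccepts, ← tableRun_add, frequently_atTop]
  constructor
  · intro h a
    obtain ⟨b, hb, hacc⟩ := h a
    exact ⟨i + b, by omega, hacc⟩
  · intro h a
    obtain ⟨b, hb, hacc⟩ := h (i + a)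
    exact ⟨b - i, by omega, by rwa [show i + (b - i) = b by omega]⟩

theorem TableEquiv.step {x y l : ℕ} (h : TableEquiv T L acc x y) (hl : l < L) :
    TableEquiv T L acc (T x l) (T y l) := by
  intro w hw
  have := h (fun i => if i = 0 then l else w (i - 1)) (fun i => by split; exacts [hl, hw _])
  rw [← tableAccepts_tableRun x _ 1, ← tableAccepts_tableRun y _ 1] at this
  simpa [tableRun] using this

theorem TableEquiv.tableRun {x y : ℕ} {w : ℕ → ℕ} (h : TableEquiv T L acc x y)
    (hw : ∀ i, w i < L) (i : ℕ) : TableEquiv T L acc (tableRun T x w i) (tableRun T y w i) := by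
  induction i with
  | zero => exact h
  | succ i ih => exact ih.step (hw i)

theorem transGen_tableRun (x : ℕ) {w : ℕ → ℕ} (hw : ∀ i, w i < L) {i j : ℕ} (hij : i < j) :
    Relation.TransGen (TableEdge T L) (tableRun T x w i) (tableRun T x w j) := by
  induction j, hij using Nat.le_induction with
  | base => exact .single ⟨w i, hw i, rfl⟩
  | succ j _ ih => exact ih.tail ⟨w j, hw j, rfl⟩

theorem reflTransGen_tableRun (x : ℕ) {w : ℕ → ℕ} (hw : ∀ i, w i < L) (i : ℕ) :
    Relation.ReflTransGen (TableEdge T L) x (tableRun T x w i) := by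
  induction i with
  | zero => exact .refl
  | succ i ih => exact ih.tail ⟨w i, hw i, rfl⟩

theorem exists_tableRun_of_reflTransGen (hL : 0 < L) {x y : ℕ}
    (h : Relation.ReflTransGen (TableEdge T L) x y) :
    ∃ w m, (∀ i, w i < L) ∧ tableRun T x w m = y := by
  induction h with
  | refl => exact ⟨fun _ => 0, 0, fun _ => hL, rfl⟩
  | tail _ he ih =>
    obtain ⟨w, m, hw, rfl⟩ := ih
    obtain ⟨l, hl, rfl⟩ := he
    refine ⟨fun i => if i < m then w i else l, m + 1, fun i => ?_, ?_⟩
    · dsimp only; split; exacts [hw _, hl]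
    · rw [tableRun, tableRun_congr (w' := w) fun j hj => by simp [hj]]
      simp

theorem exists_tableRun_of_transGen (hL : 0 < L) {x y : ℕ}
    (h : Relation.TransGen (TableEdge T L) x y) :
    ∃ w m, (∀ i, w i < L) ∧ 0 < m ∧ tableRun T x w m = y := by
  obtain ⟨z, ⟨l, hl, rfl⟩, hz⟩ := Relation.TransGen.head'_iff.mp h
  obtain ⟨w, m, hw, rfl⟩ := exists_tableRun_of_reflTransGen hL hz
  refine ⟨fun i => if i = 0 then l else w (i - 1), 1 + m, fun i => ?_, by omega, ?_⟩
  · dsimp only; split; exacts [hl, hw _]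
  · rw [tableRun_add]
    simp [tableRun]

theorem IsWeakTable.tableRun_lt (h : IsWeakTable T N L acc) {x : ℕ} (hx : x < N) {w : ℕ → ℕ}
    (hw : ∀ i, w i < L) (i : ℕ) : tableRun T x w i < N := by
  induction i with
  | zero => exact hx
  | succ i ih => exact h.lt _ ih _ (hw i)

theorem IsWeakTable.lt_of_reflTransGen (h : IsWeakTable T N L acc) {x y : ℕ} (hx : x < N)
    (hxy : Relation.ReflTransGen (TableEdge T L) x y) : y < N := by
  obtain ⟨w, m, hw, rfl⟩ := exists_tableRun_of_reflTransGen h.pos hxy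
  exact h.tableRun_lt hx hw m

/-- If a run returns to its first state infinitely often, then this state decides. -/
theorem IsWeakTable.tableAccepts_iff (h : IsWeakTable T N L acc) {x : ℕ} (hx : x < N) {w : ℕ → ℕ}
    (hw : ∀ i, w i < L) (hr : ∀ i, ∃ j > i, tableRun T x w j = x) :
    TableAccepts T acc x w ↔ acc x := by
  have key : ∀ i, acc (tableRun T x w i) ↔ acc x := by
    intro i
    obtain ⟨j, hj, hjx⟩ := hr i
    rcases Nat.eq_zero_or_pos i with rfl | hi
    · rfl
    · refine h.weak _ (h.tableRun_lt hx hw i) _ hx ?_ (transGen_tableRun x hw hi)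
      have := transGen_tableRun (T := T) x hw hj
      rwa [hjx] at this
  simp [TableAccepts, key]

/-- Repeat the loop word for ever. The run from `r` returns after each round. The run from `q` takes
at most `N` values at the ends of rounds, so two of them agree, and from the first of these on it
returns as well. -/
theorem exists_returning_of_loop (h : IsWeakTable T N L acc) {q r : ℕ} (hq : q < N) {w : ℕ → ℕ}
    (hw : ∀ i, w i < L) {m : ℕ} (hm : 0 < m) (hr : tableRun T r w m = r) :
    ∃ w' i, (∀ i, w' i < L) ∧ tableRun T r w' i = r ∧ (∀ i, ∃ j > i, tableRun T r w' j = r) ∧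
      ∀ k, ∃ j > k, tableRun T (tableRun T q w' i) w' j = tableRun T q w' i := by
  set w' : ℕ → ℕ := fun i => w (i % m) with hw'
  have hper : ∀ k, (fun i => w' (k * m + i)) = w' := fun k => by
    funext i
    simp [hw', Nat.add_comm (k * m), Nat.add_mul_mod_self_right]
  have hadd : ∀ x k j, tableRun T x w' (k * m + j) = tableRun T (tableRun T x w' (k * m)) w' j :=
    fun x k j => by rw [tableRun_add, hper]
  have hloop : ∀ k, tableRun T r w' (k * m) = r := by
    intro k
    induction k with
    | zero => simp [tableRun]
    | succ k ih =>
      rw [Nat.succ_mul, hadd, ih]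
      exact (tableRun_congr fun j hj => by simp [hw', Nat.mod_eq_of_lt hj]).trans hr
  obtain ⟨i, -, j, -, hij, he⟩ := Finset.exists_ne_map_eq_of_card_lt_of_maps_to
    (s := Finset.range (N + 1)) (t := Finset.range N) (by simp)
    (f := fun k => tableRun T q w' (k * m))
    (fun k _ => by simpa using h.tableRun_lt hq (fun i => hw _) _)
  wlog hlt : i < j generalizing i j
  · exact this j i hij.symm he.symm (by omega)
  refine ⟨w', i * m, fun _ => hw _, hloop i, fun k => ⟨(k + 1) * m, by nlinarith, hloop _⟩, ?_⟩
  have hone : tableRun T (tableRun T q w' (i * m)) w' ((j - i) * m) = tableRun T q w' (i * m) := by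
    rw [← hadd, ← Nat.add_mul, show i + (j - i) = j by omega]
    exact he.symm
  have hall : ∀ k, tableRun T (tableRun T q w' (i * m)) w' (k * (j - i) * m) =
      tableRun T q w' (i * m) := by
    intro k
    induction k with
    | zero => simp [tableRun]
    | succ k ih => rw [Nat.succ_mul, Nat.add_mul, hadd, ih, hone]
  intro k
  refine ⟨(k + 1) * (j - i) * m, ?_, hall _⟩
  have h1 : 1 ≤ (j - i) * m := Nat.mul_pos (by omega) hm
  rw [Nat.mul_assoc]
  nlinarith

theorem IsColouring.anti_reflTransGen (hc : IsColouring T N L acc c) (h : IsWeakTable T N L acc)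
    {x y : ℕ} (hx : x < N) (hxy : Relation.ReflTransGen (TableEdge T L) x y) : c y ≤ c x := by
  induction hxy with
  | refl => rfl
  | tail hxz he ih =>
    obtain ⟨l, hl, rfl⟩ := he
    exact (hc.anti _ (h.lt_of_reflTransGen hx hxz) l hl).trans ih

/-- Follow from `q` the word that leads from `p` to its witness `r`, and then the loop of `r` until
the run from `q` also lies on a cycle, at `q₂`. Since `r` and `q₂` are equivalent and both
recurrent, they agree on acceptance, so `c q₂` has the parity of `c p`. A state of colour `c p - 1`
below `r` has an equivalent partner below `q₂`, so by induction `c q₂ ≥ c p - 1`, and the parity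
excludes equality. -/
theorem IsColouring.le_of_tableEquiv (hc : IsColouring T N L acc c) (h : IsWeakTable T N L acc)
    {p q : ℕ} (hp : p < N) (hq : q < N) (he : TableEquiv T L acc p q) : c p ≤ c q := by
  induction hk : c p using Nat.strong_induction_on generalizing p q with
  | _ k ih =>
    rcases Nat.eq_zero_or_pos k with rfl | hpos
    · exact Nat.zero_le _
    obtain ⟨r, hpr, hrr, hodd, hry⟩ := hc.witness p hp (by omega)
    have hr := h.lt_of_reflTransGen hp hpr
    obtain ⟨w, m, hw, rfl⟩ := exists_tableRun_of_reflTransGen h.pos hpr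
    obtain ⟨w₁, m₁, hw₁, hm₁, hloop⟩ := exists_tableRun_of_transGen h.pos hrr
    have hq₁ := h.tableRun_lt hq hw m
    obtain ⟨w', i, hw', hri, hret, hret'⟩ := exists_returning_of_loop h hq₁ hw₁ hm₁ hloop
    have he₁ := (he.tableRun hw m).tableRun hw' i
    rw [hri] at he₁
    set r := tableRun T p w m
    set q₂ := tableRun T (tableRun T q w m) w' i with hq₂
    have hq₂N : q₂ < N := h.tableRun_lt hq₁ hw' i
    -- Both runs on `w'` return to their first states for ever, so by weakness these states decide
    -- acceptance of `w'`.
    have hacc : acc r ↔ acc q₂ := by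
      rw [← h.tableAccepts_iff hr hw' hret, ← h.tableAccepts_iff hq₂N hw' hret']
      exact he₁ w' hw'
    have hrec : Relation.TransGen (TableEdge T L) q₂ q₂ := by
      obtain ⟨j, hj, hjq⟩ := hret' 0
      have := transGen_tableRun (T := T) q₂ hw' hj
      rwa [hjq] at this
    have hpar : Odd (c q₂) ↔ Odd k := by
      rw [hc.parity q₂ hq₂N hrec, ← hacc, ← hodd, hk]
    have hge : k ≤ c q₂ + 1 := by
      rcases Nat.lt_or_ge k 2 with hk2 | hk2
      · omega
      obtain ⟨y, hry, hy⟩ := hry (by omega)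
      obtain ⟨w₂, m₂, hw₂, rfl⟩ := exists_tableRun_of_reflTransGen h.pos hry
      have hz : c (tableRun T q₂ w₂ m₂) ≤ c q₂ :=
        hc.anti_reflTransGen h hq₂N (reflTransGen_tableRun q₂ hw₂ m₂)
      have := ih _ (by omega) (h.tableRun_lt hr hw₂ m₂) (h.tableRun_lt hq₂N hw₂ m₂)
        (he₁.tableRun hw₂ m₂) rfl
      omega
    -- Only `c q₂ = k - 1` is left to exclude, and it has the wrong parity.
    have hfin : k ≤ c q₂ := by
      rcases Nat.lt_or_ge (c q₂) k with hlt | hge'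
      · have : k = c q₂ + 1 := by omega
        rw [this, Nat.odd_add_one] at hpar
        tauto
      · exact hge'
    refine hfin.trans (hc.anti_reflTransGen h hq ?_)
    exact (reflTransGen_tableRun q hw m).trans (reflTransGen_tableRun _ hw' i)

theorem IsColouring.eq_of_tableEquiv (hc : IsColouring T N L acc c) (h : IsWeakTable T N L acc)
    {p q : ℕ} (hp : p < N) (hq : q < N) (he : TableEquiv T L acc p q) : c p = c q :=
  (hc.le_of_tableEquiv h hp hq he).antisymm
    (hc.le_of_tableEquiv h hq hp fun w hw => (he w hw).symm)

/-- From some time on, a run visits only states that it visits infinitely often. These lie on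
cycles, where odd colour and acceptance coincide. -/
theorem IsColouring.tableAccepts_iff (hc : IsColouring T N L acc c) (h : IsWeakTable T N L acc)
    {x : ℕ} (hx : x < N) {w : ℕ → ℕ} (hw : ∀ i, w i < L) :
    TableAccepts T acc x w ↔ ∃ᶠ i in atTop, Odd (c (tableRun T x w i)) := by
  have hev : ∀ᶠ i in atTop, ∀ s ∈ Finset.range N, tableRun T x w i = s →
      ∃ᶠ j in atTop, tableRun T x w j = s := by
    rw [Finset.eventually_all]
    intro s _
    by_cases hs : ∃ᶠ j in atTop, tableRun T x w j = s
    · simp [hs]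
    · rw [not_frequently] at hs
      filter_upwards [hs] with i hi h using absurd h hi
  refine frequently_congr ?_
  filter_upwards [hev] with i hi
  have hlt := h.tableRun_lt hx hw i
  obtain ⟨j, hij, hj⟩ := (frequently_atTop'.mp (hi _ (Finset.mem_range.mpr hlt) rfl)) i
  have := transGen_tableRun (T := T) x hw hij
  rw [hj] at this
  exact (hc.parity _ hlt this).symm

/-- States that are identified by a congruence which respects a colouring are equivalent. -/
theorem IsColouring.tableEquiv_of_congruence (hc : IsColouring T N L acc c)
    (h : IsWeakTable T N L acc) {R : ℕ → ℕ → Prop} (hRc : ∀ x y, R x y → c x = c y)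
    (hR : ∀ x y, R x y → ∀ l < L, R (T x l) (T y l)) {x y : ℕ} (hx : x < N) (hy : y < N)
    (hxy : R x y) : TableEquiv T L acc x y := by
  intro w hw
  have hrun : ∀ i, R (tableRun T x w i) (tableRun T y w i) := by
    intro i
    induction i with
    | zero => exact hxy
    | succ i ih => exact hR _ _ ih _ (hw i)
  simp only [hc.tableAccepts_iff h hx hw, hc.tableAccepts_iff h hy hw, hRc _ _ (hrun _)]

end

end Colouring


/-! ### Strongly connected components and colours: the algorithm on an abstract memory -/

/-- The memory of the depth-first search. `st x` is `0` if `x` has not been visited, `p + 1` if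
`x` has position `p` on the stack `S`, and `N + 1` if `x` has been removed from the stack. The
stack `C` holds the states that have unexplored transitions, `Bd` the positions on `S` where the
strongly connected parts of the search path begin; for each part, `M` is the greatest colour of
a removed target and `NT` tells whether the part is known to contain a cycle. -/
structure Scc where
  R : ℕ
  s : ℕ
  c : ℕ
  t : ℕ
  st : ℕ → ℕ
  S : ℕ → ℕ
  C : ℕ → ℕ
  Bd : ℕ → ℕ
  M : ℕ → ℕ
  NT : ℕ → ℕ
  ptr : ℕ → ℕ
  col : ℕ → ℕ

namespace Scc

/-- The position `p` belongs to part `j` of the search path. -/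
def Part (σ : Scc) (j p : ℕ) : Prop := σ.Bd j ≤ p ∧ ∀ k < σ.t, j < k → p < σ.Bd k

/-- The invariant of the search. -/
structure Inv (T : ℕ → ℕ → ℕ) (N L : ℕ) (acc : ℕ → Prop) (σ : Scc) : Prop where
  s_le : σ.s ≤ N
  S_lt : ∀ p < σ.s, σ.S p < N
  st_S : ∀ p < σ.s, σ.st (σ.S p) = p + 1
  st_le : ∀ x < N, σ.st x ≠ N + 1 → σ.st x ≤ σ.s
  S_st : ∀ x < N, σ.st x ≠ 0 → σ.st x ≠ N + 1 → σ.S (σ.st x - 1) = x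
  Bd_lt : ∀ j < σ.t, σ.Bd j < σ.s
  Bd_mono : ∀ i j, i < j → j < σ.t → σ.Bd i < σ.Bd j
  Bd_zero : 0 < σ.s → 0 < σ.t ∧ σ.Bd 0 = 0
  C_lt : ∀ i < σ.c, σ.C i < N
  st_C : ∀ i < σ.c, σ.st (σ.C i) ≠ 0 ∧ σ.st (σ.C i) ≠ N + 1
  C_mono : ∀ i j, i < j → j < σ.c → σ.st (σ.C i) < σ.st (σ.C j)
  Bd_mem : ∀ j < σ.t, ∃ i < σ.c, σ.C i = σ.S (σ.Bd j)
  exhausted : ∀ p < σ.s, σ.ptr (σ.S p) = L ∨ ∃ i < σ.c, σ.C i = σ.S p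
  ptr_le : ∀ x < N, σ.ptr x ≤ L
  ptr_zero : ∀ x < N, σ.st x = 0 → σ.ptr x = 0
  edge : ∀ p < σ.s, ∀ l < σ.ptr (σ.S p), ∀ j < σ.t, σ.Bd j ≤ p → σ.Bd j < σ.st (T (σ.S p) l)
  edge_le : ∀ p < σ.s, ∀ l < σ.ptr (σ.S p), σ.st (T (σ.S p) l) ≠ N + 1 →
    ∀ k < σ.t, p < σ.Bd k → σ.st (T (σ.S p) l) ≤ σ.Bd k
  edge_M : ∀ j < σ.t, ∀ p < σ.s, σ.Part j p → ∀ l < σ.ptr (σ.S p),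
    σ.st (T (σ.S p) l) = N + 1 → σ.col (T (σ.S p) l) ≤ σ.M j
  edge_NT : ∀ j < σ.t, ∀ p < σ.s, σ.Part j p → ∀ l < σ.ptr (σ.S p), σ.NT j = 0 →
    σ.st (T (σ.S p) l) = N + 1
  reach : ∀ p < σ.s, ∀ p' < σ.s, (∀ j < σ.t, σ.Bd j ≤ p → σ.Bd j ≤ p') →
    Relation.ReflTransGen (TableEdge T L) (σ.S p) (σ.S p')
  loop : ∀ j < σ.t, σ.NT j ≠ 0 → ∀ p < σ.s, σ.Part j p →
    Relation.TransGen (TableEdge T L) (σ.S p) (σ.S p)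
  M_mem : ∀ j < σ.t, σ.M j ≠ 0 → ∃ p < σ.s, σ.Part j p ∧ ∃ y < N, σ.st y = N + 1 ∧
    σ.col y = σ.M j ∧ Relation.ReflTransGen (TableEdge T L) (σ.S p) y
  closed : ∀ x < N, σ.st x = N + 1 → ∀ l < L, σ.st (T x l) = N + 1 ∧ σ.col (T x l) ≤ σ.col x
  parity : ∀ x < N, σ.st x = N + 1 → Relation.TransGen (TableEdge T L) x x →
    (Odd (σ.col x) ↔ acc x)
  witness : ∀ x < N, σ.st x = N + 1 → 1 ≤ σ.col x →
    ∃ r, Relation.ReflTransGen (TableEdge T L) x r ∧ Relation.TransGen (TableEdge T L) r r ∧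
      (Odd (σ.col x) ↔ acc r) ∧ (2 ≤ σ.col x →
        ∃ y < N, σ.st y = N + 1 ∧ Relation.ReflTransGen (TableEdge T L) r y ∧ σ.col y + 1 = σ.col x)
  R_le : σ.R ≤ N
  roots : ∀ x < σ.R, σ.st x = N + 1

variable {T : ℕ → ℕ → ℕ} {N L : ℕ} {acc : ℕ → Prop} {σ : Scc}

/-- A new state `x` is visited. -/
def push (σ : Scc) (x : ℕ) : Scc :=
  { σ with
    s := σ.s + 1
    c := σ.c + 1
    t := σ.t + 1
    st := Function.update σ.st x (σ.s + 1)
    S := Function.update σ.S σ.s x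
    C := Function.update σ.C σ.c x
    Bd := Function.update σ.Bd σ.t σ.s
    M := Function.update σ.M σ.t 0
    NT := Function.update σ.NT σ.t 0 }

/-- A transition from `v` to a removed state `w` is explored. -/
def exploreRemoved (σ : Scc) (v w : ℕ) : Scc :=
  { σ with
    M := Function.update σ.M (σ.t - 1) (max (σ.M (σ.t - 1)) (σ.col w))
    ptr := Function.update σ.ptr v (σ.ptr v + 1) }

/-- A transition from `v` into the last part is explored. -/
def exploreInner (σ : Scc) (v : ℕ) : Scc :=
  { σ with
    NT := Function.update σ.NT (σ.t - 1) 1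
    ptr := Function.update σ.ptr v (σ.ptr v + 1) }

/-- The last two parts are merged. -/
def merge (σ : Scc) : Scc :=
  { σ with
    M := Function.update σ.M (σ.t - 2) (max (σ.M (σ.t - 2)) (σ.M (σ.t - 1)))
    NT := Function.update σ.NT (σ.t - 2) 1
    t := σ.t - 1 }

/-- The last part becomes a strongly connected component of colour `k`. -/
def remove (N k : ℕ) (σ : Scc) : Scc :=
  { σ with
    st := fun y => if y < N ∧ σ.Bd (σ.t - 1) < σ.st y ∧ σ.st y ≤ σ.s then N + 1 else σ.st y
    col := fun y => if y < N ∧ σ.Bd (σ.t - 1) < σ.st y ∧ σ.st y ≤ σ.s then k else σ.col y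
    s := σ.Bd (σ.t - 1)
    c := σ.c - 1
    t := σ.t - 1 }

namespace Inv

/-- The base of the last part is on the stack `C`, which is sorted by position on `S`; hence the top
of `C` lies in the last part. -/
theorem top (h : σ.Inv T N L acc) (hc : 0 < σ.c) :
    0 < σ.t ∧ 0 < σ.s ∧ σ.Bd (σ.t - 1) < σ.st (σ.C (σ.c - 1)) ∧
      σ.st (σ.C (σ.c - 1)) ≤ σ.s ∧ σ.S (σ.st (σ.C (σ.c - 1)) - 1) = σ.C (σ.c - 1) := by
  have h1 := h.C_lt (σ.c - 1) (by omega)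
  have h2 := h.st_C (σ.c - 1) (by omega)
  have h3 := h.st_le _ h1 h2.2
  have hs : 0 < σ.s := by omega
  obtain ⟨ht, -⟩ := h.Bd_zero hs
  refine ⟨ht, hs, ?_, h3, h.S_st _ h1 h2.1 h2.2⟩
  obtain ⟨i, hi, hiS⟩ := h.Bd_mem (σ.t - 1) (by omega)
  have h4 := h.st_S _ (h.Bd_lt (σ.t - 1) (by omega))
  rw [← hiS] at h4
  rcases Nat.lt_or_ge i (σ.c - 1) with hlt | hge
  · have := h.C_mono i (σ.c - 1) hlt (by omega)
    omega
  · have : i = σ.c - 1 := by omega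
    subst this
    omega

theorem s_eq_zero (h : σ.Inv T N L acc) (hc : σ.c = 0) : σ.s = 0 := by
  by_contra hs
  obtain ⟨ht, -⟩ := h.Bd_zero (by omega)
  obtain ⟨i, hi, -⟩ := h.Bd_mem 0 ht
  omega

theorem Bd_le (h : σ.Inv T N L acc) {j : ℕ} (hj : j < σ.t) : σ.Bd j ≤ σ.Bd (σ.t - 1) := by
  rcases Nat.lt_or_ge j (σ.t - 1) with hlt | hge
  · exact (h.Bd_mono _ _ hlt (by omega)).le
  · rw [show j = σ.t - 1 by omega]

theorem le_Bd (h : σ.Inv T N L acc) {j : ℕ} (hj : j < σ.t) : j ≤ σ.Bd j := by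
  induction j with
  | zero => omega
  | succ j ih => have := h.Bd_mono j (j + 1) (by omega) hj; have := ih (by omega); omega

theorem t_le (h : σ.Inv T N L acc) : σ.t ≤ σ.s := by
  rcases Nat.eq_zero_or_pos σ.t with ht | ht
  · omega
  · have := h.le_Bd (j := σ.t - 1) (by omega)
    have := h.Bd_lt (σ.t - 1) (by omega)
    omega

theorem c_le (h : σ.Inv T N L acc) : σ.c ≤ σ.s := by
  have key : ∀ i < σ.c, i < σ.st (σ.C i) := by
    intro i hi
    induction i with
    | zero => have := (h.st_C 0 hi).1; omega
    | succ i ih => have := h.C_mono i (i + 1) (by omega) hi; have := ih (by omega); omega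
  rcases Nat.eq_zero_or_pos σ.c with hc | hc
  · omega
  · have := key (σ.c - 1) (by omega)
    have := (h.top hc).2.2.2.1
    omega

theorem reach_top (h : σ.Inv T N L acc) (hc : 0 < σ.c) {p : ℕ} (hp : p < σ.s) :
    Relation.ReflTransGen (TableEdge T L) (σ.S p) (σ.C (σ.c - 1)) := by
  obtain ⟨ht, hs, h1, h2, h3⟩ := h.top hc
  rw [← h3]
  refine h.reach p hp _ (by omega) fun j hj _ => ?_
  have := h.Bd_le hj
  omega

/-- The positions on the stack hold distinct states, all different from the unvisited `x`. -/
theorem s_lt (h : σ.Inv T N L acc) {x : ℕ} (hx : x < N) (hx0 : σ.st x = 0) : σ.s < N := by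
  have hsub : (Finset.range σ.s).image σ.S ⊆ (Finset.range N).erase x := by
    intro y hy
    simp only [Finset.mem_image, Finset.mem_range, Finset.mem_erase] at hy ⊢
    obtain ⟨p, hp, rfl⟩ := hy
    refine ⟨fun he => ?_, h.S_lt p hp⟩
    have := h.st_S p hp
    rw [he] at this
    omega
  have hcard := Finset.card_le_card hsub
  rw [Finset.card_image_of_injOn, Finset.card_erase_of_mem (Finset.mem_range.mpr hx)] at hcard
  · simp only [Finset.card_range] at hcard
    omega
  · intro p hp q hq hpq
    have h1 := h.st_S p (by simpa using hp)
    have h2 := h.st_S q (by simpa using hq)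
    have hpq' : σ.S p = σ.S q := hpq
    rw [hpq'] at h1
    omega

/-- The transition that led to `x` is not yet counted as explored: its pointer advances only when it
is examined again after the visit of `x`. So the new part starts without explored transitions, and
the conditions on explored transitions concern old ones only. -/
theorem push (h : σ.Inv T N L acc) {x : ℕ} (hx : x < N) (hx0 : σ.st x = 0)
    (hT : ∀ x < N, ∀ l < L, T x l < N)
    (hr : ∀ p < σ.s, Relation.ReflTransGen (TableEdge T L) (σ.S p) x) :
    (σ.push x).Inv T N L acc := by
  have hs := h.s_lt hx hx0
  have hSx : ∀ p < σ.s, σ.S p ≠ x := fun p hp he => by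
    have := h.st_S p hp
    rw [he] at this; omega
  have hCx : ∀ i < σ.c, σ.C i ≠ x := fun i hi he => by
    have := (h.st_C i hi).1
    rw [he] at this; omega
  have hpx := h.ptr_zero x hx hx0
  set τ := σ.push x with hτ
  have es : τ.s = σ.s + 1 := rfl
  have ec : τ.c = σ.c + 1 := rfl
  have et : τ.t = σ.t + 1 := rfl
  have eS : ∀ p < σ.s, τ.S p = σ.S p := fun p hp => by simp [hτ, Scc.push, hp.ne]
  have eSs : τ.S σ.s = x := by simp [hτ, Scc.push]
  have est : ∀ y, y ≠ x → τ.st y = σ.st y := fun y hy => by simp [hτ, Scc.push, hy]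
  have estx : τ.st x = σ.s + 1 := by simp [hτ, Scc.push]
  have eC : ∀ i < σ.c, τ.C i = σ.C i := fun p hp => by simp [hτ, Scc.push, hp.ne]
  have eCc : τ.C σ.c = x := by simp [hτ, Scc.push]
  have eB : ∀ j < σ.t, τ.Bd j = σ.Bd j := fun p hp => by simp [hτ, Scc.push, hp.ne]
  have eBt : τ.Bd σ.t = σ.s := by simp [hτ, Scc.push]
  have eM : ∀ j < σ.t, τ.M j = σ.M j := fun p hp => by simp [hτ, Scc.push, hp.ne]
  have eMt : τ.M σ.t = 0 := by simp [hτ, Scc.push]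
  have eN : ∀ j < σ.t, τ.NT j = σ.NT j := fun p hp => by simp [hτ, Scc.push, hp.ne]
  have eNt : τ.NT σ.t = 0 := by simp [hτ, Scc.push]
  have ep : τ.ptr = σ.ptr := rfl
  have eR : τ.R = σ.R := rfl
  have ecol : τ.col = σ.col := rfl
  have hpart : ∀ j < σ.t, ∀ p < σ.s, τ.Part j p → σ.Part j p := by
    intro j hj p hp hP
    refine ⟨eB j hj ▸ hP.1, fun k hk hjk => ?_⟩
    rw [← eB k hk]
    exact hP.2 k (by omega) hjk
  have hpart' : ∀ j < σ.t, ∀ p < σ.s, σ.Part j p → τ.Part j p := by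
    intro j hj p hp hP
    refine ⟨(eB j hj).symm ▸ hP.1, fun k hk hjk => ?_⟩
    rcases Nat.lt_succ_iff_lt_or_eq.mp hk with hk | rfl
    · rw [eB k hk]
      exact hP.2 k hk hjk
    · omega
  have hpartt : ∀ p < σ.s, ¬ τ.Part σ.t p := fun p hp hP => by have := hP.1; omega
  have hparts : ∀ j < σ.t, ¬ τ.Part j σ.s := fun j hj hP => by have := hP.2 σ.t (by omega) hj; omega
  have estT : ∀ p < σ.s, ∀ l < σ.ptr (σ.S p), σ.st (T (σ.S p) l) = N + 1 ∨
      τ.st (T (σ.S p) l) ≠ N + 1 := fun p hp l hl => by grind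
  clear_value τ
  constructor
  case s_le => grind
  case S_lt => have := h.S_lt; grind
  case st_S => have := h.st_S; grind
  case st_le => have := h.st_le; grind
  case S_st =>
    intro y hy h0 h1
    by_cases hyx : y = x
    · subst hyx; rw [estx, Nat.add_sub_cancel, eSs]
    · rw [est y hyx] at *
      have := h.st_le y hy h1
      rw [eS _ (by omega), h.S_st y hy h0 h1]
  case Bd_lt => have := h.Bd_lt; grind
  case Bd_mono => have := h.Bd_mono; have := h.Bd_lt; grind
  case Bd_zero => have := h.Bd_zero; have := h.t_le; grind
  case C_lt => have := h.C_lt; grind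
  case st_C => have := h.st_C; grind
  case C_mono =>
    have := h.C_mono; have := h.st_C; have := h.st_le; have := h.C_lt; grind
  case Bd_mem =>
    intro j hj
    rcases Nat.lt_succ_iff_lt_or_eq.mp (et ▸ hj) with hj | rfl
    · obtain ⟨i, hi, he⟩ := h.Bd_mem j hj
      exact ⟨i, by omega, by rw [eC i hi, eB j hj, eS _ (h.Bd_lt j hj), he]⟩
    · exact ⟨σ.c, by omega, by rw [eCc, eBt, eSs]⟩
  case exhausted =>
    intro p hp
    rcases Nat.lt_succ_iff_lt_or_eq.mp (es ▸ hp) with hp | rfl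
    · rw [eS p hp, ep]
      refine (h.exhausted p hp).imp_right fun ⟨i, hi, he⟩ => ⟨i, by omega, by rw [eC i hi, he]⟩
    · exact .inr ⟨σ.c, by omega, by rw [eCc, eSs]⟩
  case ptr_le => have := h.ptr_le; grind
  case ptr_zero => have := h.ptr_zero; grind
  case edge =>
    intro p hp l hl j hj hjp
    rcases Nat.lt_succ_iff_lt_or_eq.mp (es ▸ hp) with hp | rfl
    · rw [eS p hp, ep] at *
      rcases Nat.lt_succ_iff_lt_or_eq.mp (et ▸ hj) with hj | rfl
      · rw [eB j hj] at *
        have h1 := h.edge p hp l hl j hj hjp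
        rcases eq_or_ne (T (σ.S p) l) x with he | he
        · rw [he, hx0] at h1; omega
        · rwa [est _ he]
      · omega
    · rw [ep, eSs, hpx] at hl; omega
  case edge_le =>
    intro p hp l hl hst k hk hpk
    rcases Nat.lt_succ_iff_lt_or_eq.mp (es ▸ hp) with hp | rfl
    · rw [eS p hp, ep] at *
      have hl' := h.ptr_le _ (h.S_lt p hp)
      -- The first part begins at position 0, so `edge` says that targets of explored transitions
      -- have been visited.
      have hne : T (σ.S p) l ≠ x := by
        intro he
        have h0 := h.Bd_zero (by omega)
        have h1 := h.edge p hp l hl 0 h0.1 (by omega)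
        rw [he] at h1
        omega
      rw [est _ hne] at hst ⊢
      rcases Nat.lt_succ_iff_lt_or_eq.mp (et ▸ hk) with hk | rfl
      · rw [eB k hk] at *
        exact h.edge_le p hp l hl hst k hk hpk
      · rw [eBt]
        exact h.st_le _ (hT _ (h.S_lt p hp) l (by omega)) hst
    · rw [ep, eSs, hpx] at hl; omega
  case edge_M =>
    intro j hj p hp hP l hl
    rcases Nat.lt_succ_iff_lt_or_eq.mp (es ▸ hp) with hp | rfl
    · rw [eS p hp, ep] at *
      rcases Nat.lt_succ_iff_lt_or_eq.mp (et ▸ hj) with hj | rfl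
      · have h1 := h.edge_M j hj p hp (hpart j hj p hp hP) l hl
        grind
      · exact absurd hP (hpartt p hp)
    · rw [ep, eSs, hpx] at hl; omega
  case edge_NT =>
    intro j hj p hp hP l hl
    rcases Nat.lt_succ_iff_lt_or_eq.mp (es ▸ hp) with hp | rfl
    · rw [eS p hp, ep] at *
      rcases Nat.lt_succ_iff_lt_or_eq.mp (et ▸ hj) with hj | rfl
      · have h1 := h.edge_NT j hj p hp (hpart j hj p hp hP) l hl
        grind
      · exact absurd hP (hpartt p hp)
    · rw [ep, eSs, hpx] at hl; omega
  case reach =>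
    intro p hp p' hp' hj
    rcases Nat.lt_succ_iff_lt_or_eq.mp (es ▸ hp) with hp | rfl <;>
    rcases Nat.lt_succ_iff_lt_or_eq.mp (es ▸ hp') with hp' | rfl
    · rw [eS p hp, eS p' hp']
      refine h.reach p hp p' hp' fun j hj1 hj2 => ?_
      have := hj j (by omega)
      rw [eB j hj1] at this
      exact this hj2
    · rw [eS p hp, eSs]
      exact hr p hp
    · have := hj σ.t (by omega)
      omega
    · exact .refl
  case loop =>
    intro j hj hn p hp hP
    rcases Nat.lt_succ_iff_lt_or_eq.mp (et ▸ hj) with hj | rfl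
    · rcases Nat.lt_succ_iff_lt_or_eq.mp (es ▸ hp) with hp | rfl
      · rw [eS p hp]
        exact h.loop j hj (eN j hj ▸ hn) p hp (hpart j hj p hp hP)
      · exact absurd hP (hparts j hj)
    · exact absurd eNt hn
  case M_mem =>
    intro j hj hM
    rcases Nat.lt_succ_iff_lt_or_eq.mp (et ▸ hj) with hj | rfl
    · obtain ⟨p, hp, hP, y, hy, hy1, hy2, hy3⟩ := h.M_mem j hj (eM j hj ▸ hM)
      refine ⟨p, by omega, hpart' j hj p hp hP, y, hy, ?_, ?_, ?_⟩
      · rw [est y (by rintro rfl; omega), hy1]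
      · rw [ecol, hy2, eM j hj]
      · rwa [eS p hp]
    · exact absurd eMt hM
  case closed => have := h.closed; grind
  case parity => have := h.parity; grind
  case witness =>
    intro y hy h1 hc1
    have hyx : y ≠ x := by rintro rfl; omega
    rw [est y hyx] at h1
    rw [ecol] at *
    obtain ⟨r, ha, hb, hc, hd⟩ := h.witness y hy h1 hc1
    refine ⟨r, ha, hb, hc, fun h2 => ?_⟩
    obtain ⟨z, hz, hz1, hz2⟩ := hd h2
    exact ⟨z, hz, by rw [est z (by rintro rfl; omega), hz1], hz2⟩
  case R_le => exact eR ▸ h.R_le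
  case roots => have := h.roots; grind

end Inv

end Scc


/-! ### Search steps inside the current search path: exploring, merging, finishing a state -/

namespace Scc

variable {T : ℕ → ℕ → ℕ} {N L : ℕ} {acc : ℕ → Prop} {σ : Scc}

namespace Inv

theorem part_top (h : σ.Inv T N L acc) (hc : 0 < σ.c) :
    σ.Part (σ.t - 1) (σ.st (σ.C (σ.c - 1)) - 1) :=
  ⟨by have := (h.top hc).2.2.1; omega, fun k hk hjk => by omega⟩

theorem eq_of_part_top (h : σ.Inv T N L acc) (hc : 0 < σ.c) {j p : ℕ} (hj : j < σ.t)
    (hp : p < σ.s) (hP : σ.Part j p) (hv : σ.S p = σ.C (σ.c - 1)) : j = σ.t - 1 := by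
  have h1 := (h.top hc).2.2.1
  have h2 := h.st_S p hp
  rw [hv] at h2
  by_contra hne
  have := hP.2 (σ.t - 1) (by omega) (by omega)
  omega

/-- Every state on the stack reaches the top of `C`, the transition leads from there back into the
stack, and its target reaches all positions that do not precede its part. -/
theorem loop_of_back (h : σ.Inv T N L acc) (hc : 0 < σ.c) {l : ℕ} (hl : l < L)
    (hN : T (σ.C (σ.c - 1)) l < N)
    (h0 : σ.st (T (σ.C (σ.c - 1)) l) ≠ 0) (h1 : σ.st (T (σ.C (σ.c - 1)) l) ≠ N + 1) {p p' : ℕ}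
    (hp : p < σ.s) (hp' : p' < σ.s)
    (hj : ∀ j < σ.t, σ.Bd j < σ.st (T (σ.C (σ.c - 1)) l) → σ.Bd j ≤ p') :
    Relation.TransGen (TableEdge T L) (σ.S p) (σ.S p') := by
  refine Relation.TransGen.trans_left (b := T (σ.C (σ.c - 1)) l)
    (Relation.TransGen.tail' (h.reach_top hc hp) ⟨l, hl, rfl⟩) ?_
  have h2 := h.st_le _ hN h1
  have h3 := h.S_st _ hN h0 h1
  have := h.reach (σ.st (T (σ.C (σ.c - 1)) l) - 1) (by omega) p' hp'
    fun j hjt hjb => hj j hjt (by omega)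
  rwa [h3] at this

theorem explored (v : ℕ) {p l : ℕ}
    (hl : l < Function.update σ.ptr v (σ.ptr v + 1) (σ.S p)) :
    l < σ.ptr (σ.S p) ∨ σ.S p = v ∧ l = σ.ptr v := by
  rw [Function.update_apply] at hl
  split at hl
  · rename_i he
    rw [he]
    omega
  · exact .inl hl

/-- Removed states lead only to removed states, so this transition closes no cycle through the
stack. It matters only through the colour of its target, which enters the maximum `M`. -/
theorem exploreRemoved (h : σ.Inv T N L acc) (hT : ∀ x < N, ∀ l < L, T x l < N) (hc : 0 < σ.c)
    {v : ℕ} (hv : v = σ.C (σ.c - 1)) (hl : σ.ptr v < L)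
    (hw : σ.st (T v (σ.ptr v)) = N + 1) :
    (σ.exploreRemoved v (T v (σ.ptr v))).Inv T N L acc := by
  have hvN : v < N := hv ▸ h.C_lt _ (by omega)
  have hst := (h.top hc)
  rw [← hv] at hst
  refine { h with
    exhausted := fun p hp => ?_
    ptr_le := fun x hx => ?_
    ptr_zero := fun x hx hx0 => ?_
    edge := fun p hp l hl' j hj hjp => ?_
    edge_le := fun p hp l hl' hst' k hk hpk => ?_
    edge_M := fun j hj p hp hP l hl' hst' => ?_
    edge_NT := fun j hj p hp hP l hl' hNT => ?_
    M_mem := fun j hj hM => ?_ }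
  · by_cases hpv : σ.S p = v
    · exact .inr ⟨σ.c - 1, by change _ < σ.c; omega, (hpv.trans hv).symm⟩
    · rcases h.exhausted p hp with he | he
      · left
        simpa [Scc.exploreRemoved, hpv] using he
      · exact .inr he
  · have := h.ptr_le x hx
    simp only [Scc.exploreRemoved, Function.update_apply]
    split <;> omega
  · have hne : x ≠ v := by
      rintro rfl
      exact (h.st_C (σ.c - 1) (by omega)).1 (hv ▸ hx0)
    simpa [Scc.exploreRemoved, hne] using h.ptr_zero x hx hx0
  · rcases explored (σ := σ) (p := p) v hl' with hl' | ⟨hpv, rfl⟩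
    · exact h.edge p hp l hl' j hj hjp
    · have h1 := h.Bd_lt j hj
      have h2 := h.s_le
      change σ.Bd j < σ.st (T (σ.S p) (σ.ptr v))
      rw [hpv, hw]
      omega
  · rcases explored (σ := σ) (p := p) v hl' with hl' | ⟨hpv, rfl⟩
    · exact h.edge_le p hp l hl' hst' k hk hpk
    · rw [show (σ.exploreRemoved v (T v (σ.ptr v))).S p = v from hpv] at hst'
      exact absurd hw hst'
  · have hle : σ.M j ≤ (σ.exploreRemoved v (T v (σ.ptr v))).M j := by
      simp only [Scc.exploreRemoved, Function.update_apply]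
      split
      · rename_i hj'; subst hj'; exact le_max_left _ _
      · rfl
    rcases explored (σ := σ) (p := p) v hl' with hl' | ⟨hpv, rfl⟩
    · exact (h.edge_M j hj p hp hP l hl' hst').trans hle
    · have := h.eq_of_part_top hc hj hp hP (hpv.trans hv)
      subst this
      change σ.col (T (σ.S p) (σ.ptr v)) ≤ _
      simp [Scc.exploreRemoved, hpv]
  · rcases explored (σ := σ) (p := p) v hl' with hl' | ⟨hpv, rfl⟩
    · exact h.edge_NT j hj p hp hP l hl' hNT
    · change σ.st (T (σ.S p) (σ.ptr v)) = N + 1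
      rw [hpv, hw]
  -- If the maximum grows, its new witness is the target, one transition away from `v`; otherwise
  -- the old witness remains.
  · by_cases hj' : j = σ.t - 1 ∧ σ.M (σ.t - 1) < σ.col (T v (σ.ptr v))
    · obtain ⟨rfl, hlt⟩ := hj'
      refine ⟨σ.st v - 1, by change _ < σ.s; omega, ?_, T v (σ.ptr v), hT v hvN _ hl, hw, ?_, ?_⟩
      · exact hv ▸ h.part_top hc
      · change σ.col _ = _
        simp [Scc.exploreRemoved, hlt.le]
      · change Relation.ReflTransGen _ (σ.S _) _
        rw [hst.2.2.2.2]
        exact .single ⟨_, hl, rfl⟩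
    · have : (σ.exploreRemoved v (T v (σ.ptr v))).M j = σ.M j := by
        simp only [Scc.exploreRemoved, Function.update_apply]
        split
        · rename_i hj; subst hj; simp at hj'; exact max_eq_left hj'
        · rfl
      rw [this] at hM ⊢
      exact h.M_mem j hj hM

/-- The target lies in the last part, whose states reach each other, so the transition puts all of
them on a cycle. This includes self-loops of a part with one state. -/
theorem exploreInner (h : σ.Inv T N L acc) (hT : ∀ x < N, ∀ l < L, T x l < N) (hc : 0 < σ.c)
    {v : ℕ} (hv : v = σ.C (σ.c - 1)) (hl : σ.ptr v < L)
    (hw : σ.st (T v (σ.ptr v)) ≠ N + 1) (hw' : σ.Bd (σ.t - 1) < σ.st (T v (σ.ptr v))) :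
    (σ.exploreInner v).Inv T N L acc := by
  have hvN : v < N := hv ▸ h.C_lt _ (by omega)
  refine { h with
    exhausted := fun p hp => ?_
    ptr_le := fun x hx => ?_
    ptr_zero := fun x hx hx0 => ?_
    edge := fun p hp l hl' j hj hjp => ?_
    edge_le := fun p hp l hl' hst' k hk hpk => ?_
    edge_M := fun j hj p hp hP l hl' hst' => ?_
    edge_NT := fun j hj p hp hP l hl' hNT => ?_
    loop := fun j hj hNT p hp hP => ?_ }
  · by_cases hpv : σ.S p = v
    · exact .inr ⟨σ.c - 1, by change _ < σ.c; omega, (hpv.trans hv).symm⟩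
    · rcases h.exhausted p hp with he | he
      · left
        simpa [Scc.exploreInner, hpv] using he
      · exact .inr he
  · have := h.ptr_le x hx
    simp only [Scc.exploreInner, Function.update_apply]
    split <;> omega
  · have hne : x ≠ v := by
      rintro rfl
      exact (h.st_C (σ.c - 1) (by omega)).1 (hv ▸ hx0)
    simpa [Scc.exploreInner, hne] using h.ptr_zero x hx hx0
  · rcases explored (σ := σ) (p := p) v hl' with hl' | ⟨hpv, rfl⟩
    · exact h.edge p hp l hl' j hj hjp
    · change σ.Bd j < σ.st (T (σ.S p) (σ.ptr v))
      rw [hpv]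
      exact (h.Bd_le hj).trans_lt hw'
  · rcases explored (σ := σ) (p := p) v hl' with hl' | ⟨hpv, rfl⟩
    · exact h.edge_le p hp l hl' hst' k hk hpk
    · have h1 := h.st_S p hp
      have h2 := (h.top hc).2.2.1
      have : σ.Bd k ≤ _ := h.Bd_le hk
      have hpk : p < σ.Bd k := hpk
      rw [← hv, ← hpv] at h2
      omega
  · rcases explored (σ := σ) (p := p) v hl' with hl' | ⟨hpv, rfl⟩
    · exact h.edge_M j hj p hp hP l hl' hst'
    · rw [show (σ.exploreInner v).S p = v from hpv] at hst'
      exact absurd hst' hw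
  · have hne : j ≠ σ.t - 1 := by
      rintro rfl
      simp [Scc.exploreInner] at hNT
    rcases explored (σ := σ) (p := p) v hl' with hl' | ⟨hpv, rfl⟩
    · refine h.edge_NT j hj p hp hP l hl' ?_
      simpa [Scc.exploreInner, hne] using hNT
    · exact absurd (h.eq_of_part_top hc hj hp hP (hpv.trans hv)) hne
  · by_cases hne : j = σ.t - 1
    · subst hne
      exact h.loop_of_back hc (hv ▸ hl) (hv ▸ hT v hvN _ hl) (by rw [← hv]; omega)
        (by rwa [← hv]) hp hp fun j hj _ => (h.Bd_le hj).trans hP.1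
    · refine h.loop j hj ?_ p hp hP
      simpa [Scc.exploreInner, hne] using hNT

/-- The target lies below the last part, so the last two parts lie on a common cycle. The pointer
does not move: the same transition is examined again until its target lies in the last part, so it
is enough to merge two parts at a time. -/
theorem merge (h : σ.Inv T N L acc) (hT : ∀ x < N, ∀ l < L, T x l < N) (hc : 0 < σ.c)
    {v : ℕ} (hv : v = σ.C (σ.c - 1)) (hl : σ.ptr v < L)
    (hw : σ.st (T v (σ.ptr v)) ≠ 0) (hw' : σ.st (T v (σ.ptr v)) ≤ σ.Bd (σ.t - 1)) :
    2 ≤ σ.t ∧ σ.merge.Inv T N L acc := by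
  have hvN : v < N := hv ▸ h.C_lt _ (by omega)
  obtain ⟨ht0, hs0, -⟩ := h.top hc
  have hB := h.Bd_lt (σ.t - 1) (by omega)
  -- A single part begins at position 0, and then the target would be unvisited.
  have ht : 2 ≤ σ.t := by
    by_contra hcon
    have := (h.Bd_zero hs0).2
    rw [show σ.t - 1 = 0 by omega, this] at hw'
    omega
  refine ⟨ht, ?_⟩
  have hne : σ.st (T v (σ.ptr v)) ≠ N + 1 := by have := h.s_le; omega
  have hB1 := h.Bd_mono (σ.t - 2) (σ.t - 1) (by omega) (by omega)
  have hp1 : ∀ j < σ.t - 2, ∀ p, σ.merge.Part j p → σ.Part j p := fun j hj p hP =>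
    ⟨hP.1, fun k hk hjk => by
      rcases Nat.lt_or_ge k (σ.t - 1) with hlt | hge
      · exact hP.2 k hlt hjk
      · have h1 := hP.2 (σ.t - 2) (by change _ < σ.t - 1; omega) hj
        change p < σ.Bd _ at h1
        rw [show k = σ.t - 1 by omega]
        omega⟩
  have hp1' : ∀ j < σ.t, ∀ p, σ.Part j p → σ.merge.Part j p := fun j hj p hP =>
    ⟨hP.1, fun k hk hjk => hP.2 k (by change k < σ.t - 1 at hk; omega) hjk⟩
  have hp2 : ∀ p, σ.merge.Part (σ.t - 2) p → σ.Part (σ.t - 2) p ∨ σ.Part (σ.t - 1) p := by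
    intro p hP
    rcases Nat.lt_or_ge p (σ.Bd (σ.t - 1)) with hlt | hge
    · exact .inl ⟨hP.1, fun k hk hjk => by rwa [show k = σ.t - 1 by omega]⟩
    · exact .inr ⟨hge, fun k hk hjk => by omega⟩
  have hp2' : ∀ p, σ.Part (σ.t - 1) p → σ.merge.Part (σ.t - 2) p := fun p hP =>
    ⟨hB1.le.trans hP.1, fun k hk hjk => by change k < σ.t - 1 at hk; omega⟩
  have hM1 : ∀ j < σ.t - 2, σ.merge.M j = σ.M j := fun j hj => by simp [Scc.merge, hj.ne]
  have hM2 : σ.merge.M (σ.t - 2) = max (σ.M (σ.t - 2)) (σ.M (σ.t - 1)) := by simp [Scc.merge]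
  have hN1 : ∀ j < σ.t - 2, σ.merge.NT j = σ.NT j := fun j hj => by simp [Scc.merge, hj.ne]
  have hN2 : σ.merge.NT (σ.t - 2) = 1 := by simp [Scc.merge]
  have hcase : ∀ j < σ.merge.t, j < σ.t - 2 ∨ j = σ.t - 2 := fun j hj => by
    change j < σ.t - 1 at hj; omega
  have hlt : ∀ j < σ.merge.t, j < σ.t := fun j hj => by change j < σ.t - 1 at hj; omega
  refine { h with
    Bd_lt := fun j hj => h.Bd_lt j (hlt j hj)
    Bd_mono := fun i j hij hj => h.Bd_mono i j hij (hlt j hj)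
    Bd_zero := fun hs => ⟨by change 0 < σ.t - 1; omega, (h.Bd_zero hs).2⟩
    Bd_mem := fun j hj => h.Bd_mem j (hlt j hj)
    edge := fun p hp l hl j hj => h.edge p hp l hl j (hlt j hj)
    edge_le := fun p hp l hl hst k hk => h.edge_le p hp l hl hst k (hlt k hk)
    edge_M := fun j hj p hp hP l hl hst => ?_
    edge_NT := fun j hj p hp hP l hl hNT => ?_
    reach := fun p hp p' hp' hjp => ?_
    loop := fun j hj hNT p hp hP => ?_
    M_mem := fun j hj hM => ?_ }
  · rcases hcase j hj with hj' | rfl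
    · rw [hM1 j hj']
      exact h.edge_M j (by omega) p hp (hp1 j hj' p hP) l hl hst
    · rw [hM2]
      rcases hp2 p hP with hP | hP
      · exact (h.edge_M _ (by omega) p hp hP l hl hst).trans (le_max_left _ _)
      · exact (h.edge_M _ (by omega) p hp hP l hl hst).trans (le_max_right _ _)
  · rcases hcase j hj with hj' | rfl
    · rw [hN1 j hj'] at hNT
      exact h.edge_NT j (by omega) p hp (hp1 j hj' p hP) l hl hNT
    · omega
  -- The only new claim is that the upper of the two parts reaches the lower one; it does so through
  -- `v` and its transition.
  · by_cases hq : σ.Bd (σ.t - 1) ≤ p ∧ p' < σ.Bd (σ.t - 1)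
    · refine (h.loop_of_back hc (hv ▸ hl) (hv ▸ hT v hvN _ hl) (by rwa [← hv])
        (by rwa [← hv]) hp hp' fun j hj hb => ?_).to_reflTransGen
      rw [← hv] at hb
      have hj1 : j ≠ σ.t - 1 := by rintro rfl; omega
      have : σ.Bd j ≤ σ.Bd (σ.t - 1) := h.Bd_le hj
      exact hjp j (by change j < σ.t - 1; omega) (by change σ.Bd j ≤ p; omega)
    · refine h.reach p hp p' hp' fun j hj hb => ?_
      rcases Nat.lt_or_ge j (σ.t - 1) with hj1 | hj1
      · exact hjp j hj1 hb
      · rw [show j = σ.t - 1 by omega] at hb ⊢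
        omega
  · rcases hcase j hj with hj' | rfl
    · exact h.loop j (by omega) (hN1 j hj' ▸ hNT) p hp (hp1 j hj' p hP)
    · refine h.loop_of_back hc (hv ▸ hl) (hv ▸ hT v hvN _ hl) (by rwa [← hv])
        (by rwa [← hv]) hp hp fun j hj hb => ?_
      rw [← hv] at hb
      have hj1 : j ≠ σ.t - 1 := by rintro rfl; omega
      have h1 : σ.Bd (σ.t - 2) ≤ p := hP.1
      rcases Nat.lt_or_ge j (σ.t - 2) with hj2 | hj2
      · have := h.Bd_mono j (σ.t - 2) hj2 (by omega)
        omega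
      · rwa [show j = σ.t - 2 by omega]
  · rcases hcase j hj with hj' | rfl
    · rw [hM1 j hj'] at hM ⊢
      obtain ⟨p, hp, hP, hy⟩ := h.M_mem j (by omega) hM
      exact ⟨p, hp, hp1' j (by omega) p hP, hy⟩
    · rw [hM2] at hM ⊢
      rcases le_total (σ.M (σ.t - 1)) (σ.M (σ.t - 2)) with hle | hle
      · rw [max_eq_left hle] at hM ⊢
        obtain ⟨p, hp, hP, hy⟩ := h.M_mem _ (by omega) hM
        exact ⟨p, hp, hp1' _ (by omega) p hP, hy⟩
      · rw [max_eq_right hle] at hM ⊢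
        obtain ⟨p, hp, hP, hy⟩ := h.M_mem _ (by omega) hM
        exact ⟨p, hp, hp2' p hP, hy⟩

/-- The state `v` is exhausted but is not the base of its part. It leaves the stack of pending
states and stays on `S` until the whole part is removed. -/
theorem pop (h : σ.Inv T N L acc) (hc : 0 < σ.c) {v : ℕ} (hv : v = σ.C (σ.c - 1))
    (hl : σ.ptr v = L) (hlt : σ.Bd (σ.t - 1) + 1 < σ.st v) :
    { σ with c := σ.c - 1 }.Inv T N L acc := by
  refine { h with
    C_lt := fun i hi => h.C_lt i (by change i < σ.c - 1 at hi; omega)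
    st_C := fun i hi => h.st_C i (by change i < σ.c - 1 at hi; omega)
    C_mono := fun i j hij hj => h.C_mono i j hij (by change j < σ.c - 1 at hj; omega)
    Bd_mem := fun j hj => ?_
    exhausted := fun p hp => ?_ }
  · obtain ⟨i, hi, he⟩ := h.Bd_mem j hj
    refine ⟨i, ?_, he⟩
    have hne : i ≠ σ.c - 1 := by
      rintro rfl
      have h1 := h.st_S _ (h.Bd_lt j hj)
      rw [← he, ← hv] at h1
      have := h.Bd_le hj
      omega
    change i < σ.c - 1
    omega
  · rcases h.exhausted p hp with he | ⟨i, hi, he⟩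
    · exact .inl he
    · by_cases hne : i = σ.c - 1
      · subst hne
        rw [← hv] at he
        exact .inl (he ▸ hl)
      · exact .inr ⟨i, by change i < σ.c - 1; omega, he⟩

/-- Between two searches the stack is empty, so a visited state must have been removed. -/
theorem nextRoot (h : σ.Inv T N L acc) (hc : σ.c = 0) (hR : σ.R < N) (hst : σ.st σ.R ≠ 0) :
    { σ with R := σ.R + 1 }.Inv T N L acc := by
  refine { h with R_le := hR, roots := fun x hx => ?_ }
  rcases Nat.lt_succ_iff_lt_or_eq.mp hx with hx | rfl
  · exact h.roots x hx
  · by_contra hne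
    have := h.st_le _ hR hne
    rw [h.s_eq_zero hc] at this
    exact hst (by omega)

end Inv

end Scc


/-! ### Removal of a completed strongly connected component -/

namespace Scc

variable {T : ℕ → ℕ → ℕ} {N L : ℕ} {acc : ℕ → Prop} {σ : Scc}

namespace Inv

/-- The state `v` is at once the base of the last part and the highest pending state, so no other
state of the part is pending. -/
theorem exhausted_top (h : σ.Inv T N L acc) (hc : 0 < σ.c) {v : ℕ} (hv : v = σ.C (σ.c - 1))
    (hl : σ.ptr v = L) (hβ : σ.st v = σ.Bd (σ.t - 1) + 1) {p : ℕ} (hp : p < σ.s)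
    (hβp : σ.Bd (σ.t - 1) ≤ p) : σ.ptr (σ.S p) = L := by
  rcases h.exhausted p hp with he | ⟨i, hi, he⟩
  · exact he
  · have h1 := h.st_S p hp
    rw [← he] at h1
    by_cases hne : i = σ.c - 1
    · rw [← he, hne, ← hv, hl]
    · have := h.C_mono i (σ.c - 1) (by omega) (by omega)
      rw [← hv] at this
      omega

theorem not_removed_of_reflTransGen (h : σ.Inv T N L acc) (hT : ∀ x < N, ∀ l < L, T x l < N)
    {x y : ℕ} (hx : x < N) (hst : σ.st x = N + 1)
    (hxy : Relation.ReflTransGen (TableEdge T L) x y) : y < N ∧ σ.st y = N + 1 := by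
  induction hxy with
  | refl => exact ⟨hx, hst⟩
  | tail _ he ih =>
    obtain ⟨l, hl, rfl⟩ := he
    exact ⟨hT _ ih.1 l hl, (h.closed _ ih.1 ih.2 l hl).1⟩

/-- All transitions of the last part are explored, and by `edge` they lead into the part or to
removed states; so the part is a full strongly connected component and the removed states remain
closed. The colour cannot be below `M`. If it equals `M`, the witness of a removed target is
inherited; if it is `M + 1`, then `v`, which lies on a cycle, is the witness, and a target of colour
`M` provides the next lower colour. -/
theorem remove (h : σ.Inv T N L acc) (hT : IsWeakTable T N L acc) (hc : 0 < σ.c)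
    {v k : ℕ} (hv : v = σ.C (σ.c - 1)) (hl : σ.ptr v = L) (hβ : σ.st v = σ.Bd (σ.t - 1) + 1)
    (hk : k = σ.M (σ.t - 1) ∨ k = σ.M (σ.t - 1) + 1 ∧ σ.NT (σ.t - 1) ≠ 0)
    (hacc : σ.NT (σ.t - 1) ≠ 0 → (Odd k ↔ acc v)) :
    (σ.remove N k).Inv T N L acc := by
  have hvN : v < N := hv ▸ h.C_lt _ (by omega)
  obtain ⟨ht0, hs0, htop⟩ := h.top hc
  rw [← hv] at htop
  have hsN := h.s_le
  have hB := h.Bd_lt (σ.t - 1) (by omega)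
  have hexh := fun p hp hβp => h.exhausted_top hc hv hl hβ (p := p) hp hβp
  set β := σ.Bd (σ.t - 1) with hβdef
  have hBdlt : ∀ j < σ.t - 1, σ.Bd j < β := fun j hj => h.Bd_mono j _ hj (by omega)
  set τ := σ.remove N k with hτ
  have es : τ.s = β := rfl
  have ec : τ.c = σ.c - 1 := rfl
  have et : τ.t = σ.t - 1 := rfl
  have est : ∀ y, ¬ (β < σ.st y ∧ σ.st y ≤ σ.s) → τ.st y = σ.st y := fun y hy => by
    simp only [hτ, Scc.remove, ← hβdef, if_neg (not_and_of_not_right _ hy)]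
  have est' : ∀ y < N, (β < σ.st y ∧ σ.st y ≤ σ.s) → τ.st y = N + 1 := fun y hyN hy => by
    simp only [hτ, Scc.remove, ← hβdef, if_pos (And.intro hyN hy)]
  have ecol : ∀ y, ¬ (β < σ.st y ∧ σ.st y ≤ σ.s) → τ.col y = σ.col y := fun y hy => by
    simp only [hτ, Scc.remove, ← hβdef, if_neg (not_and_of_not_right _ hy)]
  have ecol' : ∀ y < N, (β < σ.st y ∧ σ.st y ≤ σ.s) → τ.col y = k := fun y hyN hy => by
    simp only [hτ, Scc.remove, ← hβdef, if_pos (And.intro hyN hy)]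
  have eS : τ.S = σ.S := rfl
  have eC : τ.C = σ.C := rfl
  have eB : τ.Bd = σ.Bd := rfl
  have eM : τ.M = σ.M := rfl
  have eN : τ.NT = σ.NT := rfl
  have ep : τ.ptr = σ.ptr := rfl
  have eR : τ.R = σ.R := rfl
  have hlow : ∀ p < β, τ.st (σ.S p) = p + 1 := fun p hp => by
    have := h.st_S p (by omega)
    rw [est _ (by omega), this]
  have hold : ∀ y, σ.st y = N + 1 → τ.st y = N + 1 := fun y hy => by
    rw [est _ (by omega), hy]
  have holdc : ∀ y, σ.st y = N + 1 → τ.col y = σ.col y := fun y hy => ecol _ (by omega)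
  have hnew : ∀ y < N, τ.st y = N + 1 → σ.st y = N + 1 ∨
      (β < σ.st y ∧ σ.st y ≤ σ.s) ∧ β ≤ σ.st y - 1 ∧ σ.st y - 1 < σ.s ∧
        σ.S (σ.st y - 1) = y := fun y hy hst => by
    by_cases hcase : β < σ.st y ∧ σ.st y ≤ σ.s
    · exact .inr ⟨hcase, by omega, by omega, h.S_st y hy (by omega) (by omega)⟩
    · exact .inl (est y hcase ▸ hst)
  have hpart : ∀ j < σ.t - 1, ∀ p < β, τ.Part j p → σ.Part j p := fun j hj p hp hP =>
    ⟨hP.1, fun k hk hjk => by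
      rcases Nat.lt_or_ge k (σ.t - 1) with hlt | hge
      · exact hP.2 k hlt hjk
      · rwa [show k = σ.t - 1 by omega]⟩
  have hpart' : ∀ j < σ.t - 1, ∀ p, σ.Part j p → τ.Part j p ∧ p < β := fun j hj p hP =>
    ⟨⟨hP.1, fun k hk hjk => hP.2 k (by omega) hjk⟩, hP.2 _ (by omega) hj⟩
  have hparttop : ∀ p, β ≤ p → σ.Part (σ.t - 1) p := fun p hp => ⟨hp, fun k hk hjk => by omega⟩
  have hreach : ∀ p < σ.s, ∀ p' < σ.s, β ≤ p' →
      Relation.ReflTransGen (TableEdge T L) (σ.S p) (σ.S p') := fun p hp p' hp' hβp =>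
    h.reach p hp p' hp' fun j hj _ => (h.Bd_le hj).trans hβp
  clear_value τ
  constructor
  case s_le => omega
  case S_lt => exact fun p hp => eS ▸ h.S_lt p (by omega)
  case st_S => exact fun p hp => by rw [eS]; exact hlow p (by omega)
  case st_le =>
    intro x hx hst
    by_cases hcase : β < σ.st x ∧ σ.st x ≤ σ.s
    · exact absurd (est' x hx hcase) hst
    · rw [est x hcase] at hst ⊢
      have := h.st_le x hx hst
      omega
  case S_st =>
    intro x hx h0 hst
    by_cases hcase : β < σ.st x ∧ σ.st x ≤ σ.s
    · exact absurd (est' x hx hcase) hst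
    · rw [est x hcase] at *
      exact eS ▸ h.S_st x hx h0 hst
  case Bd_lt => exact fun j hj => by rw [eB, es]; exact hBdlt j (by omega)
  case Bd_mono => exact fun i j hij hj => by rw [eB]; exact h.Bd_mono i j hij (by omega)
  case Bd_zero =>
    intro hs
    have h0 := (h.Bd_zero hs0).2
    refine ⟨?_, eB ▸ h0⟩
    rcases Nat.lt_or_ge 1 σ.t with h1 | h1
    · omega
    · rw [show σ.t - 1 = 0 by omega] at hβdef
      omega
  case C_lt => exact fun i hi => eC ▸ h.C_lt i (by omega)
  case st_C =>
    intro i hi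
    have h1 := h.st_C i (by omega)
    have h2 := h.C_mono i (σ.c - 1) (by omega) (by omega)
    rw [← hv] at h2
    rw [eC, est _ (by omega)]
    exact h1
  case C_mono =>
    intro i j hij hj
    have h1 := h.C_mono i j hij (by omega)
    have h2 := h.C_mono j (σ.c - 1) (by omega) (by omega)
    rw [← hv] at h2
    rw [eC, est _ (by omega), est _ (by omega)]
    exact h1
  case Bd_mem =>
    intro j hj
    obtain ⟨i, hi, he⟩ := h.Bd_mem j (by omega)
    refine ⟨i, ?_, by rw [eC, eS, eB, he]⟩
    have hne : i ≠ σ.c - 1 := by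
      rintro rfl
      have h1 := h.st_S _ (h.Bd_lt j (by omega))
      rw [← he, ← hv] at h1
      have := hBdlt j (by omega)
      omega
    omega
  case exhausted =>
    intro p hp
    rw [eS, ep, eC]
    rcases h.exhausted p (by omega) with he | ⟨i, hi, he⟩
    · exact .inl he
    · refine .inr ⟨i, ?_, he⟩
      have hne : i ≠ σ.c - 1 := by
        rintro rfl
        have h1 := h.st_S p (by omega)
        rw [← he, ← hv] at h1
        omega
      omega
  case ptr_le => exact ep ▸ h.ptr_le
  case ptr_zero =>
    intro x hx hst
    by_cases hcase : β < σ.st x ∧ σ.st x ≤ σ.s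
    · rw [est' x hx hcase] at hst
      omega
    · rw [ep]
      exact h.ptr_zero x hx (est x hcase ▸ hst)
  case edge =>
    intro p hp l hl' j hj hjp
    rw [eS, eB, ep] at *
    have h1 := h.edge p (by omega) l hl' j (by omega) hjp
    by_cases hcase : β < σ.st (T (σ.S p) l) ∧ σ.st (T (σ.S p) l) ≤ σ.s
    · rw [est' _ (hT.lt _ (h.S_lt p (by omega)) l (by have := h.ptr_le _ (h.S_lt p (by omega)); omega)) hcase]
      have := hBdlt j (by omega)
      omega
    · rwa [est _ hcase]
  case edge_le =>
    intro p hp l hl' hst k hk hpk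
    rw [eS, eB, ep] at *
    by_cases hcase : β < σ.st (T (σ.S p) l) ∧ σ.st (T (σ.S p) l) ≤ σ.s
    · exact absurd (est' _ (hT.lt _ (h.S_lt p (by omega)) l (by have := h.ptr_le _ (h.S_lt p (by omega)); omega)) hcase) hst
    · rw [est _ hcase] at *
      exact h.edge_le p (by omega) l hl' hst k (by omega) hpk
  case edge_M =>
    intro j hj p hp hP l hl' hst
    rw [eS, eM, ep] at *
    have hP := hpart j (by omega) p (by omega) hP
    have hpL := h.ptr_le _ (h.S_lt p (by omega))
    rcases hnew _ (hT.lt _ (h.S_lt p (by omega)) l (by omega)) hst with hst | ⟨hcase, -⟩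
    · rw [holdc _ hst]
      exact h.edge_M j (by omega) p (by omega) hP l hl' hst
    -- A newly removed target would lie in the last part, but by `edge_le` explored transitions from
    -- earlier parts do not lead there.
    · have := h.edge_le p (by omega) l hl' (by omega) (σ.t - 1) (by omega) (by omega)
      omega
  case edge_NT =>
    intro j hj p hp hP l hl' hNT
    rw [eS, eN, ep] at *
    exact hold _ (h.edge_NT j (by omega) p (by omega) (hpart j (by omega) p (by omega) hP) l hl' hNT)
  case reach =>
    intro p hp p' hp' hj
    rw [eS, eB, et] at *
    refine h.reach p (by omega) p' (by omega) fun j hjt hb => ?_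
    rcases Nat.lt_or_ge j (σ.t - 1) with hlt | hge
    · exact hj j hlt hb
    · rw [show j = σ.t - 1 by omega] at hb
      omega
  case loop =>
    intro j hj hNT p hp hP
    rw [eS]
    exact h.loop j (by omega) (eN ▸ hNT) p (by omega) (hpart j (by omega) p (by omega) hP)
  case M_mem =>
    intro j hj hM
    rw [eM] at *
    obtain ⟨p, hp, hP, y, hy, hst, hcol, hr⟩ := h.M_mem j (by omega) hM
    have := hpart' j (by omega) p hP
    exact ⟨p, by omega, this.1, y, hy, hold y hst, by rw [holdc y hst, hcol], eS ▸ hr⟩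
  case closed =>
    intro x hx hst l hlL
    have hTN := hT.lt x hx l hlL
    rcases hnew x hx hst with hst | ⟨hcase, h1, h2, h3⟩
    · obtain ⟨h4, h5⟩ := h.closed x hx hst l hlL
      exact ⟨hold _ h4, by rw [holdc _ h4, holdc _ hst]; exact h5⟩
    · have hpL := hexh _ h2 h1
      have h4 := h.edge _ h2 l (by omega) (σ.t - 1) (by omega) h1
      have h5 := h.edge_M (σ.t - 1) (by omega) _ h2 (hparttop _ h1) l (by omega)
      rw [h3] at h4 h5
      rw [ecol' x hx hcase]
      by_cases hfin : σ.st (T x l) = N + 1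
      · refine ⟨hold _ hfin, ?_⟩
        rw [holdc _ hfin]
        have := h5 hfin
        omega
      · have hc2 : β < σ.st (T x l) ∧ σ.st (T x l) ≤ σ.s := ⟨h4, h.st_le _ hTN hfin⟩
        exact ⟨est' _ hTN hc2, (ecol' _ hTN hc2).le⟩
  case parity =>
    intro x hx hst hxx
    rcases hnew x hx hst with hst | ⟨hcase, h1, h2, h3⟩
    · rw [holdc _ hst]
      exact h.parity x hx hst hxx
    -- Otherwise all successors of the part were removed before, and the cycle through `x` could not
    -- come back.
    · have hNT : σ.NT (σ.t - 1) ≠ 0 := by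
        intro hNT
        obtain ⟨z, ⟨l, hlL, rfl⟩, hz⟩ := Relation.TransGen.head'_iff.mp hxx
        have hpL := hexh _ h2 h1
        have h5 := h.edge_NT (σ.t - 1) (by omega) _ h2 (hparttop _ h1) l (by omega) hNT
        rw [h3] at h5
        have := (h.not_removed_of_reflTransGen hT.lt (hT.lt x hx l hlL) h5 hz).2
        omega
      rw [ecol' x hx hcase, hacc hNT]
      have hxv := hreach (σ.st x - 1) h2 (σ.st v - 1) (by omega) (by omega)
      have hvx := hreach (σ.st v - 1) (by omega) (σ.st x - 1) h2 h1
      rw [h3, htop.2.2] at hxv hvx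
      rcases Relation.reflTransGen_iff_eq_or_transGen.mp hxv with he | hxv
      · rw [he]
      rcases Relation.reflTransGen_iff_eq_or_transGen.mp hvx with he | hvx
      · rw [he]
      exact hT.weak v hvN x hx hvx hxv
  case witness =>
    intro x hx hst hcol
    have hwit : ∀ x < N, σ.st x = N + 1 → 1 ≤ σ.col x → ∃ r,
        Relation.ReflTransGen (TableEdge T L) x r ∧ Relation.TransGen (TableEdge T L) r r ∧
        (Odd (σ.col x) ↔ acc r) ∧ (2 ≤ σ.col x → ∃ y < N, τ.st y = N + 1 ∧
          Relation.ReflTransGen (TableEdge T L) r y ∧ τ.col y + 1 = σ.col x) := by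
      intro x hx hst hcol
      obtain ⟨r, ha, hb, hc', hd⟩ := h.witness x hx hst hcol
      refine ⟨r, ha, hb, hc', fun h2 => ?_⟩
      obtain ⟨y, hy, hy1, hy2, hy3⟩ := hd h2
      exact ⟨y, hy, hold y hy1, hy2, by rw [holdc y hy1, hy3]⟩
    rcases hnew x hx hst with hst | ⟨hcase, h1, h2, h3⟩
    · rw [holdc x hst] at *
      exact hwit x hx hst hcol
    · rw [ecol' x hx hcase] at *
      rcases hk with hk | ⟨hk, hNT⟩
      · obtain ⟨p, hp, hP, y, hy, hst, hcy, hr⟩ := h.M_mem (σ.t - 1) (by omega) (by omega)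
        obtain ⟨r, ha, hb, hc', hd⟩ := hwit y hy hst (by omega)
        have hxp := hreach (σ.st x - 1) h2 p hp hP.1
        rw [h3] at hxp
        rw [hcy, ← hk] at hc' hd
        exact ⟨r, (hxp.trans hr).trans ha, hb, hc', hd⟩
      · have hvv := h.loop (σ.t - 1) (by omega) hNT (σ.st v - 1) (by omega) (hparttop _ (by omega))
        have hxv := hreach (σ.st x - 1) h2 (σ.st v - 1) (by omega) (by omega)
        rw [htop.2.2] at hvv hxv
        rw [h3] at hxv
        refine ⟨v, hxv, hvv, hacc hNT, fun hk2 => ?_⟩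
        obtain ⟨p, hp, hP, y, hy, hst, hcy, hr⟩ := h.M_mem (σ.t - 1) (by omega) (by omega)
        have hvp := hreach (σ.st v - 1) (by omega) p hp hP.1
        rw [htop.2.2] at hvp
        exact ⟨y, hy, hold y hst, hvp.trans hr, by rw [holdc y hst, hcy, hk]⟩
  case R_le => exact eR ▸ h.R_le
  case roots => exact fun x hx => hold x (h.roots x (eR ▸ hx))

theorem isColouring (h : σ.Inv T N L acc) (hR : N ≤ σ.R) : IsColouring T N L acc σ.col where
  anti x hx l hl := (h.closed x hx (h.roots x (by omega)) l hl).2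
  parity x hx := h.parity x hx (h.roots x (by omega))
  witness x hx hc := by
    obtain ⟨r, ha, hb, hc', hd⟩ := h.witness x hx (h.roots x (by omega)) hc
    refine ⟨r, ha, hb, hc', fun h2 => ?_⟩
    obtain ⟨y, -, -, hy, hy'⟩ := hd h2
    exact ⟨y, hy, hy'⟩

end Inv

end Scc


/-! ### Amortized cost of the search -/

namespace Scc

variable {T : ℕ → ℕ → ℕ} {N L : ℕ} {acc : ℕ → Prop} {σ : Scc}

/-- A bound for the number of steps that remain. -/
def potential (N L : ℕ) (σ : Scc) : ℕ :=
  ∑ x ∈ Finset.range N, (L - σ.ptr x + if σ.st x = 0 then 4 else 0) + σ.c + σ.t + σ.s + (N - σ.R)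

theorem sum_add_le_sum_of_update {f g : ℕ → ℕ} {x k : ℕ} (hx : x < N) (hk : g x + k ≤ f x)
    (h : ∀ y < N, y ≠ x → g y ≤ f y) :
    ∑ y ∈ Finset.range N, g y + k ≤ ∑ y ∈ Finset.range N, f y := by
  rw [← Finset.add_sum_erase _ f (Finset.mem_range.mpr hx),
    ← Finset.add_sum_erase _ g (Finset.mem_range.mpr hx)]
  have : ∑ y ∈ (Finset.range N).erase x, g y ≤ ∑ y ∈ (Finset.range N).erase x, f y :=
    Finset.sum_le_sum fun y hy => by
      rw [Finset.mem_erase, Finset.mem_range] at hy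
      exact h y hy.2 hy.1
  omega

theorem potential_eq (σ : Scc) : σ.potential N L =
    ∑ x ∈ Finset.range N, (L - σ.ptr x + if σ.st x = 0 then 4 else 0) +
      σ.c + σ.t + σ.s + (N - σ.R) := rfl

/-- The weight 4 of an unvisited state pays for its entries on the three stacks and leaves one unit
for the step. -/
theorem potential_push {x : ℕ} (hx : x < N) (hx0 : σ.st x = 0) :
    (σ.push x).potential N L + 1 ≤ σ.potential N L := by
  have := sum_add_le_sum_of_update (N := N) (k := 4) hx
    (f := fun y => L - σ.ptr y + if σ.st y = 0 then 4 else 0)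
    (g := fun y => L - (σ.push x).ptr y + if (σ.push x).st y = 0 then 4 else 0)
    (by simp [push, hx0]) (fun y _ hy => by simp [push, hy])
  have h1 : (σ.push x).c = σ.c + 1 := rfl
  have h2 : (σ.push x).t = σ.t + 1 := rfl
  have h3 : (σ.push x).s = σ.s + 1 := rfl
  have h4 : (σ.push x).R = σ.R := rfl
  rw [potential_eq, potential_eq, h1, h2, h3, h4]
  omega

theorem potential_explore {M NT : ℕ → ℕ} {v : ℕ} (hv : v < N) (hl : σ.ptr v < L) :
    { σ with M := M, NT := NT, ptr := Function.update σ.ptr v (σ.ptr v + 1) }.potential N L + 1 ≤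
      σ.potential N L := by
  have := sum_add_le_sum_of_update (N := N) (k := 1) hv
    (f := fun x => L - σ.ptr x + if σ.st x = 0 then 4 else 0)
    (g := fun x => L - Function.update σ.ptr v (σ.ptr v + 1) x + if σ.st x = 0 then 4 else 0)
    (by simp only [Function.update_self]; omega) (fun y _ hy => by simp [hy])
  have h1 : { σ with
      M := M, NT := NT, ptr := Function.update σ.ptr v (σ.ptr v + 1) }.potential N L =
    ∑ x ∈ Finset.range N, (L - Function.update σ.ptr v (σ.ptr v + 1) x +
      if σ.st x = 0 then 4 else 0) + σ.c + σ.t + σ.s + (N - σ.R) := rfl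
  rw [potential_eq σ, h1]
  omega

theorem potential_exploreRemoved {v w : ℕ} (hv : v < N) (hl : σ.ptr v < L) :
    (σ.exploreRemoved v w).potential N L + 1 ≤ σ.potential N L :=
  potential_explore (NT := σ.NT) hv hl

theorem potential_exploreInner {v : ℕ} (hv : v < N) (hl : σ.ptr v < L) :
    (σ.exploreInner v).potential N L + 1 ≤ σ.potential N L :=
  potential_explore (M := σ.M) hv hl

theorem potential_merge (ht : 2 ≤ σ.t) : σ.merge.potential N L + 1 ≤ σ.potential N L := by
  have : σ.merge.potential N L = ∑ x ∈ Finset.range N, (L - σ.ptr x + if σ.st x = 0 then 4 else 0) +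
      σ.c + (σ.t - 1) + σ.s + (N - σ.R) := rfl
  rw [this, potential_eq]
  omega

/-- The height of the stack is part of the potential, so the inner loop of a removal is paid by the
states that it takes away. -/
theorem potential_remove {k : ℕ} (hc : 0 < σ.c) (ht : 0 < σ.t) (hs : σ.Bd (σ.t - 1) < σ.s) :
    (σ.remove N k).potential N L + 1 + (σ.s - σ.Bd (σ.t - 1)) ≤ σ.potential N L := by
  have : ∑ x ∈ Finset.range N, (L - (σ.remove N k).ptr x +
      if (σ.remove N k).st x = 0 then 4 else 0) ≤
      ∑ x ∈ Finset.range N, (L - σ.ptr x + if σ.st x = 0 then 4 else 0) := by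
    refine Finset.sum_le_sum fun x _ => ?_
    have h0 : (σ.remove N k).st x = 0 ↔ σ.st x = 0 := by
      simp only [remove]
      split <;> omega
    simp only [h0]
    rfl
  have h1 : (σ.remove N k).c = σ.c - 1 := rfl
  have h2 : (σ.remove N k).t = σ.t - 1 := rfl
  have h3 : (σ.remove N k).s = σ.Bd (σ.t - 1) := rfl
  have h4 : (σ.remove N k).R = σ.R := rfl
  rw [potential_eq, potential_eq, h1, h2, h3, h4]
  omega

end Scc

/-! ### The search as a machine program -/

namespace RAM

open RAM.Expr RAM.Cmd

infixr:60 " ;; " => Cmd.seq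

/-- The memory of the search: the variables `11,…,14` and the arrays `4,…,11`. -/
def State.scc (s : State) : Scc where
  R := s.var 11
  s := s.var 12
  c := s.var 13
  t := s.var 14
  st := s.arr 4
  S := s.arr 5
  C := s.arr 6
  Bd := s.arr 7
  M := s.arr 8
  NT := s.arr 9
  ptr := s.arr 10
  col := s.arr 11

/-- Visit the state that is stored in the variable `x`. -/
def sccPush (x : ℕ) : Cmd :=
  store 4 (var x) (bin .add (var 12) (lit 1)) ;;
  store 5 (var 12) (var x) ;;
  store 6 (var 13) (var x) ;;
  store 7 (var 14) (var 12) ;;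
  store 8 (var 14) (lit 0) ;;
  store 9 (var 14) (lit 0) ;;
  assign 12 (bin .add (var 12) (lit 1)) ;;
  assign 13 (bin .add (var 13) (lit 1)) ;;
  assign 14 (bin .add (var 14) (lit 1))

/-- Explore a transition from the state in the variable `15` to the removed one in `16`. -/
def sccRemoved : Cmd :=
  branch (bin .lt (get 8 (bin .sub (var 14) (lit 1))) (get 11 (var 16)))
    (store 8 (bin .sub (var 14) (lit 1)) (get 11 (var 16))) skip ;;
  store 10 (var 15) (bin .add (get 10 (var 15)) (lit 1))

/-- Explore a transition from the state in the variable `15` into the last part. -/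
def sccInner : Cmd :=
  store 9 (bin .sub (var 14) (lit 1)) (lit 1) ;;
  store 10 (var 15) (bin .add (get 10 (var 15)) (lit 1))

/-- Merge the last two parts. -/
def sccMerge : Cmd :=
  branch (bin .lt (get 8 (bin .sub (var 14) (lit 2))) (get 8 (bin .sub (var 14) (lit 1))))
    (store 8 (bin .sub (var 14) (lit 2)) (get 8 (bin .sub (var 14) (lit 1)))) skip ;;
  store 9 (bin .sub (var 14) (lit 2)) (lit 1) ;;
  assign 14 (bin .sub (var 14) (lit 1))

/-- The colour of the last part. -/
def sccColour : Cmd :=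
  assign 18 (get 8 (bin .sub (var 14) (lit 1))) ;;
  branch (get 9 (bin .sub (var 14) (lit 1)))
    (branch (bin .eq (bin .mod (var 18) (lit 2)) (get 3 (var 15))) skip
      (assign 18 (bin .add (var 18) (lit 1)))) skip

/-- Take a state from the stack. -/
def sccUnstack : Cmd :=
  assign 12 (bin .sub (var 12) (lit 1)) ;;
  store 11 (get 5 (var 12)) (var 18) ;;
  store 4 (get 5 (var 12)) (bin .add (var 6) (lit 1))

/-- Remove the last part. -/
def sccRemove : Cmd :=
  sccColour ;;
  loop (bin .lt (get 7 (bin .sub (var 14) (lit 1))) (var 12)) sccUnstack ;;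
  assign 13 (bin .sub (var 13) (lit 1)) ;;
  assign 14 (bin .sub (var 14) (lit 1))

/-- A step at a transition of the state in the variable `15`. -/
def sccExplore : Cmd :=
  assign 16 (get 2 (bin .add (bin .mul (var 15) (var 7)) (get 10 (var 15)))) ;;
  branch (bin .eq (get 4 (var 16)) (lit 0)) (sccPush 16)
    (branch (bin .eq (get 4 (var 16)) (bin .add (var 6) (lit 1))) sccRemoved
      (branch (bin .lt (get 7 (bin .sub (var 14) (lit 1))) (get 4 (var 16))) sccInner sccMerge))

/-- A step of the search. -/
def sccStep : Cmd :=
  branch (bin .eq (var 13) (lit 0))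
    (branch (bin .eq (get 4 (var 11)) (lit 0)) (sccPush 11)
      (assign 11 (bin .add (var 11) (lit 1))))
    (assign 15 (get 6 (bin .sub (var 13) (lit 1))) ;;
      branch (bin .lt (get 10 (var 15)) (var 7)) sccExplore
        (branch (bin .lt (bin .add (get 7 (bin .sub (var 14) (lit 1))) (lit 1)) (get 4 (var 15)))
          (assign 13 (bin .sub (var 13) (lit 1))) sccRemove))

/-- The search. -/
def sccLoop : Cmd := loop (bin .lt (var 11) (var 6)) sccStep

variable {S V : ℕ} {s : State}

theorem scc_run_sccPush (x : ℕ) : ((sccPush x).run s).scc = s.scc.push (s.var x) := by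
  simp [sccPush, State.scc, Scc.push, run, eval, State.setVar, State.setArr, Op.apply]

theorem scc_run_sccRemoved :
    (sccRemoved.run s).scc = s.scc.exploreRemoved (s.var 15) (s.var 16) := by
  by_cases h : s.arr 8 (s.var 14 - 1) < s.arr 11 (s.var 16)
  · simp [sccRemoved, State.scc, Scc.exploreRemoved, run, eval, State.setArr,
      Op.apply, h, h.le]
  · simp [sccRemoved, State.scc, Scc.exploreRemoved, run, eval, State.setArr,
      Op.apply, h, max_eq_left (not_lt.mp h)]

theorem scc_run_sccInner : (sccInner.run s).scc = s.scc.exploreInner (s.var 15) := by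
  simp [sccInner, State.scc, Scc.exploreInner, run, eval, State.setArr, Op.apply]

theorem scc_run_sccMerge : (sccMerge.run s).scc = s.scc.merge := by
  by_cases h : s.arr 8 (s.var 14 - 2) < s.arr 8 (s.var 14 - 1)
  · simp [sccMerge, State.scc, Scc.merge, run, eval, State.setVar, State.setArr, Op.apply, h, h.le]
  · simp [sccMerge, State.scc, Scc.merge, run, eval, State.setVar, State.setArr, Op.apply, h,
      max_eq_left (not_lt.mp h)]

end RAM


/-! ### A bound for the colours during the search -/

namespace Scc

variable {T : ℕ → ℕ → ℕ} {N L : ℕ} {acc : ℕ → Prop} {σ : Scc} {k₀ : ℕ}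

/-- The colours of removed states and the numbers `M` are bounded by `k₀`, with a reserve. -/
structure Bounded (N L k₀ : ℕ) (σ : Scc) : Prop where
  le : σ.potential N L ≤ k₀
  col : ∀ x < N, σ.st x = N + 1 → σ.col x + σ.potential N L ≤ k₀
  M : ∀ j < σ.t, σ.M j + σ.potential N L ≤ k₀

namespace Bounded

theorem push (h : σ.Bounded N L k₀) {x : ℕ} (hx : x < N) (hx0 : σ.st x = 0) (hs : σ.s < N) :
    (σ.push x).Bounded N L k₀ := by
  have hle := potential_push (L := L) hx hx0
  have h0 := h.le
  refine ⟨by omega, fun y hy hst => ?_, fun j hj => ?_⟩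
  · have hne : y ≠ x := by
      rintro rfl
      simp [Scc.push] at hst
      omega
    have := h.col y hy (by simpa [Scc.push, hne] using hst)
    change σ.col y + _ ≤ _
    omega
  · rcases Nat.lt_succ_iff_lt_or_eq.mp hj with hj | rfl
    · have := h.M j hj
      have h1 : (σ.push x).M j = σ.M j := by simp [Scc.push, hj.ne]
      omega
    · have h1 : (σ.push x).M σ.t = 0 := by simp [Scc.push]
      omega

theorem exploreRemoved (h : σ.Bounded N L k₀) {v w : ℕ} (hv : v < N) (hl : σ.ptr v < L)
    (hw : w < N) (hst : σ.st w = N + 1) : (σ.exploreRemoved v w).Bounded N L k₀ := by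
  have hle := potential_exploreRemoved (w := w) hv hl
  have h0 := h.le
  refine ⟨by omega, fun y hy hst => ?_, fun j hj => ?_⟩
  · have := h.col y hy hst
    change σ.col y + _ ≤ _
    omega
  · have h1 := h.M j hj
    have h2 := h.col w hw hst
    have h3 : (σ.exploreRemoved v w).M j ≤ max (σ.M j) (σ.col w) := by
      simp only [Scc.exploreRemoved, Function.update_apply]
      split
      · rename_i hj; rw [hj]
      · exact le_max_left _ _
    omega

theorem exploreInner (h : σ.Bounded N L k₀) {v : ℕ} (hv : v < N) (hl : σ.ptr v < L) :
    (σ.exploreInner v).Bounded N L k₀ := by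
  have hle := potential_exploreInner hv hl
  have h0 := h.le
  refine ⟨by omega, fun y hy hst => ?_, fun j hj => ?_⟩
  · have := h.col y hy hst
    change σ.col y + _ ≤ _
    omega
  · have := h.M j hj
    change σ.M j + _ ≤ _
    omega

theorem merge (h : σ.Bounded N L k₀) (ht : 2 ≤ σ.t) : σ.merge.Bounded N L k₀ := by
  have hle := potential_merge (N := N) (L := L) ht
  have h0 := h.le
  refine ⟨by omega, fun y hy hst => ?_, fun j hj => ?_⟩
  · have := h.col y hy hst
    change σ.col y + _ ≤ _
    omega
  · have h1 := h.M j (by change j < σ.t - 1 at hj; omega)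
    have h2 := h.M (σ.t - 1) (by omega)
    have h3 : σ.merge.M j ≤ max (σ.M j) (σ.M (σ.t - 1)) := by
      simp only [Scc.merge, Function.update_apply]
      split
      · rename_i hj; rw [hj]
      · exact le_max_left _ _
    omega

/-- Only this step can create a colour above all earlier ones. It exceeds a known value by at most
one, while the potential drops by at least one. -/
theorem remove (h : σ.Bounded N L k₀) {k : ℕ} (hc : 0 < σ.c) (ht : 0 < σ.t)
    (hs : σ.Bd (σ.t - 1) < σ.s) (hk : k ≤ σ.M (σ.t - 1) + 1) : (σ.remove N k).Bounded N L k₀ := by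
  have hle := potential_remove (N := N) (L := L) (k := k) hc ht hs
  have h0 := h.le
  refine ⟨by omega, fun y hy hst => ?_, fun j hj => ?_⟩
  · have h1 := h.M (σ.t - 1) (by omega)
    simp only [Scc.remove] at hst
    change (if _ then k else σ.col y) + _ ≤ _
    split
    · omega
    · rename_i hcase
      rw [if_neg hcase] at hst
      have := h.col y hy hst
      omega
  · have := h.M j (by change j < σ.t - 1 at hj; omega)
    change σ.M j + _ ≤ _
    omega

theorem of_le {τ : Scc} (h : σ.Bounded N L k₀) (hle : τ.potential N L ≤ σ.potential N L)
    (hst : τ.st = σ.st) (hcol : τ.col = σ.col) (hM : τ.M = σ.M) (ht : τ.t = σ.t) :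
    τ.Bounded N L k₀ := by
  have h0 := h.le
  refine ⟨by omega, fun y hy hy' => ?_, fun j hj => ?_⟩
  · have := h.col y hy (hst ▸ hy')
    rw [hcol]
    omega
  · have := h.M j (ht ▸ hj)
    rw [hM]
    omega

end Bounded

end Scc

/-! ### Costs of the single search steps -/

namespace RAM

open RAM.Expr RAM.Cmd

/-- The memory at a step of the search. -/
structure SccState (T : ℕ → ℕ → ℕ) (N L : ℕ) (acc : ℕ → Prop) (k₀ : ℕ) (s : State) : Prop where
  N_eq : s.var 6 = N
  L_eq : s.var 7 = L
  table : ∀ x < N, ∀ l < L, s.arr 2 (x * L + l) = T x l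
  flag_le : ∀ x < N, s.arr 3 x ≤ 1
  flag : ∀ x < N, s.arr 3 x = 1 ↔ acc x
  inv : s.scc.Inv T N L acc
  bounded : s.scc.Bounded N L k₀

variable {T : ℕ → ℕ → ℕ} {N L : ℕ} {acc : ℕ → Prop} {k₀ S V : ℕ} {s : State}

/-- The effect of a step of the search. -/
def SccPost (T : ℕ → ℕ → ℕ) (N L : ℕ) (acc : ℕ → Prop) (k₀ : ℕ) (s : State) (t : ℕ)
    (s' : State) : Prop :=
  s'.scc.Inv T N L acc ∧ s'.scc.Bounded N L k₀ ∧
    t + 60 + 100 * s'.scc.potential N L ≤ 100 * s.scc.potential N L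

theorem runs_sccPush (hs : SccState T N L acc k₀ s) (hT : IsWeakTable T N L acc)
    (hS : N ≤ S) (hV : N + 1 ≤ V) {x : ℕ} (hx : s.var x < N) (hx0 : s.arr 4 (s.var x) = 0)
    (hr : ∀ p < s.var 12, Relation.ReflTransGen (TableEdge T L) (s.arr 5 p) (s.var x)) :
    Runs S V (sccPush x) s (SccPost T N L acc k₀ s) := by
  have hlt : s.var 12 < N := hs.inv.s_lt hx hx0
  have hc : s.var 13 ≤ s.var 12 := hs.inv.c_le
  have ht : s.var 14 ≤ s.var 12 := hs.inv.t_le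
  refine Runs.flat ?_ (fun t ht => ?_) (by simp [sccPush, Cmd.weight, Expr.weight])
  · simp [sccPush, Ok, Idx, run, eval, State.setVar, State.setArr, Op.apply]
    omega
  · have ht : t ≤ 32 := ht
    have := Scc.potential_push (σ := s.scc) (L := L) hx hx0
    rw [SccPost, scc_run_sccPush]
    exact ⟨hs.inv.push hx hx0 hT.lt hr, hs.bounded.push hx hx0 hlt, by omega⟩

theorem runs_sccRemoved (hs : SccState T N L acc k₀ s) (hT : IsWeakTable T N L acc)
    (hb : Bdd V s) (hS : N ≤ S) (hLV : L ≤ V) (hc : 0 < s.var 13)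
    (hv : s.var 15 = s.arr 6 (s.var 13 - 1)) (hl : s.arr 10 (s.var 15) < L)
    (hw : s.var 16 = T (s.var 15) (s.arr 10 (s.var 15))) (hst : s.arr 4 (s.var 16) = N + 1) :
    Runs S V sccRemoved s (SccPost T N L acc k₀ s) := by
  have hvN : s.var 15 < N := hv ▸ hs.inv.C_lt _ (by change _ < s.var 13; omega)
  have hwN : s.var 16 < N := hw ▸ hT.lt _ hvN _ hl
  have ht : s.var 14 ≤ s.var 12 := hs.inv.t_le
  have hsN : s.var 12 ≤ N := hs.inv.s_le
  have h11 := hb.arr_le 11 (s.var 16)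
  refine Runs.flat ?_ (fun t ht => ?_)
  · have h1 : s.var 14 - 1 < S := by omega
    by_cases h : s.arr 8 (s.var 14 - 1) < s.arr 11 (s.var 16)
    · simp [sccRemoved, Ok, Idx, run, eval, State.setArr, Op.apply, h]
      omega
    · simp [sccRemoved, Ok, Idx, run, eval, Op.apply, h]
      omega
  · have ht : t ≤ 30 := ht.trans (by decide)
    have := Scc.potential_exploreRemoved (σ := s.scc) (w := s.var 16) hvN hl
    rw [SccPost, scc_run_sccRemoved]
    refine ⟨?_, hs.bounded.exploreRemoved hvN hl hwN hst, by omega⟩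
    have := hs.inv.exploreRemoved hT.lt hc hv hl (hw ▸ hst)
    rw [hw]
    exact this

theorem runs_sccInner (hs : SccState T N L acc k₀ s) (hT : IsWeakTable T N L acc)
    (hS : N ≤ S) (hLV : L ≤ V) (hc : 0 < s.var 13)
    (hv : s.var 15 = s.arr 6 (s.var 13 - 1)) (hl : s.arr 10 (s.var 15) < L)
    (hw : s.var 16 = T (s.var 15) (s.arr 10 (s.var 15))) (hst : s.arr 4 (s.var 16) ≠ N + 1)
    (hst' : s.arr 7 (s.var 14 - 1) < s.arr 4 (s.var 16)) :
    Runs S V sccInner s (SccPost T N L acc k₀ s) := by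
  have hvN : s.var 15 < N := hv ▸ hs.inv.C_lt _ (by change _ < s.var 13; omega)
  have ht : s.var 14 ≤ s.var 12 := hs.inv.t_le
  have hsN : s.var 12 ≤ N := hs.inv.s_le
  refine Runs.flat ?_ (fun t ht => ?_)
  · simp [sccInner, Ok, Idx, run, eval, State.setArr, Op.apply]
    omega
  · have ht : t ≤ 30 := ht.trans (by decide)
    have := Scc.potential_exploreInner (σ := s.scc) hvN hl
    rw [SccPost, scc_run_sccInner]
    exact ⟨hs.inv.exploreInner hT.lt hc hv hl (hw ▸ hst) (hw ▸ hst'),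
      hs.bounded.exploreInner hvN hl, by omega⟩

theorem runs_sccMerge (hs : SccState T N L acc k₀ s) (hT : IsWeakTable T N L acc)
    (hb : Bdd V s) (hS : N ≤ S) (hV : N + 1 ≤ V) (hc : 0 < s.var 13)
    (hv : s.var 15 = s.arr 6 (s.var 13 - 1)) (hl : s.arr 10 (s.var 15) < L)
    (hw : s.var 16 = T (s.var 15) (s.arr 10 (s.var 15))) (hst : s.arr 4 (s.var 16) ≠ 0)
    (hst' : s.arr 4 (s.var 16) ≤ s.arr 7 (s.var 14 - 1)) :
    Runs S V sccMerge s (SccPost T N L acc k₀ s) := by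
  obtain ⟨ht2, hinv⟩ := hs.inv.merge hT.lt hc hv hl (hw ▸ hst) (hw ▸ hst')
  have ht : s.var 14 ≤ s.var 12 := hs.inv.t_le
  have hsN : s.var 12 ≤ N := hs.inv.s_le
  have h2 : 2 ≤ s.var 14 := ht2
  have h8 := hb.arr_le 8 (s.var 14 - 1)
  refine Runs.flat ?_ (fun t ht => ?_)
  · by_cases h : s.arr 8 (s.var 14 - 2) < s.arr 8 (s.var 14 - 1)
    · simp [sccMerge, Ok, Idx, run, eval, State.setArr, Op.apply, h]
      omega
    · simp [sccMerge, Ok, Idx, run, eval, State.setArr, Op.apply, h]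
      omega
  · have ht : t ≤ 38 := ht.trans (by decide)
    have := Scc.potential_merge (N := N) (L := L) ht2
    rw [SccPost, scc_run_sccMerge]
    exact ⟨hinv, hs.bounded.merge ht2, by omega⟩

theorem runs_sccColour (hs : SccState T N L acc k₀ s) (hS : N ≤ S)
    (hV : k₀ + 1 ≤ V) (hc : 0 < s.var 13) (hv : s.var 15 = s.arr 6 (s.var 13 - 1)) :
    Runs S V sccColour s fun t s' => t ≤ 30 ∧
      (s'.var 18 = s.arr 8 (s.var 14 - 1) ∨
        s'.var 18 = s.arr 8 (s.var 14 - 1) + 1 ∧ s.arr 9 (s.var 14 - 1) ≠ 0) ∧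
      (s.arr 9 (s.var 14 - 1) ≠ 0 → (Odd (s'.var 18) ↔ acc (s.var 15))) := by
  have hvN : s.var 15 < N := hv ▸ hs.inv.C_lt _ (by change _ < s.var 13; omega)
  have htop : 0 < s.var 14 := (hs.inv.top hc).1
  have ht : s.var 14 ≤ s.var 12 := hs.inv.t_le
  have hsN : s.var 12 ≤ N := hs.inv.s_le
  have hM : s.arr 8 (s.var 14 - 1) + _ ≤ k₀ := hs.bounded.M (s.var 14 - 1) (by
    change _ < s.var 14; omega)
  have h3 := hs.flag_le _ hvN
  rw [← hs.flag _ hvN]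
  have hlt : s.var 14 - 1 < S := by omega
  have hlt' : s.var 15 < S := by omega
  have hMV : s.arr 8 (s.var 14 - 1) + 1 ≤ V := by omega
  by_cases h9 : s.arr 9 (s.var 14 - 1) = 0
  · refine Runs.flat ?_ (fun t ht => ?_)
    · simp [sccColour, Ok, Idx, run, eval, State.setVar, Op.apply, h9]
      omega
    · refine ⟨ht.trans (by decide), ?_⟩
      simp [sccColour, run, eval, State.setVar, Op.apply, h9]
  · by_cases hm : s.arr 8 (s.var 14 - 1) % 2 = s.arr 3 (s.var 15)
    · refine Runs.flat ?_ (fun t ht => ?_)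
      · simp [sccColour, Ok, Idx, run, eval, State.setVar, Op.apply, h9, hm]
        omega
      · refine ⟨ht.trans (by decide), ?_⟩
        simp [sccColour, run, eval, State.setVar, Op.apply, h9, hm, Nat.odd_iff]
    · refine Runs.flat ?_ (fun t ht => ?_)
      · simp [sccColour, Ok, Idx, run, eval, State.setVar, Op.apply, h9, hm]
        omega
      · refine ⟨ht.trans (by decide), ?_⟩
        simp [sccColour, run, eval, State.setVar, Op.apply, h9, hm, Nat.odd_iff]
        omega

end RAM


/-! ### Removal on the machine and the complete search -/

namespace RAM

open RAM.Expr RAM.Cmd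

variable {T : ℕ → ℕ → ℕ} {N L : ℕ} {acc : ℕ → Prop} {k₀ S V : ℕ} {s : State}

/-- The memory `s'` arises from `s` by taking the states above position `u` from the stack. -/
structure Unstacked (N k u : ℕ) (s s' : State) : Prop where
  N_eq : s'.var 6 = N
  colour : s'.var 18 = k
  height : s'.var 12 = u
  parts : s'.var 14 = s.var 14
  stack : s'.arr 5 = s.arr 5
  base : s'.arr 7 = s.arr 7
  st : s'.arr 4 = fun y =>
    if y < N ∧ u < s.arr 4 y ∧ s.arr 4 y ≤ s.var 12 then N + 1 else s.arr 4 y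
  col : s'.arr 11 = fun y =>
    if y < N ∧ u < s.arr 4 y ∧ s.arr 4 y ≤ s.var 12 then k else s.arr 11 y

/-- Exactly one state has the entry `u` in array 4, namely the one at position `u - 1`; lowering the
limit from `u` to `u - 1` therefore affects this state only. -/
theorem Unstacked.step (hs : s.scc.Inv T N L acc) {k u : ℕ} {s' : State}
    (h : Unstacked N k u s s') (hu : 0 < u) (hus : u ≤ s.var 12) :
    Unstacked N k (u - 1) s (sccUnstack.run s') := by
  have hx := hs.S_lt (u - 1) (by change _ < s.var 12; omega)
  have hst := hs.st_S (u - 1) (by change _ < s.var 12; omega)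
  change s.arr 5 (u - 1) < N at hx
  change s.arr 4 (s.arr 5 (u - 1)) = _ at hst
  have hsN : s.var 12 ≤ N := hs.s_le
  have hiff : ∀ y, y ≠ s.arr 5 (u - 1) → ((y < N ∧ u < s.arr 4 y ∧ s.arr 4 y ≤ s.var 12) ↔
      (y < N ∧ u - 1 < s.arr 4 y ∧ s.arr 4 y ≤ s.var 12)) := by
    intro y hy
    refine and_congr_right fun hyN => and_congr_left fun hys => ⟨by omega, fun hlt => ?_⟩
    by_contra hcon
    have h4 : s.arr 4 y = u := by omega
    have := hs.S_st y hyN (by change s.arr 4 y ≠ 0; omega) (by change s.arr 4 y ≠ _; omega)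
    change s.arr 5 (s.arr 4 y - 1) = y at this
    rw [h4] at this
    exact hy this.symm
  have hcond : s.arr 5 (u - 1) < N ∧ u - 1 < s.arr 4 (s.arr 5 (u - 1)) ∧
      s.arr 4 (s.arr 5 (u - 1)) ≤ s.var 12 := ⟨hx, by omega, by omega⟩
  obtain ⟨h1, h2, h3, h4, h5, h6, h7, h8⟩ := h
  constructor
  · simpa [sccUnstack, run, eval, State.setVar, State.setArr, Op.apply] using h1
  · simpa [sccUnstack, run, eval, State.setVar, State.setArr, Op.apply] using h2
  · simp [sccUnstack, run, eval, State.setVar, State.setArr, Op.apply, h3]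
  · simpa [sccUnstack, run, eval, State.setVar, State.setArr, Op.apply] using h4
  · simpa [sccUnstack, run, eval, State.setVar, State.setArr, Op.apply] using h5
  · simpa [sccUnstack, run, eval, State.setVar, State.setArr, Op.apply] using h6
  · funext y
    by_cases hy : y = s.arr 5 (u - 1)
    · rw [hy, if_pos hcond]
      simp [sccUnstack, run, eval, State.setVar, State.setArr, Op.apply, h3, h5, h1]
    · simp only [← hiff y hy]
      simp [sccUnstack, run, eval, State.setVar, State.setArr, Op.apply, h3, h5, h7, hy]
  · funext y
    by_cases hy : y = s.arr 5 (u - 1)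
    · rw [hy, if_pos hcond]
      simp [sccUnstack, run, eval, State.setVar, State.setArr, Op.apply, h3, h5, h2]
    · simp only [← hiff y hy]
      simp [sccUnstack, run, eval, State.setVar, State.setArr, Op.apply, h3, h5, h8, hy]

theorem runs_sccUnstack_loop (hs : s.scc.Inv T N L acc) (hS : N ≤ S) (hV : N + 1 ≤ V) {k : ℕ}
    (hkV : k ≤ V) (hN : s.var 6 = N) (hk : s.var 18 = k) (ht : 0 < s.var 14) :
    Runs S V (loop (bin .lt (get 7 (bin .sub (var 14) (lit 1))) (var 12)) sccUnstack) s
      fun t s' => Unstacked N k (s.arr 7 (s.var 14 - 1)) s s' ∧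
        t ≤ 30 * (s.var 12 - s.arr 7 (s.var 14 - 1)) + 7 := by
  have hB : s.arr 7 (s.var 14 - 1) < s.var 12 := hs.Bd_lt (s.var 14 - 1) (by
    change _ < s.var 14; omega)
  have hsN : s.var 12 ≤ N := hs.s_le
  have htN : s.var 14 ≤ s.var 12 := hs.t_le
  have hloop := Runs.loop (S := S) (V := V) (c := sccUnstack)
    (e := bin .lt (get 7 (bin .sub (var 14) (lit 1))) (var 12)) (s := s)
    (Inv := fun s' => ∃ u ≤ s.var 12, s.arr 7 (s.var 14 - 1) ≤ u ∧ Unstacked N k u s s')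
    (fun s' => 30 * (s'.var 12 - s.arr 7 (s.var 14 - 1)))
    ⟨s.var 12, le_rfl, hB.le, hN, hk, rfl, rfl, rfl, rfl,
      funext fun y => (if_neg (by omega)).symm, funext fun y => (if_neg (by omega)).symm⟩
    ?_ ?_
  · refine hloop.mono fun t s' _ ⟨⟨u, hu, hu', h⟩, hz, hle⟩ => ?_
    have : u = s.arr 7 (s.var 14 - 1) := by
      simp only [eval, Op.apply, h.base, h.parts, h.height] at hz
      split at hz <;> omega
    subst this
    have hc : (bin .lt (get 7 (bin .sub (var 14) (lit 1))) (var 12)).cost = 6 := rfl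
    refine ⟨h, ?_⟩
    omega
  · rintro s' - ⟨u, hu, hu', h⟩
    simp only [Idx, eval, Op.apply, h.parts]
    simp
    omega
  · rintro s' hb ⟨u, hu, hu', h⟩ hne
    have hlt : s.arr 7 (s.var 14 - 1) < u := by
      simp only [eval, Op.apply, h.base, h.parts, h.height] at hne
      simpa using hne
    have hx := hs.S_lt (u - 1) (by change _ < s.var 12; omega)
    change s.arr 5 (u - 1) < N at hx
    have hstep := h.step hs (by omega) hu
    refine Runs.flat ?_ fun t ht => ⟨⟨u - 1, by omega, by omega, hstep⟩, ?_⟩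
    · simp [sccUnstack, Ok, Idx, run, eval, State.setVar, State.setArr, Op.apply, h.height, h.stack,
        h.colour, h.N_eq]
      omega
    · have ht : t ≤ 22 := ht.trans (by decide)
      have hc : (bin .lt (get 7 (bin .sub (var 14) (lit 1))) (var 12)).cost = 6 := rfl
      rw [hstep.height, h.height]
      omega

theorem runs_sccRemove (hs : SccState T N L acc k₀ s) (hT : IsWeakTable T N L acc)
    (hS : N ≤ S) (hV : N + 1 ≤ V) (hk₀ : k₀ + 1 ≤ V) (hc : 0 < s.var 13)
    (hv : s.var 15 = s.arr 6 (s.var 13 - 1)) (hl : s.arr 10 (s.var 15) = L)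
    (hβ : s.arr 4 (s.var 15) = s.arr 7 (s.var 14 - 1) + 1) :
    Runs S V sccRemove s (SccPost T N L acc k₀ s) := by
  intro hb
  have htop : 0 < s.var 14 := (hs.inv.top hc).1
  have ht : s.var 14 ≤ s.var 12 := hs.inv.t_le
  have hsN : s.var 12 ≤ N := hs.inv.s_le
  have hcs : s.var 13 ≤ s.var 12 := hs.inv.c_le
  have hBs : s.arr 7 (s.var 14 - 1) < s.var 12 :=
    hs.inv.Bd_lt (s.var 14 - 1) (by change _ < s.var 14; omega)
  have hM : s.arr 8 (s.var 14 - 1) + _ ≤ k₀ := hs.bounded.M (s.var 14 - 1) (by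
    change _ < s.var 14; omega)
  refine Runs.seq ?_ hb
  refine (runs_sccColour hs hS hk₀ hc hv).frame.mono ?_
  rintro t₁ s₁ - ⟨⟨ht₁, hk, hacc⟩, hvar, harr⟩
  have hscc : s₁.scc = s.scc := by
    simp only [State.scc, Scc.mk.injEq]
    exact ⟨hvar _ rfl, hvar _ rfl, hvar _ rfl, hvar _ rfl, harr _ rfl, harr _ rfl, harr _ rfl,
      harr _ rfl, harr _ rfl, harr _ rfl, harr _ rfl, harr _ rfl⟩
  have h14 : s₁.var 14 = s.var 14 := hvar _ rfl
  have h12 : s₁.var 12 = s.var 12 := hvar _ rfl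
  have h13 : s₁.var 13 = s.var 13 := hvar _ rfl
  have h7 : s₁.arr 7 = s.arr 7 := harr _ rfl
  have h4 : s₁.arr 4 = s.arr 4 := harr _ rfl
  have h11 : s₁.arr 11 = s.arr 11 := harr _ rfl
  refine Runs.seq ?_
  refine (runs_sccUnstack_loop (k := s₁.var 18) (hscc ▸ hs.inv) hS hV (by omega)
    ((hvar 6 rfl).trans hs.N_eq) rfl (by omega)).frame.mono ?_
  rintro t₂ s₂ - ⟨⟨hun, ht₂⟩, hvar₂, harr₂⟩
  rw [h7, h14, h12] at ht₂
  have hres : ((assign 13 (bin .sub (var 13) (lit 1)) ;;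
      assign 14 (bin .sub (var 14) (lit 1))).run s₂).scc = s.scc.remove N (s₁.var 18) := by
    have e5 := hun.stack
    have e12 := hun.height
    have e14 := hun.parts
    have e4 := hun.st
    have e11 := hun.col
    simp only [h7, h14, h12, h4, h11] at e5 e12 e14 e4 e11
    have e13 : s₂.var 13 = s.var 13 := (hvar₂ 13 rfl).trans h13
    have e1 : s₂.var 11 = s.var 11 := (hvar₂ 11 rfl).trans (hvar 11 rfl)
    have e6 : s₂.arr 6 = s.arr 6 := (harr₂ 6 rfl).trans (harr 6 rfl)
    have e7 : s₂.arr 7 = s.arr 7 := (harr₂ 7 rfl).trans (harr 7 rfl)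
    have e8 : s₂.arr 8 = s.arr 8 := (harr₂ 8 rfl).trans (harr 8 rfl)
    have e9 : s₂.arr 9 = s.arr 9 := (harr₂ 9 rfl).trans (harr 9 rfl)
    have e10 : s₂.arr 10 = s.arr 10 := (harr₂ 10 rfl).trans (harr 10 rfl)
    have e5' : s₁.arr 5 = s.arr 5 := harr 5 rfl
    simp [State.scc, Scc.remove, run, eval, State.setVar, Op.apply, e5, e5', e12, e14, e13, e1, e6,
      e7, e8, e9, e10, e4, e11]
    exact ⟨rfl, rfl⟩
  have e13 : s₂.var 13 = s.var 13 := (hvar₂ 13 rfl).trans h13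
  have e14 : s₂.var 14 = s.var 14 := hun.parts.trans h14
  refine Runs.flat ?_ fun t₃ ht₃ => ?_
  · simp [Ok, Idx, run, eval, State.setVar, Op.apply, e13, e14]
    omega
  · have ht₃ : t₃ ≤ 8 := ht₃
    have hpot := Scc.potential_remove (N := N) (L := L) (k := s₁.var 18) (σ := s.scc) hc htop hBs
    change _ + 1 + (s.var 12 - s.arr 7 (s.var 14 - 1)) ≤ _ at hpot
    rw [SccPost, hres]
    refine ⟨hs.inv.remove hT hc hv hl hβ hk hacc, hs.bounded.remove hc htop hBs ?_, ?_⟩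
    · change s₁.var 18 ≤ s.arr 8 (s.var 14 - 1) + 1
      omega
    · omega

theorem runs_sccExplore (hs : SccState T N L acc k₀ s) (hT : IsWeakTable T N L acc)
    (hS : N * L ≤ S) (hV : N + 1 ≤ V) (hLV : L ≤ V) (hc : 0 < s.var 13)
    (hv : s.var 15 = s.arr 6 (s.var 13 - 1)) (hl : s.arr 10 (s.var 15) < L) :
    Runs S V sccExplore s fun t s' => SccPost T N L acc k₀ s (t - 30) s' := by
  intro hb
  have hNS : N ≤ S := (Nat.le_mul_of_pos_right N hT.pos).trans hS
  have hvN : s.var 15 < N := hv ▸ hs.inv.C_lt _ (by change _ < s.var 13; omega)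
  have htop : 0 < s.var 14 := (hs.inv.top hc).1
  have ht : s.var 14 ≤ s.var 12 := hs.inv.t_le
  have hsN : s.var 12 ≤ N := hs.inv.s_le
  have hidx : s.var 15 * L + s.arr 10 (s.var 15) < N * L := by nlinarith
  refine Runs.seq ?_ hb
  have hTw := hs.table _ hvN _ hl
  have hTN := hT.lt _ hvN _ hl
  refine Runs.flat ?_ fun t₁ ht₁ => ?_
  · simp [Ok, Idx, eval, Op.apply, hs.L_eq, hTw]
    omega
  set s₁ := (assign 16 (get 2 (bin .add (bin .mul (var 15) (var 7)) (get 10 (var 15))))).run s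
    with hs₁
  have ht₁ : t₁ ≤ 8 := ht₁
  have h16 : s₁.var 16 = T (s.var 15) (s.arr 10 (s.var 15)) := by
    simp [hs₁, run, eval, State.setVar, Op.apply, hs.L_eq, hTw]
  have hvar : ∀ x, x ≠ 16 → s₁.var x = s.var x := fun x hx => by
    simp [hs₁, run, State.setVar, hx]
  have harr : s₁.arr = s.arr := by simp [hs₁, run, State.setVar]
  have hscc : s₁.scc = s.scc := by simp [hs₁, run, State.setVar, State.scc]
  have hs' : SccState T N L acc k₀ s₁ := by
    refine ⟨(hvar 6 (by decide)).trans hs.N_eq, (hvar 7 (by decide)).trans hs.L_eq, ?_, ?_, ?_,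
      hscc ▸ hs.inv, hscc ▸ hs.bounded⟩
    · rw [harr]; exact hs.table
    · rw [harr]; exact hs.flag_le
    · rw [harr]; exact hs.flag
  clear_value s₁
  have h15 := hvar 15 (by decide)
  have h13 := hvar 13 (by decide)
  have h14 := hvar 14 (by decide)
  have h16' : s₁.var 16 = T (s₁.var 15) (s₁.arr 10 (s₁.var 15)) := by rw [h16, h15, harr]
  have h16N : s₁.var 16 < N := by rw [h16]; exact hTN
  have hv₁ : s₁.var 15 = s₁.arr 6 (s₁.var 13 - 1) := by rw [h15, h13, harr, hv]
  have hl₁ : s₁.arr 10 (s₁.var 15) < L := by rw [h15, harr]; exact hl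
  have hc₁ : 0 < s₁.var 13 := by omega
  have hpost : ∀ t s', t₁ + t ≤ 30 + t → ∀ t', SccPost T N L acc k₀ s₁ t s' → t' ≤ 30 + t →
      SccPost T N L acc k₀ s (t' - 30) s' := by
    rintro t s' - t' ⟨ha, hb, hc⟩ ht'
    rw [hscc] at hc
    exact ⟨ha, hb, by omega⟩
  have hpost : ∀ t t' s', t' ≤ 30 + t → SccPost T N L acc k₀ s₁ t s' →
      SccPost T N L acc k₀ s (t' - 30) s' := fun t t' s' ht' h => hpost t s' (by omega) t' h ht'
  refine Runs.branch ?_ (fun hne => ?_) (fun hz => ?_)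
  · simp [Idx, eval]
    omega
  · have h0 : s₁.arr 4 (s₁.var 16) = 0 := Op.apply_eq_ne_zero.mp hne
    refine (runs_sccPush hs' hT hNS hV h16N h0 fun p hp => ?_).mono fun t s' _ h =>
      hpost t _ s' (by simp only [cost]; omega) h
    have := hs'.inv.reach_top hc₁ hp
    refine this.tail ⟨s₁.arr 10 (s₁.var 15), hl₁, ?_⟩
    rw [h16', hv₁]
    rfl
  · have h0 : s₁.arr 4 (s₁.var 16) ≠ 0 := Op.apply_eq_eq_zero.mp hz
    refine Runs.branch ?_ (fun hne => ?_) (fun hz => ?_)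
    · simp [Idx, eval]
      omega
    · have h1 : s₁.arr 4 (s₁.var 16) = N + 1 := by
        simpa [eval, Op.apply, hs'.N_eq] using hne
      refine fun hb => ((runs_sccRemoved hs' hT hb hNS hLV hc₁ hv₁ hl₁ h16' h1).mono
        fun t s' _ h => hpost t _ s' (by simp only [cost]; omega) h) hb
    · have h1 : s₁.arr 4 (s₁.var 16) ≠ N + 1 := by
        simpa [eval, Op.apply, hs'.N_eq] using hz
      refine Runs.branch ?_ (fun hne => ?_) (fun hz => ?_)
      · simp [Idx, eval, Op.apply]
        omega
      · have h2 : s₁.arr 7 (s₁.var 14 - 1) < s₁.arr 4 (s₁.var 16) := Op.apply_lt_ne_zero.mp hne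
        exact (runs_sccInner hs' hT hNS hLV hc₁ hv₁ hl₁ h16' h1 h2).mono
          fun t s' _ h => hpost t _ s' (by simp only [cost]; omega) h
      · have h2 : s₁.arr 4 (s₁.var 16) ≤ s₁.arr 7 (s₁.var 14 - 1) := Op.apply_lt_eq_zero.mp hz
        exact fun hb => ((runs_sccMerge hs' hT hb hNS hV hc₁ hv₁ hl₁ h16' h0 h2).mono
          fun t s' _ h => hpost t _ s' (by simp only [cost]; omega) h) hb

theorem runs_sccStep (hs : SccState T N L acc k₀ s) (hT : IsWeakTable T N L acc)
    (hS : N * L ≤ S) (hV : N + 1 ≤ V) (hLV : L ≤ V) (hk₀ : k₀ + 1 ≤ V) (hR : s.var 11 < N) :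
    Runs S V sccStep s fun t s' => SccState T N L acc k₀ s' ∧
      t + 4 + 100 * s'.scc.potential N L ≤ 100 * s.scc.potential N L := by
  intro hb
  have hNS : N ≤ S := (Nat.le_mul_of_pos_right N hT.pos).trans hS
  -- The reserve of 60 in `SccPost` covers the assignments and tests around the elementary action,
  -- bounded by 56, and the guard of the outer loop, which costs 4.
  have key : Runs S V sccStep s fun t s' => SccPost T N L acc k₀ s (t - 56) s' ∧ 1 ≤ t := by
    refine Runs.branch ⟨trivial, trivial⟩ (fun hne => ?_) (fun hz => ?_)
    · have hc0 : s.var 13 = 0 := Op.apply_eq_ne_zero.mp hne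
      have hs0 : s.var 12 = 0 := hs.inv.s_eq_zero hc0
      refine Runs.branch ?_ (fun hne => ?_) (fun hz => ?_)
      · simp [Idx, eval]
        omega
      · have h0 : s.arr 4 (s.var 11) = 0 := Op.apply_eq_ne_zero.mp hne
        exact (runs_sccPush hs hT hNS hV hR h0 fun p hp => by omega).mono
          fun t s' _ ⟨h1, h2, h3⟩ => ⟨⟨h1, h2, by simp only [cost]; omega⟩, by omega⟩
      · have h0 : s.arr 4 (s.var 11) ≠ 0 := Op.apply_eq_eq_zero.mp hz
        have hscc : ((assign 11 (bin .add (var 11) (lit 1))).run s).scc =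
            { s.scc with R := s.scc.R + 1 } := by
          simp [State.scc, run, eval, State.setVar, Op.apply]
        have hpot : { s.scc with R := s.scc.R + 1 }.potential N L + 1 ≤ s.scc.potential N L := by
          have h1 : { s.scc with R := s.scc.R + 1 }.potential N L =
            ∑ x ∈ Finset.range N, (L - s.scc.ptr x + if s.scc.st x = 0 then 4 else 0) +
              s.scc.c + s.scc.t + s.scc.s + (N - (s.scc.R + 1)) := rfl
          have h2 : s.scc.R < N := hR
          rw [h1, Scc.potential_eq s.scc]
          omega
        refine Runs.flat ?_ fun t ht => ?_
        · simp [Ok, Idx, eval, Op.apply]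
          omega
        · have ht : t ≤ 4 := ht
          rw [SccPost, hscc]
          refine ⟨⟨hs.inv.nextRoot hc0 hR h0,
            hs.bounded.of_le (Nat.le_of_succ_le hpot) rfl rfl rfl rfl, ?_⟩, by omega⟩
          generalize Scc.potential N L { s.scc with R := s.scc.R + 1 } = Φ at hpot ⊢
          simp only [cost]
          omega
    · have hc0 : 0 < s.var 13 := Nat.pos_of_ne_zero (Op.apply_eq_eq_zero.mp hz)
      have hcs : s.var 13 ≤ s.var 12 := hs.inv.c_le
      have hsN : s.var 12 ≤ N := hs.inv.s_le
      have htop : 0 < s.var 14 := (hs.inv.top hc0).1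
      have htN : s.var 14 ≤ s.var 12 := hs.inv.t_le
      have hvN : s.arr 6 (s.var 13 - 1) < N := hs.inv.C_lt _ (by change _ < s.var 13; omega)
      refine Runs.seq ?_
      refine Runs.flat ?_ fun t₁ ht₁ => ?_
      · simp [Ok, Idx, eval, Op.apply]
        omega
      set s₁ := (assign 15 (get 6 (bin .sub (var 13) (lit 1)))).run s with hs₁
      have ht₁ : t₁ ≤ 5 := ht₁
      have h15 : s₁.var 15 = s.arr 6 (s.var 13 - 1) := by
        simp [hs₁, run, eval, State.setVar, Op.apply]
      have hvar : ∀ x, x ≠ 15 → s₁.var x = s.var x := fun x hx => by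
        simp [hs₁, run, State.setVar, hx]
      have harr : s₁.arr = s.arr := by simp [hs₁, run, State.setVar]
      have hscc : s₁.scc = s.scc := by simp [hs₁, run, State.setVar, State.scc]
      have hs' : SccState T N L acc k₀ s₁ := by
        refine ⟨(hvar 6 (by decide)).trans hs.N_eq, (hvar 7 (by decide)).trans hs.L_eq, ?_, ?_, ?_,
          hscc ▸ hs.inv, hscc ▸ hs.bounded⟩
        · rw [harr]; exact hs.table
        · rw [harr]; exact hs.flag_le
        · rw [harr]; exact hs.flag
      clear_value s₁
      have h13 := hvar 13 (by decide)
      have h14 := hvar 14 (by decide)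
      have h12 := hvar 12 (by decide)
      have hv₁ : s₁.var 15 = s₁.arr 6 (s₁.var 13 - 1) := by rw [h15, h13, harr]
      have hc₁ : 0 < s₁.var 13 := by omega
      have hpost : ∀ t t' s', t' ≤ 56 + t → 1 ≤ t' → SccPost T N L acc k₀ s₁ t s' →
          SccPost T N L acc k₀ s (t' - 56) s' ∧ 1 ≤ t' := by
        rintro t t' s' ht' h1 ⟨ha, hb, hc⟩
        rw [hscc] at hc
        exact ⟨⟨ha, hb, by omega⟩, h1⟩
      refine Runs.branch ?_ (fun hne => ?_) (fun hz => ?_)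
      · simp [Idx, eval]
        omega
      · have hl : s₁.arr 10 (s₁.var 15) < L := by
          rw [← hs'.L_eq]
          exact Op.apply_lt_ne_zero.mp hne
        exact (runs_sccExplore hs' hT hS hV hLV hc₁ hv₁ hl).mono
          fun t s' _ h => hpost _ _ s' (by simp only [cost]; omega) (by simp only [cost]; omega) h
      · have hl : s₁.arr 10 (s₁.var 15) = L := by
          refine le_antisymm (hs'.inv.ptr_le _ (h15 ▸ hvN)) ?_
          rw [← hs'.L_eq]
          exact Op.apply_lt_eq_zero.mp hz
        refine Runs.branch ?_ (fun hne => ?_) (fun hz => ?_)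
        · simp [Idx, eval, Op.apply]
          omega
        · have hlt : s₁.arr 7 (s₁.var 14 - 1) + 1 < s₁.arr 4 (s₁.var 15) :=
            Op.apply_lt_ne_zero.mp hne
          have hscc' : ((assign 13 (bin .sub (var 13) (lit 1))).run s₁).scc =
              { s₁.scc with c := s₁.scc.c - 1 } := by
            simp [State.scc, run, eval, State.setVar, Op.apply]
          have hpot : { s₁.scc with c := s₁.scc.c - 1 }.potential N L + 1 ≤
              s₁.scc.potential N L := by
            have h1 : { s₁.scc with c := s₁.scc.c - 1 }.potential N L =
              ∑ x ∈ Finset.range N, (L - s₁.scc.ptr x + if s₁.scc.st x = 0 then 4 else 0) +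
                (s₁.scc.c - 1) + s₁.scc.t + s₁.scc.s + (N - s₁.scc.R) := rfl
            have h2 : 0 < s₁.scc.c := hc₁
            rw [h1, Scc.potential_eq s₁.scc]
            omega
          refine Runs.flat ?_ fun t ht => ?_
          · simp [Ok, Idx, eval, Op.apply]
            omega
          · have ht : t ≤ 4 := ht
            refine hpost 4 _ _ (by simp only [cost]; omega) (by simp only [cost]; omega) ?_
            rw [SccPost, hscc']
            exact ⟨hs'.inv.pop hc₁ hv₁ hl hlt, hs'.bounded.of_le (Nat.le_of_succ_le hpot) rfl rfl rfl rfl,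
              by omega⟩
        · have hle : s₁.arr 4 (s₁.var 15) ≤ s₁.arr 7 (s₁.var 14 - 1) + 1 :=
            Op.apply_lt_eq_zero.mp hz
          have hβ : s₁.arr 4 (s₁.var 15) = s₁.arr 7 (s₁.var 14 - 1) + 1 := by
            have h1 := (hs'.inv.top hc₁).2.2.1
            change s₁.arr 7 (s₁.var 14 - 1) < s₁.arr 4 (s₁.arr 6 (s₁.var 13 - 1)) at h1
            rw [← hv₁] at h1
            omega
          exact (runs_sccRemove hs' hT hNS hV hk₀ hc₁ hv₁ hl hβ).mono
            fun t s' _ h => hpost _ _ s' (by simp only [cost]; omega) (by simp only [cost]; omega) h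
  refine (key.frame.mono ?_) hb
  rintro t s' - ⟨⟨⟨h1, h2, h3⟩, ht⟩, hvar, harr⟩
  refine ⟨⟨(hvar 6 rfl).trans hs.N_eq, (hvar 7 rfl).trans hs.L_eq, ?_, ?_, ?_, h1, h2⟩, by omega⟩
  · rw [harr 2 rfl]; exact hs.table
  · rw [harr 3 rfl]; exact hs.flag_le
  · rw [harr 3 rfl]; exact hs.flag

theorem runs_sccLoop (hs : SccState T N L acc k₀ s) (hT : IsWeakTable T N L acc)
    (hS : N * L ≤ S) (hV : N + 1 ≤ V) (hLV : L ≤ V) (hk₀ : k₀ + 1 ≤ V) :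
    Runs S V sccLoop s fun t s' => IsColouring T N L acc (s'.arr 11) ∧
      t ≤ 100 * s.scc.potential N L + 4 := by
  refine (Runs.loop (fun s => 100 * s.scc.potential N L) hs ?_ fun s hb hs hne => ?_).mono ?_
  · exact fun s _ _ => ⟨trivial, trivial⟩
  · have hR : s.var 11 < N := by
      rw [← hs.N_eq]
      exact Op.apply_lt_ne_zero.mp hne
    exact (runs_sccStep hs hT hS hV hLV hk₀ hR).mono
      fun t s' _ ⟨h1, h2⟩ => ⟨h1, by simp only [cost]; omega⟩
  · rintro t s' - ⟨h1, hz, ht⟩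
    have hR : N ≤ s'.var 11 := by
      rw [← h1.N_eq]
      exact Op.apply_lt_eq_zero.mp hz
    exact ⟨h1.inv.isColouring hR, by simp only [cost] at ht; omega⟩

end RAM


/-! ### Disjoint sets with union by rank -/

/-- The arrays `par` and `rank` represent the partition of `{0,…,N-1}` into the fibres of `rt`. -/
structure IsForest (N : ℕ) (par rank rt : ℕ → ℕ) : Prop where
  par_lt : ∀ x < N, par x < N
  rank_lt : ∀ x < N, par x ≠ x → rank x < rank (par x)
  rt_par : ∀ x < N, rt (par x) = rt x
  rt_lt : ∀ x < N, rt x < N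
  par_rt : ∀ x < N, par (rt x) = rt x
  rt_eq : ∀ x < N, par x = x → rt x = x
  rank_le : ∀ x < N, rank x ≤ rank (rt x)
  sum_le : ∑ x ∈ Finset.range N with par x = x, 2 ^ rank x ≤ N

namespace IsForest

variable {N : ℕ} {par rank rt : ℕ → ℕ}

theorem init (hp : ∀ x < N, par x = x) (hr : ∀ x < N, rank x = 0) : IsForest N par rank id where
  par_lt x hx := by rwa [hp x hx]
  rank_lt x hx h := absurd (hp x hx) h
  rt_par x hx := hp x hx
  rt_lt x hx := hx
  par_rt x hx := hp x hx
  rt_eq x hx _ := rfl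
  rank_le x hx := le_rfl
  sum_le := by
    refine (Finset.sum_le_card_nsmul _ _ 1 fun x hx => ?_).trans ?_
    · simp only [Finset.mem_filter, Finset.mem_range] at hx
      simp [hr x hx.1]
    · simpa using Finset.card_filter_le (Finset.range N) fun x => par x = x

/-- A root of rank `r` contributes `2 ^ r` to a sum that never exceeds `N`, and no element has
larger rank than its root. -/
theorem rank_le_log (h : IsForest N par rank rt) {x : ℕ} (hx : x < N) :
    rank x ≤ Nat.log 2 N := by
  refine (h.rank_le x hx).trans ?_
  refine Nat.le_log_of_pow_le (by norm_num) (le_trans ?_ h.sum_le)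
  exact Finset.single_le_sum (f := fun x => 2 ^ rank x) (fun _ _ => Nat.zero_le _)
    (by simp [h.rt_lt x hx, h.par_rt x hx])

/-- The root `a` disappears from the sum in `sum_le` and `b` gets its new rank; `hpow` says that the
sum does not grow. Both cases of union by rank fit: an unchanged rank of `b`, or equal ranks with
that of `b` raised by one. -/
theorem link (h : IsForest N par rank rt) {a b : ℕ} {rank' : ℕ → ℕ} (ha : a < N) (hb : b < N)
    (hab : a ≠ b) (hpa : par a = a) (hpb : par b = b) (hr : ∀ x, x ≠ b → rank' x = rank x)
    (hlt : rank a < rank' b) (hle : rank b ≤ rank' b)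
    (hpow : 2 ^ rank' b ≤ 2 ^ rank a + 2 ^ rank b) :
    IsForest N (Function.update par a b) rank' (fun z => if rt z = a then b else rt z) := by
  have hra := h.rt_eq a ha hpa
  have hrb := h.rt_eq b hb hpb
  have hmono : ∀ x, rank x ≤ rank' x := fun x => by
    by_cases hx : x = b
    · rw [hx]; exact hle
    · rw [hr x hx]
  have hroot : (Finset.range N).filter (fun x => Function.update par a b x = x) =
      ((Finset.range N).filter (fun x => par x = x)).erase a := by
    ext x
    simp only [Finset.mem_filter, Finset.mem_range, Finset.mem_erase]
    by_cases hx : x = a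
    · simp [hx, hab.symm]
    · simp [hx]
  constructor
  · intro x hx
    rw [Function.update_apply]
    split
    exacts [hb, h.par_lt x hx]
  · intro x hx hne
    by_cases hxa : x = a
    · subst hxa
      rw [Function.update_self, hr _ hab]
      exact hlt
    · rw [Function.update_of_ne hxa] at hne ⊢
      have hxb : x ≠ b := by rintro rfl; exact hne hpb
      rw [hr x hxb]
      exact (h.rank_lt x hx hne).trans_le (hmono _)
  · intro x hx
    by_cases hxa : x = a
    · simp [hxa, hra, hrb]
    · rw [Function.update_of_ne hxa, h.rt_par x hx]
  · intro x hx
    split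
    exacts [hb, h.rt_lt x hx]
  · intro x hx
    split
    · rw [Function.update_of_ne hab.symm, hpb]
    · rename_i hne
      rw [Function.update_of_ne hne, h.par_rt x hx]
  · intro x hx hp
    by_cases hxa : x = a
    · subst hxa
      simp [hab.symm] at hp
    · rw [Function.update_of_ne hxa] at hp
      rw [h.rt_eq x hx hp, if_neg hxa]
  · intro x hx
    by_cases hxb : x = b
    · subst hxb
      rw [hrb, if_neg hab.symm]
    · rw [hr x hxb]
      split
      · rename_i he
        have := h.rank_le x hx
        rw [he] at this
        omega
      · exact (h.rank_le x hx).trans (hmono _)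
  · rw [hroot]
    have hmb : b ∈ ((Finset.range N).filter (fun x => par x = x)).erase a := by
      simp [hb, hpb, hab.symm]
    have hma : a ∈ (Finset.range N).filter (fun x => par x = x) := by simp [ha, hpa]
    rw [← Finset.add_sum_erase _ _ hmb]
    have h1 := h.sum_le
    rw [← Finset.add_sum_erase _ _ hma, ← Finset.add_sum_erase _ _ hmb] at h1
    have h2 : ∑ x ∈ (((Finset.range N).filter (fun x => par x = x)).erase a).erase b, 2 ^ rank' x =
        ∑ x ∈ (((Finset.range N).filter (fun x => par x = x)).erase a).erase b, 2 ^ rank x :=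
      Finset.sum_congr rfl fun x hx => by rw [hr x (Finset.ne_of_mem_erase hx)]
    omega

/-- The number of classes. -/
def roots (N : ℕ) (par : ℕ → ℕ) : ℕ := ((Finset.range N).filter fun x => par x = x).card

theorem roots_link {a b : ℕ} (ha : a < N) (hab : a ≠ b) (hpa : par a = a) :
    roots N (Function.update par a b) + 1 = roots N par := by
  have hroot : (Finset.range N).filter (fun x => Function.update par a b x = x) =
      ((Finset.range N).filter (fun x => par x = x)).erase a := by
    ext x
    simp only [Finset.mem_filter, Finset.mem_range, Finset.mem_erase]
    by_cases hx : x = a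
    · simp [hx, hab.symm]
    · simp [hx]
  rw [roots, hroot]
  exact Finset.card_erase_add_one (by simp [ha, hpa])

end IsForest

/-! ### Find and union on the machine -/

namespace RAM

open RAM.Expr RAM.Cmd

/-- Climb from the element in the variable `u` to its root. -/
def ufFind (u : ℕ) : Cmd :=
  loop (bin .eq (bin .eq (get 12 (var u)) (var u)) (lit 0)) (assign u (get 12 (var u)))

/-- Join the classes of the roots in the variables `24` and `25`. -/
def ufUnion : Cmd :=
  branch (bin .lt (get 13 (var 24)) (get 13 (var 25))) (store 12 (var 24) (var 25))
    (branch (bin .eq (get 13 (var 24)) (get 13 (var 25)))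
      (store 13 (var 24) (bin .add (get 13 (var 24)) (lit 1))) skip ;;
    store 12 (var 25) (var 24))

variable {N S V : ℕ} {s : State} {rt : ℕ → ℕ}

/-- Ranks strictly increase on the way up and are at most `log N`, which bounds the climb without
path compression. -/
theorem runs_ufFind (h : IsForest N (s.arr 12) (s.arr 13) rt) (hS : N ≤ S) {u : ℕ}
    (hu : s.var u < N) :
    Runs S V (ufFind u) s fun t s' => s'.var u = rt (s.var u) ∧
      t ≤ 10 * Nat.log 2 N + 7 := by
  refine (Runs.loop (S := S) (V := V) (c := assign u (get 12 (var u)))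
    (e := bin .eq (bin .eq (get 12 (var u)) (var u)) (lit 0)) (s := s)
    (Inv := fun s' => s'.arr = s.arr ∧ s'.var u < N ∧ rt (s'.var u) = rt (s.var u))
    (fun s' => 10 * (Nat.log 2 N - s'.arr 13 (s'.var u))) ⟨rfl, hu, rfl⟩ ?_ ?_ ?_).mono ?_
  · rintro s' - ⟨h1, h2, h3⟩
    simp [Idx, eval]
    omega
  · rintro s' hb ⟨h1, h2, h3⟩ hne
    have hne' : s'.arr 12 (s'.var u) ≠ s'.var u := Op.apply_eq_eq_zero.mp (Op.apply_eq_ne_zero.mp hne)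
    rw [← h1] at h
    have hlt := h.rank_lt _ h2 hne'
    have hpar := h.par_lt _ h2
    have hlog := h.rank_le_log hpar
    refine Runs.flat ?_ (fun t ht => ?_) (by simp [Cmd.weight, Expr.weight])
    · simp [Ok, Idx, eval]
      exact ⟨by omega, hb.arr_le _ _⟩
    · have ht : t ≤ 3 := ht
      simp only [run, eval, State.setVar, Function.update_self, cost]
      refine ⟨⟨h1, hpar, (h.rt_par _ h2).trans h3⟩, ?_⟩
      omega
  · simp [Expr.weight]
  · rintro t s' - ⟨⟨h1, h2, h3⟩, hz, ht⟩
    have he : s'.arr 12 (s'.var u) = s'.var u := by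
      by_contra hne
      exact Op.apply_eq_eq_zero.mp hz (Op.apply_eq_eq_zero.mpr hne)
    refine ⟨?_, ?_⟩
    · rw [← h3]
      exact (h.rt_eq _ h2 (h1 ▸ he)).symm
    · simp only [cost] at ht
      omega

theorem runs_ufUnion (h : IsForest N (s.arr 12) (s.arr 13) rt) (hS : N ≤ S) (hV : N + 1 ≤ V)
    (h4 : s.var 24 < N) (h5 : s.var 25 < N) (hne : s.var 24 ≠ s.var 25)
    (hp4 : s.arr 12 (s.var 24) = s.var 24) (hp5 : s.arr 12 (s.var 25) = s.var 25) :
    Runs S V ufUnion s fun t s' => t ≤ 30 ∧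
      IsForest.roots N (s'.arr 12) + 1 = IsForest.roots N (s.arr 12) ∧
      ∃ rt', IsForest N (s'.arr 12) (s'.arr 13) rt' ∧ ∀ x y, rt' x = rt' y ↔ rt x = rt y ∨
        rt x = s.var 24 ∧ rt y = s.var 25 ∨ rt x = s.var 25 ∧ rt y = s.var 24 := by
  have hlog : s.arr 13 (s.var 24) < N := (h.rank_le_log h4).trans_lt
    (Nat.log_lt_self 2 (by omega))
  by_cases hlt : s.arr 13 (s.var 24) < s.arr 13 (s.var 25)
  · have h12 : (ufUnion.run s).arr 12 = Function.update (s.arr 12) (s.var 24) (s.var 25) := by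
      simp [ufUnion, run, eval, Op.apply, hlt, State.setArr]
    have h13 : (ufUnion.run s).arr 13 = s.arr 13 := by
      simp [ufUnion, run, eval, Op.apply, hlt, State.setArr]
    refine Runs.flat ?_ fun t ht => ⟨ht.trans (by decide), ?_, ?_⟩
    · simp [ufUnion, Ok, Idx, eval, Op.apply, hlt]
      omega
    · rw [h12]
      exact IsForest.roots_link h4 hne hp4
    · refine ⟨fun z => if rt z = s.var 24 then s.var 25 else rt z, ?_, fun x y => ?_⟩
      · rw [h12, h13]
        exact h.link h4 h5 hne hp4 hp5 (fun _ _ => rfl) hlt le_rfl (Nat.le_add_left _ _)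
      · dsimp only
        grind
  · have h12 : (ufUnion.run s).arr 12 = Function.update (s.arr 12) (s.var 25) (s.var 24) := by
      by_cases he : s.arr 13 (s.var 24) = s.arr 13 (s.var 25) <;>
      simp [ufUnion, run, eval, Op.apply, hlt, State.setArr, he]
    have h13 : (ufUnion.run s).arr 13 = if s.arr 13 (s.var 24) = s.arr 13 (s.var 25) then
        Function.update (s.arr 13) (s.var 24) (s.arr 13 (s.var 24) + 1) else s.arr 13 := by
      by_cases he : s.arr 13 (s.var 24) = s.arr 13 (s.var 25) <;>
      simp [ufUnion, run, eval, Op.apply, hlt, State.setArr, he]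
    refine Runs.flat ?_ fun t ht => ⟨ht.trans (by decide), ?_, ?_⟩
    · by_cases he : s.arr 13 (s.var 24) = s.arr 13 (s.var 25)
      · simp [ufUnion, Ok, Idx, run, eval, Op.apply, State.setArr, he]
        omega
      · simp [ufUnion, Ok, Idx, run, eval, Op.apply, hlt, he]
        omega
    · rw [h12]
      exact IsForest.roots_link h5 hne.symm hp5
    · refine ⟨fun z => if rt z = s.var 25 then s.var 24 else rt z, ?_, fun x y => ?_⟩
      · rw [h12]
        refine h.link h5 h4 hne.symm hp5 hp4 (fun x hx => ?_) ?_ ?_ ?_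
        · rw [h13]
          split
          · rw [Function.update_of_ne hx]
          · rfl
        · rw [h13]
          split
          · rw [Function.update_self]; omega
          · omega
        · rw [h13]
          split
          · rw [Function.update_self]; omega
          · rfl
        · rw [h13]
          split
          · rename_i he
            rw [Function.update_self, ← he, pow_succ]
            omega
          · exact Nat.le_add_left _ _
      · dsimp only
        grind

end RAM


/-! ### Equivalence test: closure of the seed pairs under transitions -/

namespace RAM

open RAM.Expr RAM.Cmd

/-- Put the pair of the variables `22` and `23` into the queue and join the classes. -/
def hkMerge : Cmd :=
  store 14 (var 20) (var 22) ;;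
  store 15 (var 20) (var 23) ;;
  assign 20 (bin .add (var 20) (lit 1)) ;;
  ufUnion

/-- Find the successors of the current pair under the current letter. -/
def hkFetch : Cmd :=
  assign 22 (get 2 (bin .add (bin .mul (get 14 (var 19)) (var 7)) (var 21))) ;;
  assign 23 (get 2 (bin .add (bin .mul (get 15 (var 19)) (var 7)) (var 21))) ;;
  assign 24 (var 22)

/-- Identify the successors of the current pair under the current letter. -/
def hkLetter : Cmd :=
  hkFetch ;;
  ufFind 24 ;;
  assign 25 (var 23) ;;
  ufFind 25 ;;
  branch (bin .eq (var 24) (var 25)) skip hkMerge ;;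
  assign 21 (bin .add (var 21) (lit 1))

/-- Compare the colours of the current pair and go to the next pair. -/
def hkNext : Cmd :=
  branch (bin .eq (get 11 (get 14 (var 19))) (get 11 (get 15 (var 19)))) skip
    (assign 10 (lit 0)) ;;
  assign 19 (bin .add (var 19) (lit 1)) ;;
  assign 21 (lit 0)

/-- The closure of the pairs in the queue under transitions, with a comparison of the colours. -/
def hkLoop : Cmd :=
  loop (bin .lt (var 19) (var 20)) (branch (bin .lt (var 21) (var 7)) hkLetter hkNext)

variable {T : ℕ → ℕ → ℕ} {N L : ℕ} {acc : ℕ → Prop} {c : ℕ → ℕ} {a₀ : ℕ} {p₀ q₀ p₁ q₁ : ℕ}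
  {S V : ℕ} {s : State}

/-- Some pair below `k` in the queue is `(x, y)`. -/
def Queued (s : State) (x y : ℕ) : Prop := ∃ j < s.var 20, s.arr 14 j = x ∧ s.arr 15 j = y

/-- The memory during the computation of the closure. -/
structure HkState (T : ℕ → ℕ → ℕ) (N L : ℕ) (acc : ℕ → Prop) (c : ℕ → ℕ) (a₀ p₀ q₀ p₁ q₁ : ℕ)
    (rt : ℕ → ℕ) (s : State) : Prop where
  L_eq : s.var 7 = L
  table : ∀ x < N, ∀ l < L, s.arr 2 (x * L + l) = T x l
  col : s.arr 11 = c
  forest : IsForest N (s.arr 12) (s.arr 13) rt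
  length : s.var 20 + IsForest.roots N (s.arr 12) = N + 2
  two_le : 2 ≤ s.var 20
  seed : s.arr 14 0 = p₀ ∧ s.arr 15 0 = q₀ ∧ s.arr 14 1 = p₁ ∧ s.arr 15 1 = q₁
  lt : ∀ j < s.var 20, s.arr 14 j < N ∧ s.arr 15 j < N
  idx_le : s.var 19 ≤ s.var 20
  letter_le : s.var 21 ≤ L
  rel : ∀ x < N, ∀ y < N, rt x = rt y → Relation.EqvGen (Queued s) x y
  done : ∀ j < s.var 20, ∀ l < L, j < s.var 19 ∨ j = s.var 19 ∧ l < s.var 21 →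
    rt (T (s.arr 14 j) l) = rt (T (s.arr 15 j) l)
  equiv : TableEquiv T L acc p₀ q₀ → TableEquiv T L acc p₁ q₁ →
    ∀ j < s.var 20, TableEquiv T L acc (s.arr 14 j) (s.arr 15 j)
  ans_le : s.var 10 ≤ 1
  ans : s.var 10 = 1 ↔ a₀ = 1 ∧ ∀ j < s.var 19, c (s.arr 14 j) = c (s.arr 15 j)

theorem _root_.IsForest.roots_pos {par rank rt : ℕ → ℕ} (h : IsForest N par rank rt) {x : ℕ}
    (hx : x < N) : 0 < IsForest.roots N par :=
  Finset.card_pos.mpr ⟨rt x, by simp [h.rt_lt x hx, h.par_rt x hx]⟩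

/-- Once every pair is processed, `done` and `rel` make the equivalence relation generated by the
queue a congruence. If the colours agree on the queue, it respects colours and proves all pairs
equivalent. Conversely, if the seeds are equivalent, so are all queued pairs, and equivalent states
have equal colours. The seeds need not be joined in the forest, since only the implication from
equal roots to the generated relation is used. -/
theorem HkState.iff (hT : IsWeakTable T N L acc) (hc : IsColouring T N L acc c) {rt : ℕ → ℕ}
    (h : HkState T N L acc c a₀ p₀ q₀ p₁ q₁ rt s) (he : s.var 20 ≤ s.var 19) :
    s.var 10 = 1 ↔ a₀ = 1 ∧ TableEquiv T L acc p₀ q₀ ∧ TableEquiv T L acc p₁ q₁ := by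
  have hie : s.var 19 = s.var 20 := le_antisymm h.idx_le he
  obtain ⟨e1, e2, e3, e4⟩ := h.seed
  have h2 := h.two_le
  rw [h.ans, hie]
  refine and_congr_right fun _ => ⟨fun hcol => ?_, fun ⟨h0, h1⟩ j hj => ?_⟩
  · have key : ∀ j < s.var 20, TableEquiv T L acc (s.arr 14 j) (s.arr 15 j) := by
      intro j hj
      refine hc.tableEquiv_of_congruence hT (R := Relation.EqvGen (Queued s)) ?_ ?_ (h.lt j hj).1
        (h.lt j hj).2 (.rel _ _ ⟨j, hj, rfl, rfl⟩)
      · intro x y hxy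
        induction hxy with
        | rel x y hxy =>
          obtain ⟨i, hi, rfl, rfl⟩ := hxy
          exact hcol i hi
        | refl => rfl
        | symm _ _ _ ih => exact ih.symm
        | trans _ _ _ _ _ ih₁ ih₂ => exact ih₁.trans ih₂
      · intro x y hxy l hl
        induction hxy with
        | rel x y hxy =>
          obtain ⟨i, hi, rfl, rfl⟩ := hxy
          exact h.rel _ (hT.lt _ (h.lt i hi).1 l hl) _ (hT.lt _ (h.lt i hi).2 l hl)
            (h.done i hi l hl (.inl (by omega)))
        | refl => exact .refl _
        | symm _ _ _ ih => exact ih.symm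
        | trans _ _ _ _ _ ih₁ ih₂ => exact ih₁.trans _ _ _ ih₂
    have k0 := key 0 (by omega)
    have k1 := key 1 (by omega)
    rw [e1, e2] at k0
    rw [e3, e4] at k1
    exact ⟨k0, k1⟩
  · exact hc.eq_of_tableEquiv hT (h.lt j hj).1 (h.lt j hj).2 (h.equiv h0 h1 j hj)

theorem runs_hkNext {rt : ℕ → ℕ} (h : HkState T N L acc c a₀ p₀ q₀ p₁ q₁ rt s) (hS : N + 2 ≤ S)
    (hV : N + 2 ≤ V) (hlt : s.var 19 < s.var 20) (hl : L ≤ s.var 21) :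
    Runs S V hkNext s fun t s' => t ≤ 20 ∧ HkState T N L acc c a₀ p₀ q₀ p₁ q₁ rt s' ∧
      s'.var 19 = s.var 19 + 1 ∧ s'.var 21 = 0 := by
  have h1 := h.lt _ hlt
  have hlen := h.length
  have hans := h.ans_le
  have key : hkNext.Ok S V s ∧ ∃ a ≤ 1, (a = 1 ↔ a₀ = 1 ∧ ∀ j < s.var 19 + 1,
      c (s.arr 14 j) = c (s.arr 15 j)) ∧ hkNext.run s =
        ((s.setVar 10 a).setVar 19 (s.var 19 + 1)).setVar 21 0 := by
    have hsplit : (∀ j < s.var 19 + 1, c (s.arr 14 j) = c (s.arr 15 j)) ↔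
        (∀ j < s.var 19, c (s.arr 14 j) = c (s.arr 15 j)) ∧
          c (s.arr 14 (s.var 19)) = c (s.arr 15 (s.var 19)) := Nat.forall_lt_succ_right
    by_cases he : c (s.arr 14 (s.var 19)) = c (s.arr 15 (s.var 19))
    · have he' := he
      rw [← h.col] at he'
      refine ⟨?_, s.var 10, hans, ?_, ?_⟩
      · simp [hkNext, Ok, Idx, run, eval, Op.apply, he']
        omega
      · rw [h.ans, hsplit]
        tauto
      · have : s.setVar 10 (s.var 10) = s := by simp [State.setVar]
        rw [this]
        simp [hkNext, run, eval, Op.apply, State.setVar, he']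
    · have he' := he
      rw [← h.col] at he'
      refine ⟨?_, 0, by omega, ?_, ?_⟩
      · simp [hkNext, Ok, Idx, run, eval, Op.apply, State.setVar, he']
        omega
      · rw [hsplit]
        tauto
      · simp [hkNext, run, eval, Op.apply, State.setVar, he']
  obtain ⟨hok, a, ha, hiff, hrun⟩ := key
  refine Runs.flat hok fun t ht => ⟨ht.trans (by decide), ?_⟩
  rw [hrun]
  refine ⟨{ h with
    idx_le := hlt
    letter_le := Nat.zero_le _
    done := ?_
    ans_le := ha
    ans := hiff }, rfl, rfl⟩
  intro j hj l hl' hcase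
  refine h.done j hj l hl' ?_
  have hcase : j < s.var 19 + 1 ∨ j = s.var 19 + 1 ∧ l < 0 := hcase
  omega

theorem HkState.congr {rt : ℕ → ℕ} (h : HkState T N L acc c a₀ p₀ q₀ p₁ q₁ rt s) {s' : State}
    (harr : s'.arr = s.arr) (h7 : s'.var 7 = s.var 7) (h10 : s'.var 10 = s.var 10)
    (h19 : s'.var 19 = s.var 19) (h20 : s'.var 20 = s.var 20) (h21 : s'.var 21 = s.var 21) :
    HkState T N L acc c a₀ p₀ q₀ p₁ q₁ rt s' := by
  have hQ : Queued s' = Queued s := by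
    funext x y
    simp only [Queued, harr, h20]
  obtain ⟨a1, a2, a3, a4, a5, a6, a7, a8, a9, a10, a11, a12, a13, a14, a15⟩ := h
  constructor <;> simp only [harr, h7, h10, h19, h20, h21, hQ] <;> assumption

/-- A pair is queued exactly when it joins two classes, so queue length plus number of classes is
constant. This keeps the queue within its arrays. -/
theorem runs_hkMerge {rt : ℕ → ℕ}
    (h : HkState T N L acc c a₀ p₀ q₀ p₁ q₁ rt s) (hS' : N + 2 ≤ S)
    (hV : N + 2 ≤ V) (hlt : s.var 19 < s.var 20) (hx : s.var 22 < N) (hy : s.var 23 < N)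
    (h24 : s.var 24 = rt (s.var 22)) (h25 : s.var 25 = rt (s.var 23))
    (hne : s.var 24 ≠ s.var 25)
    (he : TableEquiv T L acc p₀ q₀ → TableEquiv T L acc p₁ q₁ →
      TableEquiv T L acc (s.var 22) (s.var 23)) :
    Runs S V hkMerge s fun t s' => t ≤ 40 ∧
      ∃ rt', HkState T N L acc c a₀ p₀ q₀ p₁ q₁ rt' s' ∧ s'.var 19 = s.var 19 ∧
        s'.var 21 = s.var 21 ∧ rt' (s.var 22) = rt' (s.var 23) ∧
        s'.arr 14 (s.var 19) = s.arr 14 (s.var 19) ∧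
        s'.arr 15 (s.var 19) = s.arr 15 (s.var 19) := by
  have hlen := h.length
  have hpos := h.forest.roots_pos hx
  have h2 := h.two_le
  refine Runs.seq (Runs.flat ?_ fun t₁ ht₁ => Runs.seq (Runs.flat ?_ fun t₂ ht₂ =>
    Runs.seq (Runs.flat ?_ fun t₃ ht₃ => ?_)))
  · simp [Ok, Idx, eval]; omega
  · simp [Ok, Idx, run, eval, State.setArr]; omega
  · simp [Ok, Idx, run, eval, State.setArr, Op.apply]; omega
  have ht₁ : t₁ ≤ 3 := ht₁
  have ht₂ : t₂ ≤ 3 := ht₂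
  have ht₃ : t₃ ≤ 4 := ht₃
  set s₁ := run _ _ with hs₁
  have e20 : s₁.var 20 = s.var 20 + 1 := by simp [hs₁, run, eval, State.setArr, State.setVar, Op.apply]
  have evar : ∀ x, x ≠ 20 → s₁.var x = s.var x := fun x hx => by
    simp [hs₁, run, State.setArr, State.setVar, hx]
  have e14 : s₁.arr 14 = Function.update (s.arr 14) (s.var 20) (s.var 22) := by
    simp [hs₁, run, eval, State.setArr, State.setVar]
  have e15 : s₁.arr 15 = Function.update (s.arr 15) (s.var 20) (s.var 23) := by
    simp [hs₁, run, eval, State.setArr, State.setVar]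
  have earr : ∀ a, a ≠ 14 → a ≠ 15 → s₁.arr a = s.arr a := fun a ha hb => by
    simp [hs₁, run, eval, State.setArr, State.setVar, ha, hb]
  clear_value s₁
  have v22 := evar 22 (by decide)
  have v23 := evar 23 (by decide)
  have v24 := evar 24 (by decide)
  have v25 := evar 25 (by decide)
  have a12 := earr 12 (by decide) (by decide)
  have a13 := earr 13 (by decide) (by decide)
  refine (runs_ufUnion (N := N) (rt := rt) (by rw [a12, a13]; exact h.forest) (by omega)
    (by omega) ?_ ?_ ?_ ?_ ?_).frame.mono ?_
  · rw [v24, h24]; exact h.forest.rt_lt _ hx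
  · rw [v25, h25]; exact h.forest.rt_lt _ hy
  · rwa [v24, v25]
  · rw [v24, h24, a12]; exact h.forest.par_rt _ hx
  · rw [v25, h25, a12]; exact h.forest.par_rt _ hy
  rintro t s' - ⟨⟨ht, hroots, rt', hfor, hrt⟩, hvar, harr⟩
  rw [v24, v25, h24, h25] at hrt
  have w20 : s'.var 20 = s.var 20 + 1 := (hvar 20 rfl).trans e20
  have w7 : s'.var 7 = s.var 7 := (hvar 7 rfl).trans (evar 7 (by decide))
  have w10 : s'.var 10 = s.var 10 := (hvar 10 rfl).trans (evar 10 (by decide))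
  have w19 : s'.var 19 = s.var 19 := (hvar 19 rfl).trans (evar 19 (by decide))
  have w21 : s'.var 21 = s.var 21 := (hvar 21 rfl).trans (evar 21 (by decide))
  have b14 : s'.arr 14 = _ := (harr 14 rfl).trans e14
  have b15 : s'.arr 15 = _ := (harr 15 rfl).trans e15
  have b2 : s'.arr 2 = s.arr 2 := (harr 2 rfl).trans (earr 2 (by decide) (by decide))
  have b11 : s'.arr 11 = s.arr 11 := (harr 11 rfl).trans (earr 11 (by decide) (by decide))
  have q14 : ∀ j < s.var 20, s'.arr 14 j = s.arr 14 j := fun j hj => by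
    rw [b14, Function.update_of_ne hj.ne]
  have q15 : ∀ j < s.var 20, s'.arr 15 j = s.arr 15 j := fun j hj => by
    rw [b15, Function.update_of_ne hj.ne]
  have n14 : s'.arr 14 (s.var 20) = s.var 22 := by rw [b14, Function.update_self]
  have n15 : s'.arr 15 (s.var 20) = s.var 23 := by rw [b15, Function.update_self]
  have hQ : ∀ x y, Relation.EqvGen (Queued s) x y → Relation.EqvGen (Queued s') x y :=
    fun x y hxy => hxy.mono fun a b ⟨j, hj, h1, h2⟩ =>
      ⟨j, by omega, (q14 j hj).trans h1, (q15 j hj).trans h2⟩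
  have hnew : Relation.EqvGen (Queued s') (s.var 22) (s.var 23) :=
    .rel _ _ ⟨s.var 20, by omega, n14, n15⟩
  have hmono : ∀ x y, rt x = rt y → rt' x = rt' y := fun x y hxy => (hrt x y).mpr (.inl hxy)
  refine ⟨by omega, rt', ?_, w19, w21, (hrt _ _).mpr (.inr (.inl ⟨rfl, rfl⟩)), q14 _ hlt,
    q15 _ hlt⟩
  constructor
  case L_eq => exact w7.trans h.L_eq
  case table => rw [b2]; exact h.table
  case col => exact b11.trans h.col
  case forest => exact hfor
  case length => rw [a12] at hroots; omega
  case two_le => omega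
  case seed =>
    rw [q14 0 (by omega), q15 0 (by omega), q14 1 (by omega), q15 1 (by omega)]
    exact h.seed
  case lt =>
    intro j hj
    rcases Nat.lt_succ_iff_lt_or_eq.mp (w20 ▸ hj) with hj | rfl
    · rw [q14 j hj, q15 j hj]; exact h.lt j hj
    · rw [n14, n15]; exact ⟨hx, hy⟩
  case idx_le => omega
  case letter_le => rw [w21]; exact h.letter_le
  case rel =>
    intro x hx' y hy' hxy
    -- Elements of the two joined classes are connected through the pair that has just been queued,
    -- in one direction or the other.
    rcases (hrt x y).mp hxy with hr | ⟨h1, h2⟩ | ⟨h1, h2⟩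
    · exact hQ _ _ (h.rel x hx' y hy' hr)
    · exact ((hQ _ _ (h.rel x hx' _ hx h1)).trans _ _ _ hnew).trans _ _ _
        (hQ _ _ (h.rel _ hy y hy' h2.symm))
    · exact ((hQ _ _ (h.rel x hx' _ hy h1)).trans _ _ _ (hnew.symm _ _)).trans _ _ _
        (hQ _ _ (h.rel _ hx y hy' h2.symm))
  case done =>
    intro j hj l hl hcase
    rw [w19, w21] at hcase
    have hj : j < s.var 20 := by omega
    rw [q14 j hj, q15 j hj]
    exact hmono _ _ (h.done j hj l hl hcase)
  case equiv =>
    intro h0 h1 j hj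
    rcases Nat.lt_succ_iff_lt_or_eq.mp (w20 ▸ hj) with hj | rfl
    · rw [q14 j hj, q15 j hj]; exact h.equiv h0 h1 j hj
    · rw [n14, n15]; exact he h0 h1
  case ans_le => rw [w10]; exact h.ans_le
  case ans =>
    rw [w10, w19, h.ans]
    refine and_congr_right fun _ => forall₂_congr fun j hj => ?_
    rw [q14 j (by omega), q15 j (by omega)]

theorem runs_hkLetter (hT : IsWeakTable T N L acc) {rt : ℕ → ℕ}
    (h : HkState T N L acc c a₀ p₀ q₀ p₁ q₁ rt s) (hS : N * L ≤ S) (hS' : N + 2 ≤ S)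
    (hV : N + 2 ≤ V) (hLV : L ≤ V) (hlt : s.var 19 < s.var 20) (hl : s.var 21 < L) :
    Runs S V hkLetter s fun t s' => t ≤ 20 * Nat.log 2 N + 150 ∧
      (∃ rt, HkState T N L acc c a₀ p₀ q₀ p₁ q₁ rt s') ∧
      s'.var 19 = s.var 19 ∧ s'.var 21 = s.var 21 + 1 := by
  obtain ⟨hX, hY⟩ := h.lt _ hlt
  have hlen := h.length
  have hTX := h.table _ hX _ hl
  have hTY := h.table _ hY _ hl
  have hxN := hT.lt _ hX _ hl
  have hyN := hT.lt _ hY _ hl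
  have hiX : s.arr 14 (s.var 19) * L + s.var 21 < N * L := by nlinarith
  have hiY : s.arr 15 (s.var 19) * L + s.var 21 < N * L := by nlinarith
  have hL := h.L_eq
  refine Runs.seq (Runs.flat ?_ fun t₁ ht₁ => ?_)
  · simp [hkFetch, Ok, Idx, run, eval, State.setVar, Op.apply, hL, hTX, hTY]
    omega
  have ht₁ : t₁ ≤ 23 := ht₁.trans (by decide)
  set s₁ := run _ _ with hs₁
  have e22 : s₁.var 22 = T (s.arr 14 (s.var 19)) (s.var 21) := by
    simp [hs₁, hkFetch, run, eval, State.setVar, Op.apply, hL, hTX]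
  have e23 : s₁.var 23 = T (s.arr 15 (s.var 19)) (s.var 21) := by
    simp [hs₁, hkFetch, run, eval, State.setVar, Op.apply, hL, hTY]
  have e24 : s₁.var 24 = T (s.arr 14 (s.var 19)) (s.var 21) := by
    simp [hs₁, hkFetch, run, eval, State.setVar, Op.apply, hL, hTX]
  have earr : s₁.arr = s.arr := by simp [hs₁, hkFetch, run, State.setVar]
  have evar : ∀ x < 22, s₁.var x = s.var x := fun x hx => by
    simp [hs₁, hkFetch, run, State.setVar, hx.ne, show x ≠ 23 by omega, show x ≠ 24 by omega]
  clear_value s₁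
  set x := T (s.arr 14 (s.var 19)) (s.var 21) with hx
  set y := T (s.arr 15 (s.var 19)) (s.var 21) with hy
  refine Runs.seq ((runs_ufFind (rt := rt) (by rw [earr]; exact h.forest) (by omega)
    (e24 ▸ hxN)).frame.mono ?_)
  rintro t₂ s₂ - ⟨⟨f24, ht₂⟩, fvar, farr⟩
  refine Runs.seq (Runs.flat ?_ fun t₃ ht₃ => ?_)
  · have f23 : s₂.var 23 = y := (fvar 23 rfl).trans e23
    simp [Ok, Idx, eval, f23]
    omega
  have ht₃ : t₃ ≤ 2 := ht₃
  set s₃ := run _ _ with hs₃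
  have g25 : s₃.var 25 = y := by
    simp only [hs₃, run, eval, State.setVar, Function.update_self]
    exact (fvar 23 rfl).trans e23
  have gvar : ∀ z, z ≠ 25 → s₃.var z = s₂.var z := fun z hz => by
    simp [hs₃, run, State.setVar, hz]
  have garr : s₃.arr = s.arr := by
    funext a
    simp only [hs₃, run, State.setVar]
    rw [farr a rfl, earr]
  clear_value s₃
  refine Runs.seq ((runs_ufFind (rt := rt) (by rw [garr]; exact h.forest) (by omega)
    (g25 ▸ hyN)).frame.mono ?_)
  rintro t₄ s₄ - ⟨⟨k25, ht₄⟩, kvar, karr⟩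
  have karr : s₄.arr = s.arr := by
    funext a
    rw [karr a rfl, garr]
  have k22 : s₄.var 22 = x :=
    (kvar 22 rfl).trans ((gvar 22 (by decide)).trans ((fvar 22 rfl).trans e22))
  have k23 : s₄.var 23 = y :=
    (kvar 23 rfl).trans ((gvar 23 (by decide)).trans ((fvar 23 rfl).trans e23))
  have k24 : s₄.var 24 = rt x := by
    rw [kvar 24 rfl, gvar 24 (by decide), f24, e24]
  rw [g25] at k25
  have k7 : s₄.var 7 = s.var 7 :=
    (kvar 7 rfl).trans ((gvar 7 (by decide)).trans ((fvar 7 rfl).trans (evar 7 (by decide))))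
  have k10 : s₄.var 10 = s.var 10 :=
    (kvar 10 rfl).trans ((gvar 10 (by decide)).trans ((fvar 10 rfl).trans (evar 10 (by decide))))
  have k19 : s₄.var 19 = s.var 19 :=
    (kvar 19 rfl).trans ((gvar 19 (by decide)).trans ((fvar 19 rfl).trans (evar 19 (by decide))))
  have k20 : s₄.var 20 = s.var 20 :=
    (kvar 20 rfl).trans ((gvar 20 (by decide)).trans ((fvar 20 rfl).trans (evar 20 (by decide))))
  have k21 : s₄.var 21 = s.var 21 :=
    (kvar 21 rfl).trans ((gvar 21 (by decide)).trans ((fvar 21 rfl).trans (evar 21 (by decide))))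
  have h₄ : HkState T N L acc c a₀ p₀ q₀ p₁ q₁ rt s₄ := h.congr karr k7 k10 k19 k20 k21
  have hfinal : ∀ {s₅ : State} {rt' : ℕ → ℕ}, HkState T N L acc c a₀ p₀ q₀ p₁ q₁ rt' s₅ →
      s₅.var 19 = s.var 19 → s₅.var 21 = s.var 21 →
      rt' (T (s₅.arr 14 (s₅.var 19)) (s₅.var 21)) = rt' (T (s₅.arr 15 (s₅.var 19)) (s₅.var 21)) →
      Runs S V (assign 21 (bin .add (var 21) (lit 1))) s₅ fun t s' => t ≤ 4 ∧
        (∃ rt, HkState T N L acc c a₀ p₀ q₀ p₁ q₁ rt s') ∧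
        s'.var 19 = s.var 19 ∧ s'.var 21 = s.var 21 + 1 := by
    intro s₅ rt' h₅ h19 h21 hrt
    refine Runs.flat ?_ fun t ht => ⟨ht, ⟨rt', ?_⟩, h19, ?_⟩
    · simp [Ok, Idx, eval, Op.apply]
      omega
    · refine { h₅ with
        letter_le := ?_
        done := ?_ }
      · change s₅.var 21 + 1 ≤ L
        omega
      · intro j hj l hl' hcase
        have hcase : j < s₅.var 19 ∨ j = s₅.var 19 ∧ l < s₅.var 21 + 1 := hcase
        by_cases hlast : j = s₅.var 19 ∧ l = s₅.var 21
        · obtain ⟨rfl, rfl⟩ := hlast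
          exact hrt
        · exact h₅.done j hj l hl' (by omega)
    · change s₅.var 21 + 1 = s.var 21 + 1
      omega
  refine Runs.seq (Runs.branch ⟨trivial, trivial⟩ (fun hne => ?_) (fun hz => ?_))
  · have heq : s₄.var 24 = s₄.var 25 := Op.apply_eq_ne_zero.mp hne
    refine Runs.flat trivial fun t₅ ht₅ => (hfinal h₄ k19 k21 ?_).mono ?_
    · rw [karr, k19, k21, ← hx, ← hy, ← k24, ← k25, heq]
    · rintro t₆ s₆ - ⟨ht₆, h₆⟩
      have ht₅ : t₅ ≤ 1 := ht₅
      exact ⟨by simp only [cost]; omega, h₆⟩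
  · have hne : s₄.var 24 ≠ s₄.var 25 := Op.apply_eq_eq_zero.mp hz
    refine (runs_hkMerge h₄ hS' hV (by omega) (k22 ▸ hxN) (k23 ▸ hyN) (by rw [k24, k22])
      (by rw [k25, k23]) hne ?_).frame.mono ?_
    · intro h0 h1
      rw [k22, k23]
      exact (h.equiv h0 h1 _ hlt).step hl
    · rintro t₅ s₅ - ⟨⟨ht₅, rt', h₅, w19, w21, hrt, hX', hY'⟩, -, -⟩
      refine (hfinal h₅ (w19.trans k19) (w21.trans k21) ?_).mono ?_
      · rw [k22, k23] at hrt
        rw [k19, karr] at hX' hY'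
        rw [w19, w21, k19, k21, hX', hY', ← hx, ← hy, hrt]
      · rintro t₆ s₆ - ⟨ht₆, h₆⟩
        exact ⟨by simp only [cost]; omega, h₆⟩

/-- Each of at most `N + 2` pairs takes `L` letter steps and one step to move on, which explains the
factor `L + 1`. A letter step contains two climbs of length at most `log N`. -/
theorem runs_hkLoop (hT : IsWeakTable T N L acc) (hc : IsColouring T N L acc c)
    (h : ∃ rt, HkState T N L acc c a₀ p₀ q₀ p₁ q₁ rt s) (hi : s.var 19 = 0)
    (hS : N * L ≤ S) (hS' : N + 2 ≤ S) (hV : N + 2 ≤ V) (hLV : L ≤ V) :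
    Runs S V hkLoop s fun t s' =>
      t ≤ (20 * Nat.log 2 N + 170) * ((N + 2) * (L + 1)) + 4 ∧ s'.var 10 ≤ 1 ∧
      (s'.var 10 = 1 ↔ a₀ = 1 ∧ TableEquiv T L acc p₀ q₀ ∧ TableEquiv T L acc p₁ q₁) := by
  refine (Runs.loop (Inv := fun s => ∃ rt, HkState T N L acc c a₀ p₀ q₀ p₁ q₁ rt s)
    (fun s => (20 * Nat.log 2 N + 170) * ((N + 2 - s.var 19) * (L + 1) - s.var 21)) h ?_
    fun s hb hs hne => ?_).mono ?_
  · exact fun s _ _ => ⟨trivial, trivial⟩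
  · obtain ⟨rt, hs⟩ := hs
    have hlt : s.var 19 < s.var 20 := Op.apply_lt_ne_zero.mp hne
    have hlen := hs.length
    have hle := hs.letter_le
    refine Runs.branch ⟨trivial, trivial⟩ (fun hne => ?_) (fun hz => ?_)
    · have hl : s.var 21 < L := by
        rw [← hs.L_eq]
        exact Op.apply_lt_ne_zero.mp hne
      refine (runs_hkLetter hT hs hS hS' hV hLV hlt hl).mono ?_
      rintro t s' - ⟨ht, h1, h2, h3⟩
      refine ⟨h1, ?_⟩
      rw [h2, h3]
      obtain ⟨k, hk⟩ : ∃ k, N + 2 - s.var 19 = k + 1 := ⟨N + 1 - s.var 19, by omega⟩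
      obtain ⟨m, hm⟩ : ∃ m, (k + 1) * (L + 1) - s.var 21 = m + 1 :=
        ⟨(k + 1) * (L + 1) - s.var 21 - 1, by
          have : L + 1 ≤ (k + 1) * (L + 1) := Nat.le_mul_of_pos_left _ (by omega)
          omega⟩
      rw [hk, hm, show (k + 1) * (L + 1) - (s.var 21 + 1) = m by omega, Nat.mul_succ]
      simp only [cost]
      omega
    · have hl : L ≤ s.var 21 := by
        rw [← hs.L_eq]
        exact Op.apply_lt_eq_zero.mp hz
      refine (runs_hkNext hs hS' hV hlt hl).mono ?_
      rintro t s' - ⟨ht, h1, h2, h3⟩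
      refine ⟨⟨rt, h1⟩, ?_⟩
      rw [h2, h3]
      obtain ⟨k, hk⟩ : ∃ k, N + 2 - s.var 19 = k + 1 := ⟨N + 1 - s.var 19, by omega⟩
      have hm : (k + 1) * (L + 1) - L = k * (L + 1) + 1 := by rw [Nat.succ_mul]; omega
      rw [hk, show N + 2 - (s.var 19 + 1) = k by omega, show s.var 21 = L by omega, hm,
        Nat.sub_zero, Nat.mul_succ _ (k * (L + 1))]
      generalize (20 * Nat.log 2 N + 170) * (k * (L + 1)) = Z
      simp only [cost]
      omega
  · rintro t s' - ⟨⟨rt, hs'⟩, hz, ht⟩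
    have hle : s'.var 20 ≤ s'.var 19 := Op.apply_lt_eq_zero.mp hz
    refine ⟨?_, hs'.ans_le, hs'.iff hT hc hle⟩
    rw [hi] at ht
    simp only [cost] at ht
    exact (Nat.le_add_right t _).trans (ht.trans
      (Nat.add_le_add (Nat.mul_le_mul_left _ (Nat.sub_le _ _)) le_rfl))

end RAM


/-! ### The product automaton that compares dual encodings -/

/-- The mode after reading the letter number `k`, with the switch `sw`. The modes `0,…,3` count the
stars that have been read, and `4` and `5` read the two tails of a pair of dual words. -/
def dualMode (b B pw m sw k : ℕ) : ℕ :=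
  if k < B then
    if m < 4 then if sw = 1 then if k / pw % b + 1 < b then if m < 1 then 4 else 5 else m else m
    else m
  else if 0 < m then if m < 3 then m + 1 else m else m

/-- The letter that the given automaton reads. -/
def dualLetter (b B pw m sw k : ℕ) : ℕ :=
  if k < B then
    if m < 4 then if sw = 1 then if k / pw % b + 1 < b then if m < 1 then k else k + pw else k
      else k
    else if m < 5 then k + (b - 1 - k / pw % b) * pw else k - k / pw % b * pw
  else k

/-- The transition table of the product automaton. -/
def dualTable (δ : ℕ → ℕ) (b n B pw x l : ℕ) : ℕ :=
  dualMode b B pw (x / n) (l / (B + 1)) (l % (B + 1)) * n +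
    δ (x % n * (B + 1) + dualLetter b B pw (x / n) (l / (B + 1)) (l % (B + 1)))

/-- The accepting states of the product automaton. -/
def dualFlag (F : ℕ → ℕ) (n x : ℕ) : ℕ :=
  if x / n = 1 then 0 else if x / n = 3 then 0 else F (x % n)

theorem dualMode_lt {b B pw m sw k : ℕ} (hm : m < 6) : dualMode b B pw m sw k < 6 := by
  unfold dualMode
  split_ifs <;> omega

/-! ### The table of the product automaton on the machine -/

namespace RAM

open RAM.Expr RAM.Cmd

/-- Decode the index in the variable `26`. -/
def tableDecode : Cmd :=
  assign 28 (bin .div (bin .div (var 26) (var 7)) (var 2)) ;;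
  assign 29 (bin .mod (bin .div (var 26) (var 7)) (var 2)) ;;
  assign 30 (bin .div (bin .mod (var 26) (var 7)) (var 5)) ;;
  assign 31 (bin .mod (bin .mod (var 26) (var 7)) (var 5)) ;;
  assign 32 (bin .mod (bin .div (var 31) (var 9)) (var 0))

/-- Compute the new mode and the letter for the given automaton. -/
def tableMode : Cmd :=
  branch (bin .lt (var 31) (var 4))
    (branch (bin .lt (var 28) (lit 4))
      (branch (bin .eq (var 30) (lit 1))
        (branch (bin .lt (bin .add (var 32) (lit 1)) (var 0))
          (branch (bin .lt (var 28) (lit 1)) (assign 28 (lit 4))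
            (assign 28 (lit 5) ;; assign 31 (bin .add (var 31) (var 9)))) skip) skip)
      (branch (bin .lt (var 28) (lit 5))
        (assign 31 (bin .add (var 31)
          (bin .mul (bin .sub (bin .sub (var 0) (lit 1)) (var 32)) (var 9))))
        (assign 31 (bin .sub (var 31) (bin .mul (var 32) (var 9))))))
    (branch (bin .lt (lit 0) (var 28))
      (branch (bin .lt (var 28) (lit 3)) (assign 28 (bin .add (var 28) (lit 1))) skip) skip)

/-- Compute one entry of the table of the product automaton. -/
def tableStep : Cmd :=
  tableDecode ;;
  tableMode ;;
  store 2 (var 26) (bin .add (bin .mul (var 28) (var 2))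
    (get 0 (bin .add (bin .mul (var 29) (var 5)) (var 31)))) ;;
  assign 26 (bin .add (var 26) (lit 1))

def tableLoop : Cmd := loop (bin .lt (var 26) (bin .mul (var 6) (var 7))) tableStep

/-- Compute the flag of one state and reset its entries in the arrays. -/
def resetStep : Cmd :=
  branch (bin .eq (bin .div (var 26) (var 2)) (lit 1)) (store 3 (var 26) (lit 0))
    (branch (bin .eq (bin .div (var 26) (var 2)) (lit 3)) (store 3 (var 26) (lit 0))
      (store 3 (var 26) (get 1 (bin .mod (var 26) (var 2))))) ;;
  store 4 (var 26) (lit 0) ;;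
  store 10 (var 26) (lit 0) ;;
  store 12 (var 26) (var 26) ;;
  store 13 (var 26) (lit 0) ;;
  assign 26 (bin .add (var 26) (lit 1))

def resetLoop : Cmd := loop (bin .lt (var 26) (var 6)) resetStep

/-- The parameters of the product automaton are in the memory. -/
structure HeadState (b n B pw : ℕ) (s : State) : Prop where
  base : s.var 0 = b
  size : s.var 2 = n
  letters : s.var 4 = B
  letters_succ : s.var 5 = B + 1
  states : s.var 6 = 6 * n
  alphabet : s.var 7 = 2 * (B + 1)
  power : s.var 9 = pw
  table_lt : ∀ i < n * (B + 1), s.arr 0 i < n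
  flag_le : ∀ q < n, s.arr 1 q ≤ 1
  start : s.var 3 < n

variable {b n B pw S V : ℕ} {s : State}

theorem HeadState.congr (h : HeadState b n B pw s) {s' : State}
    (hv : ∀ x < 10, s'.var x = s.var x) (h0 : s'.arr 0 = s.arr 0) (h1 : s'.arr 1 = s.arr 1) :
    HeadState b n B pw s' := by
  obtain ⟨a1, a2, a3, a4, a5, a6, a7, a8, a9, a10⟩ := h
  constructor <;> simp only [h0, h1, hv _ (by norm_num : 0 < 10), hv _ (by norm_num : 2 < 10),
    hv _ (by norm_num : 3 < 10), hv _ (by norm_num : 4 < 10), hv _ (by norm_num : 5 < 10),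
    hv _ (by norm_num : 6 < 10), hv _ (by norm_num : 7 < 10), hv _ (by norm_num : 9 < 10)] <;>
    assumption

theorem run_tableMode {m sw k : ℕ} (h0 : s.var 0 = b) (h4 : s.var 4 = B) (h9 : s.var 9 = pw)
    (h28 : s.var 28 = m) (h30 : s.var 30 = sw) (h31 : s.var 31 = k)
    (h32 : s.var 32 = k / pw % b) :
    (tableMode.run s).var 28 = dualMode b B pw m sw k ∧
      (tableMode.run s).var 31 = dualLetter b B pw m sw k := by
  unfold dualMode dualLetter
  by_cases g1 : k < B
  · by_cases g2 : m < 4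
    · by_cases g3 : sw = 1
      · by_cases g4 : k / pw % b + 1 < b
        · by_cases g5 : m < 1 <;>
          simp [-Nat.lt_one_iff, tableMode, run, eval, Op.apply, State.setVar, h28, h30, h31, h32,
            h0, h4, h9, g1, g2, g3, g4, g5]
        · simp [tableMode, run, eval, Op.apply, h28, h30, h31, h32, h0, h4, g1, g2, g3, g4]
      · simp [tableMode, run, eval, Op.apply, h28, h30, h31, h4, g1, g2, g3]
    · by_cases g3 : m < 5 <;>
      simp [tableMode, run, eval, Op.apply, State.setVar, h28, h31, h32, h0, h4, h9, g1, g2, g3]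
  · by_cases g2 : 0 < m
    · by_cases g3 : m < 3 <;>
      simp [tableMode, run, eval, Op.apply, State.setVar, h28, h31, h4, g1, g2, g3]
    · simp [tableMode, run, eval, Op.apply, h28, h31, h4, g1, g2]

theorem ok_tableMode {m sw k : ℕ} (h0 : s.var 0 = b) (h4 : s.var 4 = B) (h9 : s.var 9 = pw)
    (h28 : s.var 28 = m) (h30 : s.var 30 = sw) (h31 : s.var 31 = k)
    (h32 : s.var 32 = k / pw % b) (hk : k ≤ B)
    (hdl : ∀ m, dualLetter b B pw m sw k ≤ B) (hV : B + 6 ≤ V) :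
    tableMode.Ok S V s := by
  have hd := hdl m
  have e0 := hdl 0
  have e1 := hdl 1
  unfold dualLetter at hd e0 e1
  by_cases g1 : k < B
  · by_cases g2 : m < 4
    · by_cases g3 : sw = 1
      · by_cases g4 : k / pw % b + 1 < b
        · simp [g1, g3, g4] at e1
          simp [tableMode, Ok, Idx, run, eval, Op.apply, State.setVar, h28, h30, h31, h32,
            h0, h4, h9, g1, g2, g3, g4]
          omega
        · simp [tableMode, Ok, Idx, eval, Op.apply, h28, h30, h31, h32, h0, h4, g1, g2, g3, g4]
      · simp [tableMode, Ok, Idx, eval, Op.apply, h28, h30, h31, h4, g1, g2, g3]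
    · by_cases g3 : m < 5 <;> simp [g1, g2, g3] at hd <;>
      simp [tableMode, Ok, Idx, eval, Op.apply, h28, h31, h32, h0, h4, h9, g1, g2, g3] <;> omega
  · by_cases g2 : 0 < m
    · by_cases g3 : m < 3 
      · simp [tableMode, Ok, Idx, eval, Op.apply, h28, h31, h4, g1, g2, g3]
        omega
      · simp [tableMode, Ok, Idx, eval, Op.apply, h28, h31, h4, g1, g2, g3]
    · simp [tableMode, Ok, Idx, eval, Op.apply, h28, h31, h4, g1, g2]

/-- The index is `x L + l` with `L = 2 (B + 1)`, so mode, state, switch, letter and the relevant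
digit are recovered by a fixed number of divisions. -/
theorem runs_tableStep (h : HeadState b n B pw s) (hn : 0 < n)
    (hdl : ∀ m sw k, k ≤ B → dualLetter b B pw m sw k ≤ B) (hS : 6 * n * (2 * (B + 1)) ≤ S)
    (hV : 6 * n * (2 * (B + 1)) + 6 ≤ V) (hi : s.var 26 < 6 * n * (2 * (B + 1))) :
    Runs S V tableStep s fun t s' => t ≤ 150 ∧ s'.var 26 = s.var 26 + 1 ∧
      s'.arr 2 = Function.update (s.arr 2) (s.var 26)
        (dualTable (s.arr 0) b n B pw (s.var 26 / (2 * (B + 1))) (s.var 26 % (2 * (B + 1)))) := by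
  obtain ⟨h0, h2, h4, h5, h6, h7, h9, htab, -, -⟩ := h
  have hL : 0 < 2 * (B + 1) := by omega
  set x := s.var 26 / (2 * (B + 1)) with hx
  set l := s.var 26 % (2 * (B + 1)) with hl
  have hxN : x < 6 * n := (Nat.div_lt_iff_lt_mul hL).mpr hi
  have hlL : l < 2 * (B + 1) := Nat.mod_lt _ hL
  have hm6 : x / n < 6 := (Nat.div_lt_iff_lt_mul hn).mpr hxN
  have hq : x % n < n := Nat.mod_lt _ hn
  have hk : l % (B + 1) < B + 1 := Nat.mod_lt _ (by omega)
  have hbig1 : 6 * n ≤ 6 * n * (2 * (B + 1)) := Nat.le_mul_of_pos_right _ hL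
  have hbig2 : 2 * (B + 1) ≤ 6 * n * (2 * (B + 1)) := Nat.le_mul_of_pos_left _ (by omega)
  have hsw : l / (B + 1) < 2 := (Nat.div_lt_iff_lt_mul (by omega)).mpr hlL
  have hb : l % (B + 1) / pw % b ≤ B :=
    (Nat.mod_le _ _).trans ((Nat.div_le_self _ _).trans (by omega))
  clear_value x l
  refine Runs.seq (Runs.flat ?_ fun t₁ ht₁ => ?_)
  · simp [tableDecode, Ok, Idx, run, eval, State.setVar, Op.apply, h0, h2,
      h5, h7, h9]
    rw [← hx, ← hl, show s.var 26 % (B + 1) = l % (B + 1) by rw [hl, Nat.mod_mul_left_mod]]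
    omega
  have ht₁ : t₁ ≤ 30 := ht₁.trans (by decide)
  set s₁ := run _ _ with hs₁
  have e28 : s₁.var 28 = x / n := by
    simp [hs₁, tableDecode, run, eval, State.setVar, Op.apply, h2, h7, hx]
  have e29 : s₁.var 29 = x % n := by
    simp [hs₁, tableDecode, run, eval, State.setVar, Op.apply, h2, h7, hx]
  have e30 : s₁.var 30 = l / (B + 1) := by
    simp [hs₁, tableDecode, run, eval, State.setVar, Op.apply, h5, h7, hl]
  have e31 : s₁.var 31 = l % (B + 1) := by
    simp [hs₁, tableDecode, run, eval, State.setVar, Op.apply, h5, h7, hl]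
  have e32 : s₁.var 32 = l % (B + 1) / pw % b := by
    simp [hs₁, tableDecode, run, eval, State.setVar, Op.apply, h0, h5, h7, h9, hl]
  have earr : s₁.arr = s.arr := by simp [hs₁, tableDecode, run, State.setVar]
  have evar : ∀ z < 28, s₁.var z = s.var z := fun z hz => by
    simp [hs₁, tableDecode, run, State.setVar, hz.ne, show z ≠ 29 by omega,
      show z ≠ 30 by omega, show z ≠ 31 by omega, show z ≠ 32 by omega]
  clear_value s₁
  have f0 := (evar 0 (by decide)).trans h0
  have f4 := (evar 4 (by decide)).trans h4
  have f9 := (evar 9 (by decide)).trans h9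
  set m := x / n with hm
  set sw := l / (B + 1) with hsw'
  set k := l % (B + 1) with hk'
  have hdl' := hdl m sw k (by omega)
  have hdm : dualMode b B pw m sw k < 6 := dualMode_lt hm6
  clear_value m sw k
  refine Runs.seq ((Runs.flat (Q := fun t s' => t ≤ 60 ∧ s' = tableMode.run s₁)
    (ok_tableMode f0 f4 f9 e28 e30 e31 e32 (by omega) (fun m => hdl m sw k (by omega))
      (by omega)) fun t₂ ht₂ => ⟨ht₂.trans (by decide), rfl⟩).frame.mono ?_)
  rintro t₂ s₂ - ⟨⟨ht₂, hs₂⟩, gvar, garr⟩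
  obtain ⟨g28, g31⟩ := run_tableMode f0 f4 f9 e28 e30 e31 e32
  rw [← hs₂] at g28 g31
  have g29 := (gvar 29 rfl).trans e29
  have g26 := (gvar 26 rfl).trans (evar 26 (by decide))
  have g2 := (gvar 2 rfl).trans ((evar 2 (by decide)).trans h2)
  have g5 := (gvar 5 rfl).trans ((evar 5 (by decide)).trans h5)
  have garr : s₂.arr = s.arr := by
    funext a
    rw [garr a rfl, earr]
  have hidx : x % n * (B + 1) + dualLetter b B pw m sw k < n * (B + 1) := by
    have := Nat.mul_le_mul_right (B + 1) (Nat.succ_le_of_lt hq)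
    rw [Nat.succ_mul] at this
    omega
  have hcell := htab _ hidx
  have hmn : dualMode b B pw m sw k * n ≤ 5 * n := Nat.mul_le_mul_right n (by omega)
  have hnB : n * (B + 1) ≤ 6 * n * (2 * (B + 1)) :=
    Nat.mul_le_mul (by omega) (by omega)
  refine Runs.flat ?_ fun t ht => ?_
  · simp [Ok, Idx, run, eval, State.setArr, Op.apply, g26, g2, g5, g28, g29, g31, garr]
    omega
  · have ht : t ≤ 20 := ht.trans (by decide)
    refine ⟨by omega, ?_, ?_⟩
    · simp [run, eval, State.setVar, State.setArr, Op.apply, g26]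
    · simp [run, eval, State.setVar, State.setArr, Op.apply, g26, g2, g5,
        g28, g29, g31, garr, dualTable,
        ← hm, ← hsw', ← hk']

end RAM


/-! ### The test for one component -/

namespace RAM

open RAM.Expr RAM.Cmd

variable {b n B pw S V : ℕ} {s : State}

theorem runs_tableLoop (h : HeadState b n B pw s) (hn : 0 < n)
    (hdl : ∀ m sw k, k ≤ B → dualLetter b B pw m sw k ≤ B) (hS : 6 * n * (2 * (B + 1)) ≤ S)
    (hV : 6 * n * (2 * (B + 1)) + 6 ≤ V) (h26 : s.var 26 = 0) :
    Runs S V tableLoop s fun t s' => t ≤ 160 * (6 * n * (2 * (B + 1))) + 6 ∧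
      ∀ x < 6 * n, ∀ l < 2 * (B + 1),
        s'.arr 2 (x * (2 * (B + 1)) + l) = dualTable (s.arr 0) b n B pw x l := by
  refine (Runs.loop (Inv := fun s' => HeadState b n B pw s' ∧ s'.arr 0 = s.arr 0 ∧
      s'.var 26 ≤ 6 * n * (2 * (B + 1)) ∧
      ∀ i < s'.var 26, s'.arr 2 i =
        dualTable (s.arr 0) b n B pw (i / (2 * (B + 1))) (i % (2 * (B + 1))))
    (fun s' => 160 * (6 * n * (2 * (B + 1)) - s'.var 26)) ⟨h, rfl, by omega, by omega⟩
    ?_ ?_).mono ?_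
  · exact fun _ _ _ => ⟨trivial, trivial, trivial⟩
  · rintro s' - ⟨hh, h0, hle, hrow⟩ hne
    have hlt : s'.var 26 < s'.var 6 * s'.var 7 := Op.apply_lt_ne_zero.mp hne
    rw [hh.states, hh.alphabet] at hlt
    refine (runs_tableStep hh hn hdl hS hV hlt).frame.mono ?_
    rintro t s₁ - ⟨⟨ht, hi, harr⟩, fvar, farr⟩
    refine ⟨⟨hh.congr (fun x hx => fvar x ?_) (farr 0 rfl) (farr 1 rfl), (farr 0 rfl).trans h0,
      by omega, fun i hi' => ?_⟩, ?_⟩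
    · interval_cases x <;> rfl
    · rw [harr, h0]
      rcases Nat.lt_succ_iff_lt_or_eq.mp (hi ▸ hi') with hlt' | rfl
      · rw [Function.update_of_ne hlt'.ne, hrow i hlt']
      · rw [Function.update_self]
    · simp only [cost]
      omega
  · rintro t s' - ⟨⟨hh, h0, hle, hrow⟩, hz, ht⟩
    have hge : s'.var 6 * s'.var 7 ≤ s'.var 26 := Op.apply_lt_eq_zero.mp hz
    rw [hh.states, hh.alphabet] at hge
    simp only [cost] at ht
    refine ⟨by omega, fun x hx l hl => ?_⟩
    have hlt : x * (2 * (B + 1)) + l < 6 * n * (2 * (B + 1)) := by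
      have := Nat.mul_le_mul_right (2 * (B + 1)) (Nat.succ_le_of_lt hx)
      rw [Nat.succ_mul] at this
      omega
    rw [hrow _ (by omega), mul_comm x, Nat.mul_add_div (by omega), Nat.mul_add_mod,
      Nat.div_eq_of_lt hl, Nat.mod_eq_of_lt hl, add_zero]

theorem runs_resetStep (h : HeadState b n B pw s) (hn : 0 < n) (hS : 6 * n ≤ S)
    (hV : 6 * n + 6 ≤ V) (hi : s.var 26 < 6 * n) :
    Runs S V resetStep s fun t s' => t ≤ 40 ∧ s'.var 26 = s.var 26 + 1 ∧
      s'.arr 3 = Function.update (s.arr 3) (s.var 26) (dualFlag (s.arr 1) n (s.var 26)) ∧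
      s'.arr 4 = Function.update (s.arr 4) (s.var 26) 0 ∧
      s'.arr 10 = Function.update (s.arr 10) (s.var 26) 0 ∧
      s'.arr 12 = Function.update (s.arr 12) (s.var 26) (s.var 26) ∧
      s'.arr 13 = Function.update (s.arr 13) (s.var 26) 0 := by
  have hmod : s.var 26 % n < n := Nat.mod_lt _ hn
  have hfl := h.flag_le _ hmod
  have h2 := h.size
  refine Runs.flat ?_ fun t ht => ⟨ht.trans (by decide), ?_⟩
  · by_cases g1 : s.var 26 / n = 1 <;> by_cases g3 : s.var 26 / n = 3 <;>
    simp [resetStep, Ok, Idx, run, eval, Op.apply, State.setArr, h2, g1, g3] <;>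
    omega
  · unfold dualFlag
    by_cases g1 : s.var 26 / n = 1 <;> by_cases g3 : s.var 26 / n = 3 <;>
    simp [resetStep, run, eval, Op.apply, State.setVar, State.setArr, h2, g1, g3]

theorem runs_resetLoop (h : HeadState b n B pw s) (hn : 0 < n) (hS : 6 * n ≤ S)
    (hV : 6 * n + 6 ≤ V) (h26 : s.var 26 = 0) :
    Runs S V resetLoop s fun t s' => t ≤ 50 * (6 * n) + 4 ∧
      ∀ x < 6 * n, s'.arr 3 x = dualFlag (s.arr 1) n x ∧ s'.arr 4 x = 0 ∧ s'.arr 10 x = 0 ∧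
        s'.arr 12 x = x ∧ s'.arr 13 x = 0 := by
  refine (Runs.loop (Inv := fun s' => HeadState b n B pw s' ∧ s'.arr 1 = s.arr 1 ∧
      s'.var 26 ≤ 6 * n ∧ ∀ x < s'.var 26, s'.arr 3 x = dualFlag (s.arr 1) n x ∧
        s'.arr 4 x = 0 ∧ s'.arr 10 x = 0 ∧ s'.arr 12 x = x ∧ s'.arr 13 x = 0)
    (fun s' => 50 * (6 * n - s'.var 26)) ⟨h, rfl, by omega, by omega⟩
    ?_ ?_).mono ?_
  · exact fun _ _ _ => ⟨trivial, trivial⟩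
  · rintro s' - ⟨hh, h0, hle, hrow⟩ hne
    have hlt : s'.var 26 < s'.var 6 := Op.apply_lt_ne_zero.mp hne
    rw [hh.states] at hlt
    refine (runs_resetStep hh hn hS hV hlt).frame.mono ?_
    rintro t s₁ - ⟨⟨ht, hi, a3, a4, a10, a12, a13⟩, fvar, farr⟩
    refine ⟨⟨hh.congr (fun x hx => fvar x ?_) (farr 0 rfl) (farr 1 rfl), (farr 1 rfl).trans h0,
      by omega, fun i hi' => ?_⟩, ?_⟩
    · interval_cases x <;> rfl
    · rw [a3, a4, a10, a12, a13, h0]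
      rcases Nat.lt_succ_iff_lt_or_eq.mp (hi ▸ hi') with hlt' | rfl
      · simp only [Function.update_of_ne hlt'.ne]
        exact hrow i hlt'
      · simp only [Function.update_self, and_self]
    · simp only [cost]
      omega
  · rintro t s' - ⟨⟨hh, h0, hle, hrow⟩, hz, ht⟩
    have hge : s'.var 6 ≤ s'.var 26 := Op.apply_lt_eq_zero.mp hz
    rw [hh.states] at hge
    simp only [cost] at ht
    exact ⟨by omega, fun x hx => hrow x (by omega)⟩

/-- Initialize the search and the queue. -/
def seedQueue : Cmd :=
  assign 11 (lit 0) ;; assign 12 (lit 0) ;; assign 13 (lit 0) ;; assign 14 (lit 0) ;;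
  assign 19 (lit 0) ;; assign 20 (lit 2) ;; assign 21 (lit 0) ;;
  store 14 (lit 0) (var 3) ;;
  store 15 (lit 0) (bin .add (var 2) (var 3)) ;;
  store 14 (lit 1) (get 0 (bin .mul (var 3) (var 5))) ;;
  store 15 (lit 1) (var 3)

/-- Test the conditions for one component and go to the next one. -/
def componentStep : Cmd :=
  assign 26 (lit 0) ;; tableLoop ;; assign 26 (lit 0) ;; resetLoop ;; seedQueue ;; sccLoop ;;
  hkLoop ;; assign 8 (bin .add (var 8) (lit 1)) ;; assign 9 (bin .mul (var 9) (var 0))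

/-- Only `st` and `ptr` have to be reset. All conditions on the other arrays concern the stacks,
which are empty, or removed states, of which there are none; so remains of an earlier component do
no harm. -/
theorem _root_.Scc.Inv.init {T : ℕ → ℕ → ℕ} {N L : ℕ} {acc : ℕ → Prop} {σ : Scc} (hR : σ.R = 0)
    (hs : σ.s = 0) (hc : σ.c = 0) (ht : σ.t = 0) (hst : ∀ x < N, σ.st x = 0)
    (hptr : ∀ x < N, σ.ptr x = 0) : σ.Inv T N L acc := by
  have hst' : ∀ x < N, σ.st x ≠ N + 1 := fun x hx => by rw [hst x hx]; omega
  constructor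
  case st_le => exact fun x hx _ => (hst x hx).le.trans (Nat.zero_le _)
  case S_st => exact fun x hx h => absurd (hst x hx) h
  case ptr_le => exact fun x hx => by simp [hptr x hx]
  case ptr_zero => exact fun x hx _ => hptr x hx
  case closed => exact fun x hx h => absurd h (hst' x hx)
  case parity => exact fun x hx h => absurd h (hst' x hx)
  case witness => exact fun x hx h => absurd h (hst' x hx)
  all_goals simp [hR, hs, hc, ht]

/-- Each state contributes `L` for its transitions, 4 for being unvisited and 1 as a possible root.
-/
theorem _root_.Scc.potential_init {N L : ℕ} {σ : Scc} (hR : σ.R = 0) (hs : σ.s = 0)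
    (hc : σ.c = 0) (ht : σ.t = 0) (hst : ∀ x < N, σ.st x = 0) (hptr : ∀ x < N, σ.ptr x = 0) :
    σ.potential N L = N * (L + 5) := by
  rw [Scc.potential_eq, hR, hs, hc, ht, Finset.sum_congr rfl (g := fun _ => L + 4)]
  · simp
    ring
  · intro x hx
    rw [Finset.mem_range] at hx
    simp [hst x hx, hptr x hx]

theorem _root_.Scc.Bounded.init {N L : ℕ} {σ : Scc} (ht : σ.t = 0) (hst : ∀ x < N, σ.st x = 0) :
    σ.Bounded N L (σ.potential N L) where
  le := le_rfl
  col x hx h := by rw [hst x hx] at h; omega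
  M j hj := by omega

/-- The forest starts with `N` classes and the queue with two pairs that are not joined; hence the
constant `N + 2` in `length`. -/
theorem HkState.init {T : ℕ → ℕ → ℕ} {N L : ℕ} {acc : ℕ → Prop} {a₀ : ℕ} {s : State}
    (h7 : s.var 7 = L) (htab : ∀ x < N, ∀ l < L, s.arr 2 (x * L + l) = T x l)
    (hpar : ∀ x < N, s.arr 12 x = x) (hrank : ∀ x < N, s.arr 13 x = 0)
    (h19 : s.var 19 = 0) (h20 : s.var 20 = 2) (h21 : s.var 21 = 0) (h10 : s.var 10 = a₀)
    (ha : a₀ ≤ 1) (hlt : ∀ j < 2, s.arr 14 j < N ∧ s.arr 15 j < N) :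
    HkState T N L acc (s.arr 11) a₀ (s.arr 14 0) (s.arr 15 0) (s.arr 14 1) (s.arr 15 1) id s where
  L_eq := h7
  table := htab
  col := rfl
  forest := .init hpar hrank
  length := by
    rw [h20, IsForest.roots, Finset.filter_true_of_mem fun x hx => hpar x (Finset.mem_range.mp hx)]
    simp [add_comm]
  two_le := h20.ge
  seed := ⟨rfl, rfl, rfl, rfl⟩
  lt := by rwa [h20]
  idx_le := by omega
  letter_le := by omega
  rel x _ y _ h := by
    cases h
    exact .refl x
  done := by omega
  equiv h0 h1 j hj := by
    rw [h20] at hj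
    interval_cases j
    exacts [h0, h1]
  ans_le := h10 ▸ ha
  ans := by simp [h10, h19]

/-- The number `m n + q` stands for the state `q` in mode `m`, and letter number 0 is the zero
vector. The first seed compares the initial state in the modes 0 and 1, the second compares, in mode
0, its successor under the zero vector with the initial state. -/
theorem HeadState.run_seedQueue (h : HeadState b n B pw s) (hS : 2 ≤ S) (hn : 0 < n)
    (hSt : n * (B + 1) ≤ S) (hV : 2 * n + 2 ≤ V) :
    seedQueue.Ok S V s ∧ (∀ x < 2, (seedQueue.run s).arr 14 x < 2 * n ∧
      (seedQueue.run s).arr 15 x < 2 * n) ∧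
    (seedQueue.run s).arr 14 0 = s.var 3 ∧ (seedQueue.run s).arr 15 0 = n + s.var 3 ∧
    (seedQueue.run s).arr 14 1 = s.arr 0 (s.var 3 * (B + 1)) ∧
    (seedQueue.run s).arr 15 1 = s.var 3 ∧
    (seedQueue.run s).var 11 = 0 ∧ (seedQueue.run s).var 12 = 0 ∧ (seedQueue.run s).var 13 = 0 ∧
    (seedQueue.run s).var 14 = 0 ∧ (seedQueue.run s).var 19 = 0 ∧ (seedQueue.run s).var 20 = 2 ∧
    (seedQueue.run s).var 21 = 0 ∧ (∀ x < 11, (seedQueue.run s).var x = s.var x) ∧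
    ∀ a < 14, (seedQueue.run s).arr a = s.arr a := by
  have h2 := h.size
  have h3 := h.start
  have h5 := h.letters_succ
  have hidx : s.var 3 * (B + 1) < n * (B + 1) := Nat.mul_lt_mul_of_pos_right h3 (by omega)
  have hcell := h.table_lt _ hidx
  have e14 : (seedQueue.run s).arr 14 = Function.update (Function.update (s.arr 14) 0 (s.var 3)) 1
      (s.arr 0 (s.var 3 * (B + 1))) := by
    simp [seedQueue, run, eval, Op.apply, State.setVar, State.setArr, h5]
  have e15 : (seedQueue.run s).arr 15 = Function.update (Function.update (s.arr 15) 0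
      (n + s.var 3)) 1 (s.var 3) := by
    simp [seedQueue, run, eval, Op.apply, State.setVar, State.setArr, h2]
  refine ⟨?_, fun x hx => ?_, ?_, ?_, ?_, ?_, ?_, ?_, ?_, ?_, ?_, ?_, ?_, fun x hx => ?_,
    fun a ha => ?_⟩
  · simp [seedQueue, Ok, Idx, run, eval, Op.apply, State.setVar, State.setArr, h2, h5]
    omega
  · rw [e14, e15]
    interval_cases x <;> simp <;> omega
  · simp [e14]
  · simp [e15]
  · simp [e14]
  · simp [e15]
  · simp [seedQueue, run, eval, State.setVar, State.setArr]
  · simp [seedQueue, run, eval, State.setVar, State.setArr]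
  · simp [seedQueue, run, eval, State.setVar, State.setArr]
  · simp [seedQueue, run, eval, State.setVar, State.setArr]
  · simp [seedQueue, run, eval, State.setVar, State.setArr]
  · simp [seedQueue, run, eval, State.setVar, State.setArr]
  · simp [seedQueue, run, eval, State.setVar, State.setArr]
  · interval_cases x <;> simp [seedQueue, run, State.setVar, State.setArr]
  · interval_cases a <;> simp [seedQueue, run, State.setVar, State.setArr]

/-- The words that are read from the seeds are accepted simultaneously. -/
def ComponentTest (δ F : ℕ → ℕ) (b n B q₀ pw : ℕ) : Prop :=
  TableEquiv (dualTable δ b n B pw) (2 * (B + 1)) (fun x => dualFlag F n x = 1) q₀ (n + q₀) ∧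
    TableEquiv (dualTable δ b n B pw) (2 * (B + 1)) (fun x => dualFlag F n x = 1)
      (δ (q₀ * (B + 1))) q₀

theorem component_time_aux {N L l : ℕ} (hL : 6 * L ≤ N * L) (hN : N * 4 ≤ N * L) (h4 : 4 ≤ L) :
    (20 * l + 170) * ((N + 2) * (L + 1)) ≤ 680 * (N * L * (l + 1)) := by
  have e2 : (N + 2) * (L + 1) ≤ 4 * (N * L) := by
    have : (N + 2) * (L + 1) = N * L + N + 2 * L + 2 := by ring
    omega
  calc (20 * l + 170) * ((N + 2) * (L + 1))
      ≤ (170 * (l + 1)) * (4 * (N * L)) := Nat.mul_le_mul (by omega) e2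
    _ = 680 * (N * L * (l + 1)) := by ring

/-- Both equivalences share one colouring and one closure, because the queue holds two seeds.
Variable 10 can only drop to 0 and collects the conjunction over the components; variable 9 moves on
to the next power of `b`. -/
theorem runs_componentStep (h : HeadState b n B pw s) (hn : 0 < n) (hB : 0 < B)
    (hdl : ∀ m sw k, k ≤ B → dualLetter b B pw m sw k ≤ B)
    (hT : IsWeakTable (dualTable (s.arr 0) b n B pw) (6 * n) (2 * (B + 1))
      fun x => dualFlag (s.arr 1) n x = 1)
    (hpw : pw * b ≤ V) (h8 : s.var 8 < V) (h10 : s.var 10 ≤ 1)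
    (hS : 6 * n * (2 * (B + 1)) ≤ S) (hV : 6 * n * (2 * (B + 1) + 5) + 1 ≤ V) :
    Runs S V componentStep s fun t s' =>
      t ≤ 3000 * (6 * n * (2 * (B + 1)) * (Nat.log 2 (6 * n) + 1)) ∧
      HeadState b n B (pw * b) s' ∧ s'.arr 0 = s.arr 0 ∧ s'.arr 1 = s.arr 1 ∧
      s'.var 1 = s.var 1 ∧ s'.var 3 = s.var 3 ∧ s'.var 8 = s.var 8 + 1 ∧ s'.var 10 ≤ 1 ∧
      (s'.var 10 = 1 ↔ s.var 10 = 1 ∧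
        ComponentTest (s.arr 0) (s.arr 1) b n B (s.var 3) pw) := by
  set N := 6 * n with hN
  set L := 2 * (B + 1) with hL
  have hNL : 6 * L ≤ N * L := Nat.mul_le_mul_right L (by omega)
  have hNL' : N * 4 ≤ N * L := Nat.mul_le_mul_left N (by omega)
  have hNL5 : N * (L + 5) = N * L + N * 5 := Nat.mul_add _ _ _
  have hnL : n * (B + 1) ≤ N * L := Nat.mul_le_mul (by omega) (by omega)
  have hV6 : N * L + 6 ≤ V := by omega
  have hV6' : N + 6 ≤ V := by omega
  have hSN : N ≤ S := by omega
  refine Runs.seq (Runs.flat (by simp [Ok, Idx, eval]) fun t₁ ht₁ => ?_)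
  have ht₁ : t₁ ≤ 2 := ht₁
  set s₁ := run _ _ with hs₁
  have v₁ : ∀ x < 26, s₁.var x = s.var x := fun x hx => by simp [hs₁, run, State.setVar, hx.ne]
  have z₁ : s₁.var 26 = 0 := by simp [hs₁, run, eval, State.setVar]
  have a₁ : s₁.arr = s.arr := rfl
  clear_value s₁
  have h₁ : HeadState b n B pw s₁ := h.congr (fun x hx => v₁ x (by omega)) (by rw [a₁]) (by rw [a₁])
  refine Runs.seq ((runs_tableLoop h₁ hn hdl hS hV6 z₁).frame.mono ?_)
  rintro t₂ s₂ - ⟨⟨ht₂, htab⟩, fv₂, fa₂⟩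
  have v₂ : ∀ x < 26, s₂.var x = s.var x := fun x hx => by
    rw [← v₁ x hx]
    refine fv₂ x ?_
    interval_cases x <;> rfl
  have a₂ : ∀ a, a ≠ 2 → s₂.arr a = s.arr a := fun a ha => by
    rw [← a₁]
    refine fa₂ a ?_
    simp [tableLoop, tableStep, tableDecode, tableMode, writesArr, ha]
  rw [a₁] at htab
  refine Runs.seq (Runs.flat (by simp [Ok, Idx, eval]) fun t₃ ht₃ => ?_)
  have ht₃ : t₃ ≤ 2 := ht₃
  set s₃ := run _ _ with hs₃
  have v₃ : ∀ x < 26, s₃.var x = s.var x := fun x hx => by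
    rw [← v₂ x hx]
    simp [hs₃, run, State.setVar, hx.ne]
  have z₃ : s₃.var 26 = 0 := by simp [hs₃, run, eval, State.setVar]
  have a₃ : s₃.arr = s₂.arr := rfl
  clear_value s₃
  have h₃ : HeadState b n B pw s₃ := h.congr (fun x hx => v₃ x (by omega))
    (by rw [a₃, a₂ 0 (by decide)]) (by rw [a₃, a₂ 1 (by decide)])
  refine Runs.seq ((runs_resetLoop h₃ hn hSN hV6' z₃).frame.mono ?_)
  rintro t₄ s₄ - ⟨⟨ht₄, hres⟩, fv₄, fa₄⟩
  have v₄ : ∀ x < 26, s₄.var x = s.var x := fun x hx => by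
    rw [← v₃ x hx]
    refine fv₄ x ?_
    interval_cases x <;> rfl
  have b0 : s₄.arr 0 = s.arr 0 := by rw [fa₄ 0 rfl, a₃, a₂ 0 (by decide)]
  have b1 : s₄.arr 1 = s.arr 1 := by rw [fa₄ 1 rfl, a₃, a₂ 1 (by decide)]
  rw [← a₃, ← fa₄ 2 rfl] at htab
  rw [a₃, a₂ 1 (by decide)] at hres
  have h₄ : HeadState b n B pw s₄ := h.congr (fun x hx => v₄ x (by omega)) b0 b1
  obtain ⟨hok, hlt, c0, c1, c2, c3, d11, d12, d13, d14, d19, d20, d21, dv, da⟩ :=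
    h₄.run_seedQueue (S := S) (V := V) (by omega) hn (by omega) (by omega)
  refine Runs.seq (Runs.flat hok fun t₅ ht₅ => ?_)
  have ht₅ : t₅ ≤ 40 := ht₅.trans (by decide)
  set s₅ := run seedQueue s₄ with hs₅
  clear_value s₅
  have hst : ∀ x < N, s₅.scc.st x = 0 := fun x hx => by
    change s₅.arr 4 x = 0
    rw [da 4 (by decide)]
    exact (hres x hx).2.1
  have hptr : ∀ x < N, s₅.scc.ptr x = 0 := fun x hx => by
    change s₅.arr 10 x = 0
    rw [da 10 (by decide)]
    exact (hres x hx).2.2.1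
  have hpot : s₅.scc.potential N L = N * (L + 5) :=
    Scc.potential_init d11 d12 d13 d14 hst hptr
  have w₅ : ∀ x < 11, s₅.var x = s.var x := fun x hx => (dv x hx).trans (v₄ x (by omega))
  have hscc : SccState (dualTable (s.arr 0) b n B pw) N L (fun x => dualFlag (s.arr 1) n x = 1)
      (N * (L + 5)) s₅ :=
    { N_eq := (w₅ 6 (by decide)).trans h.states
      L_eq := (w₅ 7 (by decide)).trans h.alphabet
      table := by rw [da 2 (by decide)]; exact htab
      flag_le := fun x hx => by
        rw [da 3 (by decide), (hres x hx).1]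
        unfold dualFlag
        split_ifs
        exacts [Nat.zero_le _, Nat.zero_le _, h.flag_le _ (Nat.mod_lt _ hn)]
      flag := fun x hx => by rw [da 3 (by decide), (hres x hx).1]
      inv := .init d11 d12 d13 d14 hst hptr
      bounded := hpot ▸ .init d14 hst }
  refine Runs.seq ((runs_sccLoop hscc hT hS (by omega) (by omega) hV).frame.mono ?_)
  rintro t₆ s₆ - ⟨⟨hcol, ht₆⟩, fv₆, fa₆⟩
  rw [hpot] at ht₆
  have w₆ : ∀ x < 11, s₆.var x = s.var x := fun x hx => by
    rw [← w₅ x hx]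
    refine fv₆ x ?_
    interval_cases x <;> rfl
  have hhk : HkState (dualTable (s.arr 0) b n B pw) N L (fun x => dualFlag (s.arr 1) n x = 1)
      (s₆.arr 11) (s.var 10) (s₆.arr 14 0) (s₆.arr 15 0) (s₆.arr 14 1) (s₆.arr 15 1) id s₆ := by
    refine HkState.init ((w₆ 7 (by decide)).trans h.alphabet) ?_ ?_ ?_ ((fv₆ 19 rfl).trans d19)
      ((fv₆ 20 rfl).trans d20) ((fv₆ 21 rfl).trans d21) (w₆ 10 (by decide)) h10 ?_
    · rw [fa₆ 2 rfl]; exact hscc.table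
    · rw [fa₆ 12 rfl, da 12 (by decide)]; exact fun x hx => (hres x hx).2.2.2.1
    · rw [fa₆ 13 rfl, da 13 (by decide)]; exact fun x hx => (hres x hx).2.2.2.2
    · rw [fa₆ 14 rfl, fa₆ 15 rfl]
      intro j hj
      have := hlt j hj
      omega
  rw [fa₆ 14 rfl, fa₆ 15 rfl, c0, c1, c2, c3] at hhk
  rw [v₄ 3 (by decide), b0] at hhk
  refine Runs.seq ((runs_hkLoop hT hcol ⟨id, hhk⟩ ((fv₆ 19 rfl).trans d19) hS (by omega)
    (by omega) (by omega)).frame.mono ?_)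
  rintro t₇ s₇ - ⟨⟨ht₇, hle, hiff⟩, fv₇, fa₇⟩
  have w₇ : ∀ x < 10, s₇.var x = s.var x := fun x hx => by
    rw [← w₆ x (by omega)]
    refine fv₇ x ?_
    interval_cases x <;> rfl
  have x0 : s₇.arr 0 = s.arr 0 := by rw [fa₇ 0 rfl, fa₆ 0 rfl, da 0 (by decide), b0]
  have x1 : s₇.arr 1 = s.arr 1 := by rw [fa₇ 1 rfl, fa₆ 1 rfl, da 1 (by decide), b1]
  have y0 := (w₇ 0 (by decide)).trans h.base
  have y8 := w₇ 8 (by decide)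
  have y9 := (w₇ 9 (by decide)).trans h.power
  refine Runs.flat ?_ fun t₈ ht₈ => ?_
  · simp [Ok, Idx, run, eval, Op.apply, State.setVar, y0, y8, y9]
    omega
  have ht₈ : t₈ ≤ 8 := ht₈
  set s₈ := run _ _ with hs₈
  have u : ∀ x, x ≠ 8 → x ≠ 9 → s₈.var x = s₇.var x := fun x h8 h9 => by
    simp [hs₈, run, State.setVar, h8, h9]
  have u8 : s₈.var 8 = s.var 8 + 1 := by
    simp [hs₈, run, eval, Op.apply, State.setVar, y8]
  have u9 : s₈.var 9 = pw * b := by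
    simp [hs₈, run, eval, Op.apply, State.setVar, y0, y9]
  have ua : s₈.arr = s₇.arr := rfl
  clear_value s₈
  refine ⟨?_, ?_, by rw [ua, x0], by rw [ua, x1], (u 1 (by decide) (by decide)).trans
    (w₇ 1 (by decide)), (u 3 (by decide) (by decide)).trans (w₇ 3 (by decide)), u8, ?_, ?_⟩
  · have e1 := component_time_aux (l := Nat.log 2 N) hNL hNL' (by omega)
    have ht₂ : t₂ ≤ 160 * (N * L) + 6 := ht₂
    have ht₄ : t₄ ≤ 50 * N + 4 := ht₄
    have e3 : N * L ≤ N * L * (Nat.log 2 N + 1) := Nat.le_mul_of_pos_right _ (by omega)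
    omega
  · exact
    { base := (u 0 (by decide) (by decide)).trans y0
      size := (u 2 (by decide) (by decide)).trans ((w₇ 2 (by decide)).trans h.size)
      letters := (u 4 (by decide) (by decide)).trans ((w₇ 4 (by decide)).trans h.letters)
      letters_succ := (u 5 (by decide) (by decide)).trans
        ((w₇ 5 (by decide)).trans h.letters_succ)
      states := (u 6 (by decide) (by decide)).trans ((w₇ 6 (by decide)).trans h.states)
      alphabet := (u 7 (by decide) (by decide)).trans ((w₇ 7 (by decide)).trans h.alphabet)
      power := u9
      table_lt := by rw [ua, x0]; exact h.table_lt
      flag_le := by rw [ua, x1]; exact h.flag_le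
      start := by
        rw [u 3 (by decide) (by decide), w₇ 3 (by decide)]
        exact h.start }
  · rw [u 10 (by decide) (by decide)]; exact hle
  · rw [u 10 (by decide) (by decide)]; exact hiff

end RAM


/-! ### The complete decision procedure -/

namespace RAM

open RAM.Expr RAM.Cmd

/-- Compute the number of digit vectors. -/
def powerLoop : Cmd :=
  loop (bin .lt (var 8) (var 1))
    (assign 4 (bin .mul (var 4) (var 0)) ;; assign 8 (bin .add (var 8) (lit 1)))

/-- Compute the parameters. -/
def setup : Cmd :=
  assign 5 (bin .add (var 4) (lit 1)) ;; assign 6 (bin .mul (lit 6) (var 2)) ;;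
  assign 7 (bin .mul (lit 2) (var 5)) ;; assign 8 (lit 0) ;; assign 9 (lit 1) ;;
  assign 10 (lit 1)

def componentLoop : Cmd := loop (bin .lt (var 8) (var 1)) componentStep

/-- The decision procedure. -/
def program : Cmd :=
  assign 4 (lit 1) ;; powerLoop ;; setup ;; componentLoop ;; assign 0 (var 10)

variable {b d n B q₀ S V : ℕ} {s : State}

theorem runs_powerLoop (h0 : s.var 0 = b) (h1 : s.var 1 = d) (h4 : s.var 4 = 1)
    (h8 : s.var 8 = 0) (hb : 0 < b) (hV : b ^ d ≤ V) (hd : d ≤ V) :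
    Runs S V powerLoop s fun t s' => t ≤ 20 * d + 4 ∧ s'.var 4 = b ^ d := by
  refine (Runs.loop (Inv := fun s' => s'.var 0 = b ∧ s'.var 1 = d ∧ s'.var 4 = b ^ s'.var 8 ∧
    s'.var 8 ≤ d) (fun s' => 20 * (d - s'.var 8)) ⟨h0, h1, by rw [h4, h8, pow_zero], by omega⟩
    ?_ ?_).mono ?_
  · exact fun _ _ _ => ⟨trivial, trivial⟩
  · rintro s' - ⟨e0, e1, e4, e8⟩ hne
    have hlt : s'.var 8 < s'.var 1 := Op.apply_lt_ne_zero.mp hne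
    have hpow : b ^ (s'.var 8 + 1) ≤ V := (Nat.pow_le_pow_right hb (by omega)).trans hV
    refine Runs.flat ?_ fun t ht => ?_
    · simp [Ok, Idx, run, eval, Op.apply, State.setVar, e0, e4, ← pow_succ]
      omega
    · have ht : t ≤ 8 := ht
      simp [run, eval, Op.apply, State.setVar, e0, e1, e4, ← pow_succ, cost]
      omega
  · rintro t s' - ⟨⟨e0, e1, e4, e8⟩, hz, ht⟩
    have hge : s'.var 1 ≤ s'.var 8 := Op.apply_lt_eq_zero.mp hz
    simp only [cost] at ht
    refine ⟨by omega, ?_⟩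
    rw [e4]
    congr 1
    omega

theorem runs_componentLoop (h : HeadState b n B 1 s) (h1 : s.var 1 = d) (h3 : s.var 3 = q₀)
    (h8 : s.var 8 = 0) (h10 : s.var 10 = 1) (hn : 0 < n) (hb : 0 < b) (hB : B = b ^ d)
    (hdl : ∀ f < d, ∀ m sw k, k ≤ B → dualLetter b B (b ^ f) m sw k ≤ B)
    (hT : ∀ f < d, IsWeakTable (dualTable (s.arr 0) b n B (b ^ f)) (6 * n) (2 * (B + 1))
      fun x => dualFlag (s.arr 1) n x = 1)
    (hd : d ≤ V) (hS : 6 * n * (2 * (B + 1)) ≤ S) (hV : 6 * n * (2 * (B + 1) + 5) + 1 ≤ V) :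
    Runs S V componentLoop s fun t s' =>
      t ≤ d * (3010 * (6 * n * (2 * (B + 1)) * (Nat.log 2 (6 * n) + 1))) + 4 ∧
      s'.var 10 ≤ 1 ∧
      (s'.var 10 = 1 ↔ ∀ f < d, ComponentTest (s.arr 0) (s.arr 1) b n B q₀ (b ^ f)) := by
  have hBV : B ≤ V := by nlinarith
  refine (Runs.loop (Inv := fun s' => HeadState b n B (b ^ s'.var 8) s' ∧ s'.arr 0 = s.arr 0 ∧
    s'.arr 1 = s.arr 1 ∧ s'.var 1 = d ∧ s'.var 3 = q₀ ∧ s'.var 8 ≤ d ∧ s'.var 10 ≤ 1 ∧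
    (s'.var 10 = 1 ↔ ∀ f < s'.var 8, ComponentTest (s.arr 0) (s.arr 1) b n B q₀ (b ^ f)))
    (fun s' => (d - s'.var 8) * (3010 * (6 * n * (2 * (B + 1)) * (Nat.log 2 (6 * n) + 1))))
    ⟨by rwa [h8, pow_zero], rfl, rfl, h1, h3, by omega, by omega, by simp [h10, h8]⟩
    ?_ ?_).mono ?_
  · exact fun _ _ _ => ⟨trivial, trivial⟩
  · rintro s' - ⟨hh, a0, a1, e1, e3, e8, e10, hiff⟩ hne
    have hlt : s'.var 8 < s'.var 1 := Op.apply_lt_ne_zero.mp hne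
    rw [e1] at hlt
    have hpow : b ^ (s'.var 8 + 1) ≤ B := hB ▸ Nat.pow_le_pow_right hb hlt
    refine (runs_componentStep hh hn (hB ▸ pow_pos hb d) (hdl _ hlt)
      (by rw [a0, a1]; exact hT _ hlt) (by rw [← pow_succ]; omega) (by omega) e10 hS
      hV).mono ?_
    rintro t s₁ - ⟨ht, k1, k2, k3, k4, k5, k6, k7, k8⟩
    refine ⟨⟨?_, k2.trans a0, k3.trans a1, k4.trans e1, k5.trans e3, by omega, k7, ?_⟩, ?_⟩
    · rw [k6, pow_succ]
      exact k1
    · rw [k8, k6, hiff, Nat.forall_lt_succ_right, a0, a1, e3]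
    · obtain ⟨k, hk⟩ : ∃ k, d - s'.var 8 = k + 1 := ⟨d - s'.var 8 - 1, by omega⟩
      rw [k6, hk, show d - (s'.var 8 + 1) = k by omega, Nat.succ_mul k]
      have hpos : 0 < 6 * n * (2 * (B + 1)) * (Nat.log 2 (6 * n) + 1) := by positivity
      simp only [cost]
      omega
  · rintro t s' - ⟨⟨hh, a0, a1, e1, e3, e8, e10, hiff⟩, hz, ht⟩
    have hge : s'.var 1 ≤ s'.var 8 := Op.apply_lt_eq_zero.mp hz
    rw [h8, Nat.sub_zero] at ht
    simp only [cost] at ht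
    rw [show s'.var 8 = d by omega] at hiff
    exact ⟨by omega, e10, hiff⟩

theorem runs_program (h0 : s.var 0 = b) (h1 : s.var 1 = d) (h2 : s.var 2 = n)
    (h3 : s.var 3 = q₀) (h8 : s.var 8 = 0) (hq : q₀ < n) (hb : 0 < b) (hB : B = b ^ d)
    (htab : ∀ i < n * (B + 1), s.arr 0 i < n) (hflag : ∀ q < n, s.arr 1 q ≤ 1)
    (hdl : ∀ f < d, ∀ m sw k, k ≤ B → dualLetter b B (b ^ f) m sw k ≤ B)
    (hT : ∀ f < d, IsWeakTable (dualTable (s.arr 0) b n B (b ^ f)) (6 * n) (2 * (B + 1))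
      fun x => dualFlag (s.arr 1) n x = 1)
    (hd : d ≤ V) (hS : 6 * n * (2 * (B + 1)) ≤ S) (hV : 6 * n * (2 * (B + 1) + 5) + 1 ≤ V) :
    Runs S V program s fun t s' =>
      t ≤ d * (3010 * (6 * n * (2 * (B + 1)) * (Nat.log 2 (6 * n) + 1))) + 20 * d + 50 ∧
      s'.var 0 ≤ 1 ∧
      (s'.var 0 = 1 ↔ ∀ f < d, ComponentTest (s.arr 0) (s.arr 1) b n B q₀ (b ^ f)) := by
  have hBV : 10 * B + 20 ≤ V := by nlinarith
  have hnV : 6 * n ≤ V := by nlinarith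
  refine Runs.seq (Runs.flat (by simp [Ok, Idx, eval]; omega) fun t₁ ht₁ => ?_)
  have ht₁ : t₁ ≤ 2 := ht₁
  set s₁ := run _ _ with hs₁
  have v₁ : ∀ x, x ≠ 4 → s₁.var x = s.var x := fun x hx => by simp [hs₁, run, State.setVar, hx]
  have z₁ : s₁.var 4 = 1 := by simp [hs₁, run, eval, State.setVar]
  have a₁ : s₁.arr = s.arr := rfl
  clear_value s₁
  refine Runs.seq ((runs_powerLoop (b := b) (d := d) ((v₁ 0 (by decide)).trans h0)
    ((v₁ 1 (by decide)).trans h1) z₁ ((v₁ 8 (by decide)).trans h8) hb (by omega) hd).frame.mono ?_)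
  rintro t₂ s₂ - ⟨⟨ht₂, z₂⟩, fv₂, fa₂⟩
  rw [← hB] at z₂
  have v₂ : ∀ x < 4, s₂.var x = s.var x := fun x hx => by
    rw [← v₁ x hx.ne]
    refine fv₂ x ?_
    interval_cases x <;> rfl
  have a₂ : s₂.arr = s.arr := by
    funext a
    rw [fa₂ a rfl, a₁]
  have e2 := (v₂ 2 (by decide)).trans h2
  refine Runs.seq (Runs.flat ?_ fun t₃ ht₃ => ?_)
  · simp [setup, Ok, Idx, run, eval, Op.apply, State.setVar, z₂, e2]
    omega
  have ht₃ : t₃ ≤ 30 := ht₃.trans (by decide)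
  set s₃ := run _ _ with hs₃
  have v₃ : ∀ x < 5, s₃.var x = s₂.var x := fun x hx => by
    interval_cases x <;> simp [hs₃, setup, run, State.setVar]
  have e5 : s₃.var 5 = B + 1 := by
    simp [hs₃, setup, run, eval, Op.apply, State.setVar, z₂]
  have e6 : s₃.var 6 = 6 * n := by
    simp [hs₃, setup, run, eval, Op.apply, State.setVar, e2]
  have e7 : s₃.var 7 = 2 * (B + 1) := by
    simp [hs₃, setup, run, eval, Op.apply, State.setVar, z₂]
  have e8 : s₃.var 8 = 0 := by
    simp [hs₃, setup, run, eval, State.setVar]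
  have e9 : s₃.var 9 = 1 := by
    simp [hs₃, setup, run, eval, State.setVar]
  have e10 : s₃.var 10 = 1 := by
    simp [hs₃, setup, run, eval, State.setVar]
  have a₃ : s₃.arr = s.arr := a₂
  clear_value s₃
  have e3 := ((v₃ 3 (by decide)).trans (v₂ 3 (by decide))).trans h3
  have hh : HeadState b n B 1 s₃ :=
    { base := ((v₃ 0 (by decide)).trans (v₂ 0 (by decide))).trans h0
      size := (v₃ 2 (by decide)).trans e2
      letters := (v₃ 4 (by decide)).trans z₂
      letters_succ := e5
      states := e6
      alphabet := e7
      power := e9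
      table_lt := by rwa [a₃]
      flag_le := by rwa [a₃]
      start := by rwa [e3] }
  refine Runs.seq ((runs_componentLoop hh (((v₃ 1 (by decide)).trans (v₂ 1 (by decide))).trans h1)
    e3 e8 e10 (by omega) hb hB hdl (by rwa [a₃]) hd hS hV).mono ?_)
  rintro t₄ s₄ - ⟨ht₄, hle, hiff⟩
  rw [a₃] at hiff
  refine Runs.flat ⟨trivial, by simp only [eval]; omega⟩ fun t₅ ht₅ => ?_
  have ht₅ : t₅ ≤ 2 := ht₅
  have z₅ : (run (assign 0 (var 10)) s₄).var 0 = s₄.var 10 := by simp [run, eval, State.setVar]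
  rw [z₅]
  exact ⟨by omega, hle, hiff⟩

end RAM


/-! ### Digit sequences that represent the same number -/

/-- The digit sequences `x` and `y` are of the form `u a (b-1) (b-1) …` and `u (a+1) 0 0 …`. -/
def IsDualAt {b : ℕ} (σ : ℕ) (x y : ℕ → Fin b) : Prop :=
  (∀ i < σ, x i = y i) ∧ (y σ : ℕ) = x σ + 1 ∧ ∀ i, σ < i → (x i : ℕ) = b - 1 ∧ (y i : ℕ) = 0

namespace Real

variable {b : ℕ} {x y : ℕ → Fin b}

theorem mul_ofDigits_eq (x : ℕ → Fin b) :
    b * ofDigits x = x 0 + ofDigits fun i => x (i + 1) := by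
  have hb : (b : ℝ) ≠ 0 := Nat.cast_ne_zero.mpr (Fin.pos (x 0)).ne'
  rw [ofDigits_eq_sum_add_ofDigits x 1]
  simp only [Finset.sum_range_one, ofDigitsTerm, zero_add, pow_one]
  field_simp

/-- The common prefix cancels, and the scaling turns the digits at position `σ` into integers and
what follows into numbers in `[0, 1]`. -/
theorem pow_mul_ofDigits_sub {σ : ℕ} (h : ∀ i < σ, x i = y i) :
    (b : ℝ) ^ (σ + 1) * (ofDigits x - ofDigits y) =
      ((x σ : ℝ) + ofDigits fun i => x (i + (σ + 1))) -
        (y σ + ofDigits fun i => y (i + (σ + 1))) := by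
  have hb : (b : ℝ) ≠ 0 := Nat.cast_ne_zero.mpr (Fin.pos (x 0)).ne'
  rw [ofDigits_eq_sum_add_ofDigits x (σ + 1), ofDigits_eq_sum_add_ofDigits y (σ + 1),
    Finset.sum_range_succ, Finset.sum_range_succ,
    Finset.sum_congr rfl fun i hi => show ofDigitsTerm x i = ofDigitsTerm y i by
      rw [ofDigitsTerm, ofDigitsTerm, h i (Finset.mem_range.mp hi)],
    show ofDigitsTerm x σ = x σ * ((b : ℝ) ^ (σ + 1))⁻¹ from rfl,
    show ofDigitsTerm y σ = y σ * ((b : ℝ) ^ (σ + 1))⁻¹ from rfl]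
  generalize ∑ i ∈ Finset.range σ, ofDigitsTerm y i = Z
  field_simp
  ring

theorem ofDigits_eq_zero_iff : ofDigits x = 0 ↔ ∀ i, (x i : ℕ) = 0 := by
  constructor
  · intro h i
    induction i generalizing x with
    | zero =>
      have h1 := mul_ofDigits_eq x
      have h2 := ofDigits_nonneg fun i => x (i + 1)
      rw [h, mul_zero] at h1
      have h3 : (0 : ℝ) ≤ (x 0 : ℕ) := Nat.cast_nonneg _
      exact_mod_cast show ((x 0 : ℕ) : ℝ) = 0 by linarith
    | succ i ih =>
      refine ih (x := fun i => x (i + 1)) ?_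
      have h1 := mul_ofDigits_eq x
      have h2 := ofDigits_nonneg fun i => x (i + 1)
      rw [h, mul_zero] at h1
      have h3 : (0 : ℝ) ≤ (x 0 : ℕ) := Nat.cast_nonneg _
      linarith
  · intro h
    simp [ofDigits, ofDigitsTerm, h]

/-- In `b · 1 = x 0 + tail` the digit is at most `b - 1` and the tail at most 1, so both are
extremal, and the tail satisfies the hypothesis again. -/
theorem ofDigits_eq_one_iff (hb : 1 < b) : ofDigits x = 1 ↔ ∀ i, (x i : ℕ) = b - 1 := by
  constructor
  · intro h
    have key : ∀ x : ℕ → Fin b, ofDigits x = 1 →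
        (x 0 : ℕ) = b - 1 ∧ ofDigits (fun i => x (i + 1)) = 1 := by
      intro x h
      have h1 := mul_ofDigits_eq x
      have h2 := ofDigits_le_one fun i => x (i + 1)
      rw [h, mul_one] at h1
      have h3 : ((x 0 : ℕ) : ℝ) + 1 ≤ b := by exact_mod_cast (x 0).isLt
      have h4 : ((x 0 : ℕ) : ℝ) + 1 = b := by linarith
      have h5 : (x 0 : ℕ) + 1 = b := by exact_mod_cast h4
      exact ⟨by omega, by linarith⟩
    intro i
    induction i generalizing x with
    | zero => exact (key x h).1
    | succ i ih => exact ih (key x h).2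
  · intro h
    rw [← ofDigits_const_last_eq_one' hb]
    congr 1
    funext i
    exact Fin.ext (h i)

theorem ofDigits_eq_of_isDualAt (hb : 1 < b) {σ : ℕ} (h : IsDualAt σ x y) :
    ofDigits x = ofDigits y := by
  have h1 := pow_mul_ofDigits_sub h.1
  have hx : ofDigits (fun i => x (i + (σ + 1))) = 1 :=
    (ofDigits_eq_one_iff hb).mpr fun i => (h.2.2 _ (by omega)).1
  have hy : ofDigits (fun i => y (i + (σ + 1))) = 0 :=
    ofDigits_eq_zero_iff.mpr fun i => (h.2.2 _ (by omega)).2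
  rw [hx, hy, h.2.1] at h1
  push_cast at h1
  have h2 : (b : ℝ) ^ (σ + 1) * (ofDigits x - ofDigits y) = 0 := by rw [h1]; ring
  have hb' : (b : ℝ) ^ (σ + 1) ≠ 0 := by positivity
  linarith [(mul_eq_zero.mp h2).resolve_left hb']

/-- Digit plus tail is the same number on both sides, the tails lie in `[0, 1]`, and the digits
differ by at least one. So they differ by exactly one, the tail of `x` is 1 and the tail of `y` is
0. -/
theorem isDualAt_of_lt (hb : 1 < b) {σ : ℕ} (h : ofDigits x = ofDigits y)
    (hσ : ∀ i < σ, x i = y i) (hlt : (x σ : ℕ) < y σ) : IsDualAt σ x y := by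
  have h1 := pow_mul_ofDigits_sub hσ
  rw [h, sub_self, mul_zero] at h1
  have h2 := ofDigits_le_one fun i => x (i + (σ + 1))
  have h3 := ofDigits_nonneg fun i => y (i + (σ + 1))
  have h4 : ((x σ : ℕ) : ℝ) + 1 ≤ (y σ : ℕ) := by exact_mod_cast hlt
  have h5 : ((y σ : ℕ) : ℝ) = (x σ : ℕ) + 1 := by linarith
  refine ⟨hσ, by exact_mod_cast h5, fun i hi => ?_⟩
  have hx := (ofDigits_eq_one_iff hb).mp (by linarith : ofDigits (fun i => x (i + (σ + 1))) = 1)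
    (i - (σ + 1))
  have hy := ofDigits_eq_zero_iff.mp (by linarith : ofDigits (fun i => y (i + (σ + 1))) = 0)
    (i - (σ + 1))
  rw [Nat.sub_add_cancel hi] at hx hy
  exact ⟨hx, hy⟩

theorem eq_or_isDualAt_of_ofDigits_eq (hb : 1 < b) (h : ofDigits x = ofDigits y) :
    x = y ∨ (∃ σ, IsDualAt σ x y) ∨ ∃ σ, IsDualAt σ y x := by
  by_cases hxy : x = y
  · exact .inl hxy
  right
  have hex : ∃ i, x i ≠ y i := Function.ne_iff.mp hxy
  classical
  have hmin : ∀ i < Nat.find hex, x i = y i := fun i hi => not_not.mp (Nat.find_min hex hi)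
  rcases Nat.lt_or_gt_of_ne (Fin.val_ne_of_ne (Nat.find_spec hex)) with hlt | hlt
  · exact .inl ⟨_, isDualAt_of_lt hb h hmin hlt⟩
  · exact .inr ⟨_, isDualAt_of_lt hb h.symm (fun i hi => (hmin i hi).symm) hlt⟩

end Real

/-! ### Encodings with the star at a given position -/

section Encoding

variable {b d : ℕ}

/-- The digit vectors `D 0, D 1, …` with a star before the one at position `p`. -/
def starAt (p : ℕ) (D : ℕ → Fin d → Fin b) : ℕ → ParLetter b d :=
  fun i => if i = p then none else some (D (if i < p then i else i - 1))

/-- The position of the digit vector number `i` if the star is at position `p`. -/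
def starPos (p i : ℕ) : ℕ := if i < p then i else i + 1

theorem starPos_lt_iff {p i j : ℕ} : starPos p i < starPos p j ↔ i < j := by
  unfold starPos
  split_ifs <;> omega

theorem starPos_ne (p i : ℕ) : starPos p i ≠ p := by
  unfold starPos
  split_ifs <;> omega

theorem exists_starPos_eq {p i : ℕ} (h : i ≠ p) : ∃ j, starPos p j = i := by
  refine ⟨if i < p then i else i - 1, ?_⟩
  unfold starPos
  split_ifs <;> omega

variable {p : ℕ} {D : ℕ → Fin d → Fin b}

theorem starAt_self : starAt p D p = none := by simp [starAt]

theorem starAt_starPos (i : ℕ) : starAt p D (starPos p i) = some (D i) := by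
  rw [starAt, if_neg (starPos_ne p i)]
  congr 2
  unfold starPos
  split_ifs <;> omega

theorem eq_starAt_iff {u : ℕ → ParLetter b d} :
    u = starAt p D ↔ u p = none ∧ ∀ i, u (starPos p i) = some (D i) := by
  constructor
  · rintro rfl
    exact ⟨starAt_self, starAt_starPos⟩
  · rintro ⟨h1, h2⟩
    funext i
    by_cases hi : i = p
    · rw [hi, h1, starAt_self]
    · obtain ⟨j, rfl⟩ := exists_starPos_eq hi
      rw [h2, starAt_starPos]

theorem starAt_eq_none_iff {i : ℕ} : starAt p D i = none ↔ i = p := by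
  by_cases hi : i = p <;> simp [starAt, hi]

theorem exists_starAt_iff {u : ℕ → ParLetter b d} :
    (∃ D, u = starAt p D) ↔ ∀ i, u i = none ↔ i = p := by
  constructor
  · rintro ⟨D, rfl⟩ i
    exact starAt_eq_none_iff
  · intro h
    have : ∀ i, ∃ a, u (starPos p i) = some a := fun i =>
      Option.ne_none_iff_exists'.mp fun hn => starPos_ne p i ((h _).mp hn)
    choose D hD using this
    exact ⟨D, eq_starAt_iff.mpr ⟨(h p).mpr rfl, hD⟩⟩

/-- The digit vectors of `v ⋆ w`. -/
def starDigits (v : List (Fin d → Fin b)) (w : ℕ → Fin d → Fin b) : ℕ → Fin d → Fin b :=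
  fun i => if h : i < v.length then v[i] else w (i - v.length)

theorem starWord_eq (v : List (Fin d → Fin b)) (w : ℕ → Fin d → Fin b) :
    starWord v w = starAt v.length (starDigits v w) := by
  rw [eq_starAt_iff]
  refine ⟨by simp [starWord], fun i => ?_⟩
  unfold starPos starWord starDigits
  by_cases h : i < v.length
  · simp [h]
  · simp only [h, if_false, dite_false]
    rw [dif_neg (by omega), if_neg (by omega)]
    congr 2
    omega

theorem starDigits_ofFn (p : ℕ) (D : ℕ → Fin d → Fin b) :
    starDigits (List.ofFn fun i : Fin p => D i) (fun i => D (i + p)) = D := by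
  funext i
  unfold starDigits
  split_ifs with h
  · simp
  · simp only [List.length_ofFn] at h ⊢
    rw [Nat.sub_add_cancel (by omega)]

/-- Integer and fractional digits together form a single expansion, and the position of the star is
only a scaling factor. -/
theorem starValue_eq (v : List (Fin d → Fin b)) (w : ℕ → Fin d → Fin b) (f : Fin d) :
    starValue v w f = (b : ℝ) ^ v.length * Real.ofDigits fun i => starDigits v w i f := by
  induction v with
  | nil => simp [starValue, starDigits, ← Nat.coe_ofDigits]
  | cons a v ih =>
    have h1 : (fun i => starDigits (a :: v) w (i + 1) f) = fun i => starDigits v w i f := by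
      funext i
      simp [starDigits]
    have h2 : starDigits (a :: v) w 0 = a := by simp [starDigits]
    rw [List.length_cons, pow_succ, mul_assoc, Real.mul_ofDigits_eq, h1, h2, mul_add, ← ih]
    simp only [starValue, ← Nat.coe_ofDigits, List.map_cons, List.reverse_cons, Nat.ofDigits_append,
      List.length_reverse, List.length_map, Nat.ofDigits_singleton]
    push_cast
    ring

theorem isParEncoding_iff {u : ℕ → ParLetter b d} {r : Fin d → ℝ} :
    IsParEncoding u r ↔ ∃ p D, u = starAt p D ∧
      ∀ f, (b : ℝ) ^ p * Real.ofDigits (fun i => D i f) = r f := by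
  constructor
  · rintro ⟨v, w, rfl, rfl⟩
    exact ⟨_, _, starWord_eq v w, fun f => (starValue_eq v w f).symm⟩
  · rintro ⟨p, D, rfl, h⟩
    refine ⟨List.ofFn fun i : Fin p => D i, fun i => D (i + p), ?_, ?_⟩
    · rw [starWord_eq, starDigits_ofFn, List.length_ofFn]
    · funext f
      rw [starValue_eq, starDigits_ofFn, List.length_ofFn, h]

theorem isParallelLanguage_iff {L : Set (ℕ → ParLetter b d)} :
    IsParallelLanguage L ↔ ∀ u ∈ L, ∃ p D, u = starAt p D := by
  refine forall₂_congr fun u _ => ⟨?_, ?_⟩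
  · rintro ⟨v, w, rfl⟩
    exact ⟨_, _, starWord_eq v w⟩
  · rintro ⟨p, D, rfl⟩
    refine ⟨List.ofFn fun i : Fin p => D i, fun i => D (i + p), ?_⟩
    rw [starWord_eq, starDigits_ofFn, List.length_ofFn]

end Encoding


/-! ### Dual words and the reduction of saturation to local conditions -/

section Encoding

variable {b d : ℕ}

/-- The words `u` and `u'` differ only in the component `f`, where they have the digits
`… a (b-1) (b-1) …` and `… (a+1) 0 0 …` with `a` at position `τ`. -/
def IsDualWord (f : Fin d) (τ : ℕ) (u u' : ℕ → ParLetter b d) : Prop :=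
  (∀ i < τ, u i = u' i) ∧
  (∃ a a', u τ = some a ∧ u' τ = some a' ∧ (a' f : ℕ) = a f + 1 ∧ ∀ g ≠ f, a' g = a g) ∧
  ∀ i, τ < i → (u i = none ∧ u' i = none) ∨
    ∃ a a', u i = some a ∧ u' i = some a' ∧ (a f : ℕ) = b - 1 ∧ (a' f : ℕ) = 0 ∧
      ∀ g ≠ f, a' g = a g

/-- The word `u` with the letter `a` in front. -/
def consWord {α : Type*} (a : α) (u : ℕ → α) : ℕ → α
  | 0 => a
  | i + 1 => u i

theorem IsDualWord.eq_none_iff {f : Fin d} {τ : ℕ} {u u' : ℕ → ParLetter b d}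
    (h : IsDualWord f τ u u') (i : ℕ) : u i = none ↔ u' i = none := by
  obtain ⟨h1, ⟨a, a', h2, h2', -⟩, h3⟩ := h
  rcases Nat.lt_trichotomy i τ with hi | rfl | hi
  · rw [h1 i hi]
  · simp [h2, h2']
  · rcases h3 i hi with ⟨h4, h5⟩ | ⟨a, a', h4, h5, -⟩ <;> simp [h4, h5]

theorem isDualWord_starAt {f : Fin d} {σ p : ℕ} {D D' : ℕ → Fin d → Fin b}
    (h : IsDualAt σ (fun i => D i f) fun i => D' i f) (hne : ∀ i, ∀ g ≠ f, D' i g = D i g) :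
    IsDualWord f (starPos p σ) (starAt p D) (starAt p D') := by
  refine ⟨fun i hi => ?_, ⟨_, _, starAt_starPos _, starAt_starPos _, h.2.1, hne σ⟩, fun i hi => ?_⟩
  · by_cases hp : i = p
    · rw [hp, starAt_self, starAt_self]
    · obtain ⟨j, rfl⟩ := exists_starPos_eq hp
      rw [starAt_starPos, starAt_starPos]
      congr 1
      funext g
      by_cases hg : g = f
      · rw [hg]
        exact h.1 j (starPos_lt_iff.mp hi)
      · exact (hne j g hg).symm
  · by_cases hp : i = p
    · left
      rw [hp, starAt_self, starAt_self]
      exact ⟨rfl, rfl⟩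
    · obtain ⟨j, rfl⟩ := exists_starPos_eq hp
      have hj := h.2.2 j (starPos_lt_iff.mp hi)
      exact .inr ⟨_, _, starAt_starPos _, starAt_starPos _, hj.1, hj.2, hne j⟩

theorem IsDualWord.exists_isDualAt {f : Fin d} {τ p : ℕ} {D D' : ℕ → Fin d → Fin b}
    (h : IsDualWord f τ (starAt p D) (starAt p D')) :
    (∃ σ, IsDualAt σ (fun i => D i f) fun i => D' i f) ∧ ∀ i, ∀ g ≠ f, D' i g = D i g := by
  obtain ⟨h1, ⟨a, a', h2, h2', h3, h4⟩, h5⟩ := h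
  have hτ : τ ≠ p := by
    rintro rfl
    rw [starAt_self] at h2
    simp at h2
  obtain ⟨σ, rfl⟩ := exists_starPos_eq hτ
  rw [starAt_starPos] at h2 h2'
  obtain rfl := Option.some.inj h2
  obtain rfl := Option.some.inj h2'
  have hlt : ∀ i < σ, D i = D' i := fun i hi => by
    have := h1 _ (starPos_lt_iff (p := p).mpr hi)
    rw [starAt_starPos, starAt_starPos] at this
    exact Option.some.inj this
  have hgt : ∀ i, σ < i → (D i f : ℕ) = b - 1 ∧ (D' i f : ℕ) = 0 ∧ ∀ g ≠ f, D' i g = D i g := by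
    intro i hi
    rcases h5 _ (starPos_lt_iff (p := p).mpr hi) with ⟨h6, -⟩ | ⟨a, a', h6, h6', h7⟩
    · rw [starAt_starPos] at h6
      simp at h6
    · rw [starAt_starPos] at h6 h6'
      obtain rfl := Option.some.inj h6
      obtain rfl := Option.some.inj h6'
      exact h7
  refine ⟨⟨σ, fun i hi => congrFun (hlt i hi) f, h3, fun i hi =>
    ⟨(hgt i hi).1, (hgt i hi).2.1⟩⟩, fun i g hg => ?_⟩
  rcases Nat.lt_trichotomy i σ with hi | rfl | hi
  · rw [hlt i hi]
  · exact h4 g hg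
  · exact (hgt i hi).2.2 g hg

theorem starAt_succ_consWord (p : ℕ) (D : ℕ → Fin d → Fin b) (z : Fin d → Fin b) :
    consWord (some z) (starAt p D) = starAt (p + 1) (consWord z D) := by
  rw [eq_starAt_iff]
  refine ⟨starAt_self, fun i => ?_⟩
  cases i with
  | zero => simp [starPos, consWord]
  | succ i =>
    have : starPos (p + 1) (i + 1) = starPos p i + 1 := by
      unfold starPos
      split_ifs <;> omega
    rw [this]
    exact starAt_starPos i

/-- The added letter is not the star, so the star is found in the remaining word, one position
earlier. -/
theorem eq_starAt_of_consWord {p : ℕ} {D : ℕ → Fin d → Fin b} {z : Fin d → Fin b}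
    {u : ℕ → ParLetter b d} (h : consWord (some z) u = starAt p D) :
    ∃ p D, u = starAt p D := by
  have hnone := exists_starAt_iff.mp ⟨D, h⟩
  cases p with
  | zero => exact absurd ((hnone 0).mpr rfl) (by simp [consWord])
  | succ p => exact ⟨p, exists_starAt_iff.mpr fun i => (hnone (i + 1)).trans (by omega)⟩

theorem value_consWord {z : Fin d → Fin b} (hz : ∀ f, (z f : ℕ) = 0) (p : ℕ)
    (D : ℕ → Fin d → Fin b) (f : Fin d) :
    (b : ℝ) ^ (p + 1) * Real.ofDigits (fun i => consWord z D i f) =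
      (b : ℝ) ^ p * Real.ofDigits fun i => D i f := by
  rw [pow_succ, mul_assoc, Real.mul_ofDigits_eq]
  simp [consWord, hz]

/-- The conditions for real vector languages that concern single words and pairs of words. -/
structure IsLocallySaturated (z : Fin d → Fin b) (L : Set (ℕ → ParLetter b d)) : Prop where
  parallel : ∀ u ∈ L, ∃ p D, u = starAt p D
  zero : ∀ u, consWord (some z) u ∈ L ↔ u ∈ L
  dual : ∀ (f : Fin d) τ u u', IsDualWord f τ u u' → (u ∈ L ↔ u' ∈ L)

variable {L : Set (ℕ → ParLetter b d)} {z : Fin d → Fin b}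

theorem IsSaturated.mem_iff (h : IsSaturated L) {p p' : ℕ} {D D' : ℕ → Fin d → Fin b}
    (hv : ∀ f, (b : ℝ) ^ p * Real.ofDigits (fun i => D i f) =
      (b : ℝ) ^ p' * Real.ofDigits fun i => D' i f) : starAt p D ∈ L ↔ starAt p' D' ∈ L := by
  have h1 := isParEncoding_iff.mpr ⟨p, D, rfl, fun f => rfl⟩
  have h2 := isParEncoding_iff.mpr ⟨p', D', rfl, fun f => (hv f).symm⟩
  exact ⟨fun hm => h _ ⟨_, hm, h1⟩ _ h2, fun hm => h _ ⟨_, hm, h2⟩ _ h1⟩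

/-- Padding and dual exchange preserve the encoded vector, and they neither create nor destroy the
property of having exactly one star. Words without this property are not in `L`, so the equivalences
hold for all words. -/
theorem IsLocallySaturated.of_isSaturated (hb : 1 < b) (hz : ∀ f, (z f : ℕ) = 0)
    (hp : IsParallelLanguage L) (hs : IsSaturated L) : IsLocallySaturated z L := by
  rw [isParallelLanguage_iff] at hp
  refine ⟨hp, fun u => ?_, fun f τ u u' h => ?_⟩
  · have key : (∃ p D, u = starAt p D) → (consWord (some z) u ∈ L ↔ u ∈ L) := by
      rintro ⟨p, D, rfl⟩
      rw [starAt_succ_consWord]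
      exact hs.mem_iff (value_consWord hz p D)
    refine ⟨fun hu => ?_, fun hu => (key (hp u hu)).mpr hu⟩
    obtain ⟨p, D, hD⟩ := hp _ hu
    exact (key (eq_starAt_of_consWord hD)).mp hu
  · have key : ∀ p, (∃ D, u = starAt p D) → (u ∈ L ↔ u' ∈ L) := by
      intro p hu
      have hu' : ∃ D, u' = starAt p D := by
        rw [exists_starAt_iff] at hu ⊢
        exact fun i => (h.eq_none_iff i).symm.trans (hu i)
      obtain ⟨D, rfl⟩ := hu
      obtain ⟨D', rfl⟩ := hu'
      obtain ⟨⟨σ, h1⟩, h2⟩ := h.exists_isDualAt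
      refine hs.mem_iff fun g => ?_
      congr 1
      by_cases hg : g = f
      · rw [hg]
        exact Real.ofDigits_eq_of_isDualAt hb h1
      · simp only [h2 _ g hg]
    refine ⟨fun hu => ?_, fun hu => ?_⟩
    · obtain ⟨p, hD⟩ := hp _ hu
      exact (key p hD).mp hu
    · obtain ⟨p, hD⟩ := hp _ hu
      refine (key p ?_).mpr hu
      rw [exists_starAt_iff] at hD ⊢
      exact fun i => (h.eq_none_iff i).trans (hD i)

namespace IsLocallySaturated

theorem exists_pad (h : IsLocallySaturated z L) (hz : ∀ f, (z f : ℕ) = 0) (k p : ℕ)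
    (D : ℕ → Fin d → Fin b) : ∃ E, (starAt (p + k) E ∈ L ↔ starAt p D ∈ L) ∧
      ∀ f, (b : ℝ) ^ (p + k) * Real.ofDigits (fun i => E i f) =
        (b : ℝ) ^ p * Real.ofDigits fun i => D i f := by
  induction k with
  | zero => exact ⟨D, Iff.rfl, fun _ => rfl⟩
  | succ k ih =>
    obtain ⟨E, h1, h2⟩ := ih
    refine ⟨consWord z E, ?_, fun f => ?_⟩
    · rw [← h1, ← h.zero (starAt (p + k) E), starAt_succ_consWord]
      rfl
    · rw [← h2, ← value_consWord hz (p + k)]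
      rfl

theorem mem_of_component (h : IsLocallySaturated z L) (hb : 1 < b) {p : ℕ}
    {D D' : ℕ → Fin d → Fin b} (f : Fin d)
    (hf : Real.ofDigits (fun i => D i f) = Real.ofDigits fun i => D' i f)
    (hne : ∀ i, ∀ g ≠ f, D' i g = D i g) (hD : starAt p D ∈ L) : starAt p D' ∈ L := by
  rcases Real.eq_or_isDualAt_of_ofDigits_eq hb hf with he | ⟨σ, he⟩ | ⟨σ, he⟩
  · have : D' = D := by
      funext i g
      by_cases hg : g = f
      · rw [hg]
        exact (congrFun he i).symm
      · exact hne i g hg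
    rwa [this]
  · exact (h.dual f _ _ _ (isDualWord_starAt he hne)).mp hD
  · exact (h.dual f _ _ _ (isDualWord_starAt he fun i g hg => (hne i g hg).symm)).mpr hD

/-- The digits are exchanged one component at a time; each exchange is trivial or a dual exchange in
one of the two directions. -/
theorem mem_of_ofDigits_eq (h : IsLocallySaturated z L) (hb : 1 < b) {p : ℕ}
    {D D' : ℕ → Fin d → Fin b}
    (hf : ∀ f, Real.ofDigits (fun i => D i f) = Real.ofDigits fun i => D' i f)
    (hD : starAt p D ∈ L) : starAt p D' ∈ L := by
  have key : ∀ k ≤ d, starAt p (fun i (f : Fin d) => if (f : ℕ) < k then D' i f else D i f) ∈ L := by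
    intro k hk
    induction k with
    | zero => simpa using hD
    | succ k ih =>
      refine h.mem_of_component hb ⟨k, hk⟩ ?_ (fun i g hg => ?_) (ih (by omega))
      · simpa using hf ⟨k, hk⟩
      · have : (g : ℕ) ≠ k := fun he => hg (Fin.ext he)
        simp only [show (g : ℕ) < k + 1 ↔ (g : ℕ) < k by omega]
  simpa using key d le_rfl

theorem isSaturated (h : IsLocallySaturated z L) (hb : 1 < b) (hz : ∀ f, (z f : ℕ) = 0) :
    IsSaturated L := by
  rintro r ⟨u, hu, hr⟩ u' hr'
  obtain ⟨p, D, rfl, hD⟩ := isParEncoding_iff.mp hr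
  obtain ⟨p', D', rfl, hD'⟩ := isParEncoding_iff.mp hr'
  -- Padding the first encoding with `p'` zeros and the second with `p` puts both stars at position
  -- `p + p'`, where equal values mean equal expansions.
  obtain ⟨E, hE, hE'⟩ := h.exists_pad hz p' p D
  obtain ⟨F, hF, hF'⟩ := h.exists_pad hz p p' D'
  rw [← hF, add_comm p' p]
  refine h.mem_of_ofDigits_eq hb (fun f => ?_) (hE.mpr hu)
  have hpos : (b : ℝ) ^ (p + p') ≠ 0 := by positivity
  refine mul_left_cancel₀ hpos ?_
  rw [hE', hD, add_comm p p', hF', hD']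

end IsLocallySaturated

theorem isRVA_iff {Q : Type*} {A : BuchiAutomaton (ParLetter b d) Q} (hb : 1 < b)
    (hz : ∀ f, (z f : ℕ) = 0) : IsRVA A ↔ IsLocallySaturated z A.language :=
  ⟨fun h => .of_isSaturated hb hz h.1 h.2, fun h =>
    ⟨isParallelLanguage_iff.mpr h.parallel, h.isSaturated hb hz⟩⟩

end Encoding


/-! ### The language of the product automaton -/

section Letters

variable {b d : ℕ}

theorem letterOfCode_lt {k : ℕ} (h : k < b ^ d) :
    letterOfCode b d k = some (finFunctionFinEquiv.symm ⟨k, h⟩) := dif_pos h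

theorem letterOfCode_code (a : Fin d → Fin b) :
    letterOfCode b d (finFunctionFinEquiv a) = some a := by
  rw [letterOfCode_lt (finFunctionFinEquiv a).isLt, Fin.eta, Equiv.symm_apply_apply]

theorem exists_code {k : ℕ} (h : k < b ^ d) :
    ∃ a : Fin d → Fin b, k = (finFunctionFinEquiv a : ℕ) :=
  ⟨finFunctionFinEquiv.symm ⟨k, h⟩, by simp⟩

theorem letterOfCode_eq_none_iff {k : ℕ} : letterOfCode b d k = none ↔ b ^ d ≤ k := by
  unfold letterOfCode
  split_ifs with h <;> simp <;> omega

theorem exists_letterOfCode_eq (x : ParLetter b d) : ∃ k ≤ b ^ d, letterOfCode b d k = x := by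
  cases x with
  | none => exact ⟨b ^ d, le_rfl, letterOfCode_eq_none_iff.mpr le_rfl⟩
  | some a => exact ⟨_, (finFunctionFinEquiv a).isLt.le, letterOfCode_code a⟩

theorem code_div_mod (a : Fin d → Fin b) (f : Fin d) :
    (finFunctionFinEquiv a : ℕ) / b ^ (f : ℕ) % b = a f := by
  have := congrArg Fin.val (congrFun (finFunctionFinEquiv.symm_apply_apply a) f)
  exact this

/-- This is an additive form of replacing a digit, which avoids truncated subtraction and yields the
three digit changes of `dualLetter`. -/
theorem code_update (a : Fin d → Fin b) (f : Fin d) (v : Fin b) :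
    (finFunctionFinEquiv (Function.update a f v) : ℕ) + a f * b ^ (f : ℕ) =
      (finFunctionFinEquiv a : ℕ) + v * b ^ (f : ℕ) := by
  rw [finFunctionFinEquiv_apply, finFunctionFinEquiv_apply,
    ← Finset.add_sum_erase _ _ (Finset.mem_univ f),
    ← Finset.add_sum_erase _ (fun i => (a i : ℕ) * b ^ (i : ℕ)) (Finset.mem_univ f),
    Function.update_self, Finset.sum_congr rfl fun i hi => by
      rw [Function.update_of_ne (Finset.ne_of_mem_erase hi)]]
  ring

theorem code_add (a : Fin d → Fin b) (f : Fin d) (h : (a f : ℕ) + 1 < b) :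
    (finFunctionFinEquiv a : ℕ) + b ^ (f : ℕ) =
      finFunctionFinEquiv (Function.update a f ⟨a f + 1, h⟩) := by
  have := code_update a f ⟨a f + 1, h⟩
  simp only [Nat.succ_mul] at this
  omega

theorem code_max (a : Fin d → Fin b) (f : Fin d) (h : b - 1 < b) :
    (finFunctionFinEquiv a : ℕ) + (b - 1 - a f) * b ^ (f : ℕ) =
      finFunctionFinEquiv (Function.update a f ⟨b - 1, h⟩) := by
  have h1 := code_update a f ⟨b - 1, h⟩
  have h2 : (b - 1 - a f) * b ^ (f : ℕ) + a f * b ^ (f : ℕ) = (b - 1) * b ^ (f : ℕ) := by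
    rw [← Nat.add_mul, Nat.sub_add_cancel (by have := (a f).isLt; omega)]
  simp only at h1
  omega

theorem code_zero (a : Fin d → Fin b) (f : Fin d) (h : 0 < b) :
    (finFunctionFinEquiv a : ℕ) - a f * b ^ (f : ℕ) =
      finFunctionFinEquiv (Function.update a f ⟨0, h⟩) := by
  have h1 := code_update a f ⟨0, h⟩
  simp only [Nat.zero_mul] at h1
  omega

theorem dualLetter_le (f : Fin d) (m sw k : ℕ) (hk : k ≤ b ^ d) :
    dualLetter b (b ^ d) (b ^ (f : ℕ)) m sw k ≤ b ^ d := by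
  unfold dualLetter
  split_ifs with h1 h2 h3 h4 h5 h6
  · exact hk
  · obtain ⟨a, rfl⟩ := exists_code h1
    rw [code_div_mod] at h4
    rw [code_add a f h4]
    exact Fin.is_le'
  · exact hk
  · exact hk
  · obtain ⟨a, rfl⟩ := exists_code h1
    rw [code_div_mod, code_max a f (by have := (a f).isLt; omega)]
    exact Fin.is_le'
  · exact (Nat.sub_le _ _).trans hk
  · exact hk

end Letters

/-! ### Runs of the product automaton -/

section Product

open Filter

/-- The modes of the run of the product automaton. -/
def dualModes (b B pw m : ℕ) (w : ℕ → ℕ) : ℕ → ℕ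
  | 0 => m
  | i + 1 => dualMode b B pw (dualModes b B pw m w i) (w i / (B + 1)) (w i % (B + 1))

/-- The letters that the given automaton reads in the run of the product automaton. -/
def dualLetters (b B pw m : ℕ) (w : ℕ → ℕ) (i : ℕ) : ℕ :=
  dualLetter b B pw (dualModes b B pw m w i) (w i / (B + 1)) (w i % (B + 1))

/-- The letter makes the product automaton leave the modes `0,…,3`. -/
def IsSwitch (b B pw l : ℕ) : Prop :=
  l % (B + 1) < B ∧ l / (B + 1) = 1 ∧ l % (B + 1) / pw % b + 1 < b

variable {b n B pw : ℕ} {δ F : ℕ → ℕ} {w : ℕ → ℕ}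

/-- The transition function of the given automaton. -/
def plainTable (δ : ℕ → ℕ) (B q k : ℕ) : ℕ := δ (q * (B + 1) + k)

theorem index_lt {q k : ℕ} (hq : q < n) (hk : k ≤ B) : q * (B + 1) + k < n * (B + 1) := by
  have := Nat.mul_le_mul_right (B + 1) (Nat.succ_le_of_lt hq)
  rw [Nat.succ_mul] at this
  omega

theorem le_dualMode {m sw k : ℕ} (hm : m < 6) : m ≤ dualMode b B pw m sw k := by
  unfold dualMode
  split_ifs <;> omega

theorem dualModes_lt {m : ℕ} (hm : m < 6) (i : ℕ) : dualModes b B pw m w i < 6 := by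
  induction i with
  | zero => exact hm
  | succ i ih => exact dualMode_lt ih

theorem dualModes_le {m : ℕ} (hm : m < 6) {i j : ℕ} (hij : i ≤ j) :
    dualModes b B pw m w i ≤ dualModes b B pw m w j := by
  induction j, hij using Nat.le_induction with
  | base => exact le_rfl
  | succ j _ ih => exact ih.trans (le_dualMode (dualModes_lt hm j))

theorem tableRun_plainTable_lt (hδ : ∀ i < n * (B + 1), δ i < n) {o : ℕ → ℕ}
    (ho : ∀ i, o i ≤ B) {q : ℕ} (hq : q < n) (i : ℕ) : tableRun (plainTable δ B) q o i < n := by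
  induction i with
  | zero => exact hq
  | succ i ih => exact hδ _ (index_lt ih (ho i))

theorem add_div_of_lt {m q : ℕ} (hq : q < n) : (m * n + q) / n = m := by
  rw [mul_comm, Nat.mul_add_div (by omega), Nat.div_eq_of_lt hq, add_zero]

theorem add_mod_of_lt {m q : ℕ} (hq : q < n) : (m * n + q) % n = q := by
  rw [mul_comm, Nat.mul_add_mod, Nat.mod_eq_of_lt hq]

/-- The modes depend on the input word only, so the run splits into the sequence of modes and a run
of the given automaton on the modified letters. -/
theorem tableRun_dualTable (hδ : ∀ i < n * (B + 1), δ i < n)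
    (hdl : ∀ m sw k, k ≤ B → dualLetter b B pw m sw k ≤ B) {m q : ℕ} (hq : q < n) (i : ℕ) :
    tableRun (dualTable δ b n B pw) (m * n + q) w i =
      dualModes b B pw m w i * n + tableRun (plainTable δ B) q (dualLetters b B pw m w) i := by
  have ho : ∀ i, dualLetters b B pw m w i ≤ B := fun i =>
    hdl _ _ _ (Nat.le_of_lt_succ (Nat.mod_lt _ (Nat.succ_pos B)))
  induction i with
  | zero => rfl
  | succ i ih =>
    have hlt := tableRun_plainTable_lt hδ ho hq i
    rw [tableRun, ih, dualTable, add_div_of_lt hlt, add_mod_of_lt hlt]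
    rfl

theorem tableAccepts_dualTable (hδ : ∀ i < n * (B + 1), δ i < n)
    (hdl : ∀ m sw k, k ≤ B → dualLetter b B pw m sw k ≤ B) {m q : ℕ} (hq : q < n) :
    TableAccepts (dualTable δ b n B pw) (fun x => dualFlag F n x = 1) (m * n + q) w ↔
      ∃ᶠ i in atTop, (dualModes b B pw m w i ≠ 1 ∧ dualModes b B pw m w i ≠ 3) ∧
        F (tableRun (plainTable δ B) q (dualLetters b B pw m w) i) = 1 := by
  have ho : ∀ i, dualLetters b B pw m w i ≤ B := fun i =>
    hdl _ _ _ (Nat.le_of_lt_succ (Nat.mod_lt _ (Nat.succ_pos B)))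
  refine frequently_congr (.of_forall fun i => ?_)
  have hlt := tableRun_plainTable_lt hδ ho hq i
  simp only [tableRun_dualTable hδ hdl hq, dualFlag, add_div_of_lt hlt, add_mod_of_lt hlt]
  split_ifs <;> simp [*]

/-- Only the modes 1 and 3 suppress acceptance, so a run that finally avoids them accepts exactly
when the given automaton does. -/
theorem tableAccepts_dualTable_of_eventually (hδ : ∀ i < n * (B + 1), δ i < n)
    (hdl : ∀ m sw k, k ≤ B → dualLetter b B pw m sw k ≤ B) {m q : ℕ} (hq : q < n)
    (he : ∀ᶠ i in atTop, dualModes b B pw m w i ≠ 1 ∧ dualModes b B pw m w i ≠ 3) :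
    TableAccepts (dualTable δ b n B pw) (fun x => dualFlag F n x = 1) (m * n + q) w ↔
      TableAccepts (plainTable δ B) (fun q => F q = 1) q (dualLetters b B pw m w) := by
  rw [tableAccepts_dualTable hδ hdl hq]
  exact frequently_congr (he.mono fun i hi => and_iff_right hi)

theorem dualMode_of_not_isSwitch {m l : ℕ} (hm : m < 4) (h : ¬ IsSwitch b B pw l) :
    dualMode b B pw m (l / (B + 1)) (l % (B + 1)) =
      if l % (B + 1) < B then m else if 0 < m then if m < 3 then m + 1 else m else m := by
  unfold IsSwitch at h
  unfold dualMode
  split_ifs <;> tauto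

theorem dualLetter_of_not_isSwitch {m l : ℕ} (hm : m < 4) (h : ¬ IsSwitch b B pw l) :
    dualLetter b B pw m (l / (B + 1)) (l % (B + 1)) = l % (B + 1) := by
  unfold IsSwitch at h
  unfold dualLetter
  split_ifs <;> tauto

theorem dualModes_zero {τ : ℕ} (h : ∀ i < τ, ¬ IsSwitch b B pw (w i)) {i : ℕ} (hi : i ≤ τ) :
    dualModes b B pw 0 w i = 0 := by
  induction i with
  | zero => rfl
  | succ i ih =>
    rw [dualModes, ih (by omega), dualMode_of_not_isSwitch (by norm_num) (h i hi)]
    simp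

theorem dualModes_one {τ : ℕ} (h : ∀ i < τ, ¬ IsSwitch b B pw (w i)) {i : ℕ} (hi : i ≤ τ) :
    1 ≤ dualModes b B pw 1 w i ∧ dualModes b B pw 1 w i ≤ 3 := by
  induction i with
  | zero => exact ⟨le_rfl, by norm_num [dualModes]⟩
  | succ i ih =>
    have := ih (by omega)
    rw [dualModes, dualMode_of_not_isSwitch (by omega) (h i hi)]
    split_ifs <;> omega

theorem dualModes_eq_of_isSwitch {m τ c : ℕ} (hc : 4 ≤ c)
    (h : dualModes b B pw m w (τ + 1) = c) {i : ℕ} (hi : τ < i) : dualModes b B pw m w i = c := by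
  induction i, hi using Nat.le_induction with
  | base => exact h
  | succ i _ ih =>
    rw [dualModes, ih]
    unfold dualMode
    split_ifs <;> omega

theorem dualModes_zero_ne (i : ℕ) :
    dualModes b B pw 0 w i ≠ 1 ∧ dualModes b B pw 0 w i ≠ 3 := by
  have : dualModes b B pw 0 w i = 0 ∨ dualModes b B pw 0 w i = 4 := by
    induction i with
    | zero => exact .inl rfl
    | succ i ih =>
      rw [dualModes]
      unfold dualMode
      rcases ih with ih | ih <;> rw [ih] <;> split_ifs <;> omega
  omega

/-- If the counting part ends in mode `2` then exactly one star has been read. -/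
theorem exists_star_of_frequently (h : ∀ i, ¬ IsSwitch b B pw (w i))
    (hf : ∃ᶠ i in atTop, dualModes b B pw 1 w i = 2) :
    ∃ p, ∀ i, B ≤ w i % (B + 1) ↔ i = p := by
  have hb : ∀ i, 1 ≤ dualModes b B pw 1 w i ∧ dualModes b B pw 1 w i ≤ 3 := fun i =>
    dualModes_one (fun j _ => h j) (le_refl i)
  have hstep : ∀ i, dualModes b B pw 1 w (i + 1) = if w i % (B + 1) < B then
      dualModes b B pw 1 w i else if dualModes b B pw 1 w i < 3 then
        dualModes b B pw 1 w i + 1 else dualModes b B pw 1 w i := fun i => by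
    have := hb i
    rw [dualModes, dualMode_of_not_isSwitch (by omega) (h i)]
    split_ifs <;> omega
  have hmono : ∀ {i j}, i ≤ j → dualModes b B pw 1 w i ≤ dualModes b B pw 1 w j := fun hij =>
    dualModes_le (by norm_num) hij
  classical
  have hex := hf.exists
  have hmin := fun j (hj : j < Nat.find hex) => Nat.find_min hex hj
  have hspec := Nat.find_spec hex
  generalize Nat.find hex = k at hmin hspec
  cases k with
  | zero => simp [dualModes] at hspec
  | succ p =>
    have hp := hmin p (by omega)
    have hp1 := hb p
    have hsp := hstep p
    refine ⟨p, fun i => ⟨fun hi => ?_, ?_⟩⟩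
    · by_contra hne
      have hsi := hstep i
      have hi1 := hb i
      -- A star before `p` would put the run above mode 1 by position `p`, and a star after `p`
      -- would keep it in mode 3 for ever.
      rcases Nat.lt_or_gt_of_ne hne with hlt | hlt
      · have := hmono (show i + 1 ≤ p by omega)
        split_ifs at hsi hsp <;> omega
      · have h2 := hmono (show p + 1 ≤ i by omega)
        obtain ⟨j, hj, hj2⟩ := frequently_atTop.mp hf (i + 1)
        have := hmono hj
        split_ifs at hsi hsp <;> omega
    · rintro rfl
      by_contra hlt
      rw [if_pos (by omega)] at hsp
      omega

theorem dualModes_eq_two (h : ∀ i, ¬ IsSwitch b B pw (w i)) {p : ℕ}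
    (hp : ∀ i, B ≤ w i % (B + 1) ↔ i = p) {i : ℕ} (hi : p < i) :
    dualModes b B pw 1 w i = 2 := by
  have h1 : ∀ i ≤ p, dualModes b B pw 1 w i = 1 := by
    intro i hi
    induction i with
    | zero => rfl
    | succ i ih =>
      have := (hp i).not.mpr (by omega)
      rw [dualModes, ih (by omega), dualMode_of_not_isSwitch (by norm_num) (h i),
        if_pos (by omega)]
  induction i, hi using Nat.le_induction with
  | base =>
    have := (hp p).mpr rfl
    rw [dualModes, h1 p le_rfl, dualMode_of_not_isSwitch (by norm_num) (h p), if_neg (by omega)]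
    norm_num
  | succ i hi ih =>
    have := (hp i).not.mpr (by omega)
    rw [dualModes, ih, dualMode_of_not_isSwitch (by norm_num) (h i), if_pos (by omega)]

end Product


/-! ### Weakness of the product automaton and correctness of the component test -/

section Product

open Filter

variable {b d n : ℕ} {A : BuchiAutomaton (ParLetter b d) (Fin n)} {δ F : ℕ → ℕ} {w : ℕ → ℕ}
  {f : Fin d}

/-- The arrays `δ` and `F` describe the transitions and the accepting states of `A`. -/
structure IsTableOf (A : BuchiAutomaton (ParLetter b d) (Fin n)) (δ F : ℕ → ℕ) : Prop where
  step : ∀ (q : Fin n), ∀ k ≤ b ^ d, δ (q * (b ^ d + 1) + k) = A.step q (letterOfCode b d k)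
  accept : ∀ q : Fin n, F q = 1 ↔ q ∈ A.accept

namespace IsTableOf

theorem lt (h : IsTableOf A δ F) : ∀ i < n * (b ^ d + 1), δ i < n := by
  intro i hi
  have hq : i / (b ^ d + 1) < n := (Nat.div_lt_iff_lt_mul (Nat.succ_pos _)).mpr hi
  have := h.step ⟨_, hq⟩ (i % (b ^ d + 1)) (Nat.le_of_lt_succ (Nat.mod_lt _ (Nat.succ_pos _)))
  rw [mul_comm, Nat.div_add_mod] at this
  rw [this]
  exact Fin.isLt _

theorem tableRun_eq (h : IsTableOf A δ F) {o : ℕ → ℕ} (ho : ∀ i, o i ≤ b ^ d) (i : ℕ) :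
    tableRun (plainTable δ (b ^ d)) A.init o i = A.run (fun i => letterOfCode b d (o i)) i := by
  induction i with
  | zero => rfl
  | succ i ih =>
    rw [tableRun, ih, BuchiAutomaton.run, plainTable, h.step _ _ (ho i)]

/-- There are finitely many accepting states, so infinitely many accepting visits include infinitely
many visits to one of them. -/
theorem _root_.BuchiAutomaton.mem_language_iff {α Q : Type*} [Finite Q] {A : BuchiAutomaton α Q}
    {u : ℕ → α} : u ∈ A.language ↔ ∃ᶠ i in atTop, A.run u i ∈ A.accept := by
  rw [Nat.frequently_atTop_iff_infinite]
  constructor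
  · rintro ⟨q, hq, hinf⟩
    exact hinf.mono fun i hi => by rw [Set.mem_ofPred_eq] at hi ⊢; rwa [hi]
  · intro hinf
    by_contra hcon
    have hfin : ∀ q ∈ A.accept, {i | A.run u i = q}.Finite := fun q hq =>
      Set.not_infinite.mp fun hi => hcon ⟨q, hq, hi⟩
    refine hinf (((Set.toFinite A.accept).biUnion hfin).subset fun i hi => ?_)
    simpa using hi

theorem mem_language_iff (h : IsTableOf A δ F) {o : ℕ → ℕ} (ho : ∀ i, o i ≤ b ^ d) :
    (fun i => letterOfCode b d (o i)) ∈ A.language ↔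
      TableAccepts (plainTable δ (b ^ d)) (fun q => F q = 1) A.init o := by
  rw [BuchiAutomaton.mem_language_iff]
  refine frequently_congr (.of_forall fun i => ?_)
  rw [h.tableRun_eq ho]
  exact (h.accept _).symm

theorem accessible_of_transGen (h : IsTableOf A δ F) {x y : ℕ} (hx : x < 6 * n)
    (hxy : Relation.TransGen (TableEdge (dualTable δ b n (b ^ d) (b ^ (f : ℕ)))
      (2 * (b ^ d + 1))) x y) (hn : 0 < n) :
    y < 6 * n ∧ x / n ≤ y / n ∧
      A.Accessible ⟨x % n, Nat.mod_lt _ hn⟩ ⟨y % n, Nat.mod_lt _ hn⟩ := by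
  have key : ∀ x < 6 * n, ∀ l, dualTable δ b n (b ^ d) (b ^ (f : ℕ)) x l < 6 * n ∧
      x / n ≤ dualTable δ b n (b ^ d) (b ^ (f : ℕ)) x l / n ∧
      ∃ a, A.step ⟨x % n, Nat.mod_lt _ hn⟩ a =
        ⟨dualTable δ b n (b ^ d) (b ^ (f : ℕ)) x l % n, Nat.mod_lt _ hn⟩ := by
    intro x hx l
    have hm : x / n < 6 := (Nat.div_lt_iff_lt_mul hn).mpr hx
    have hk := dualLetter_le f (x / n) (l / (b ^ d + 1)) (l % (b ^ d + 1))
      (Nat.le_of_lt_succ (Nat.mod_lt _ (Nat.succ_pos _)))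
    have hstep := h.step ⟨x % n, Nat.mod_lt _ hn⟩ _ hk
    have hlt := h.lt _ (index_lt (Nat.mod_lt x hn) hk)
    have hm' : dualMode b (b ^ d) (b ^ (f : ℕ)) (x / n) (l / (b ^ d + 1)) (l % (b ^ d + 1)) < 6 :=
      dualMode_lt hm
    unfold dualTable
    refine ⟨?_, ?_, letterOfCode b d _, Fin.ext (hstep.symm.trans ?_)⟩
    · have := Nat.mul_le_mul_right n (Nat.le_of_lt_succ hm')
      omega
    · rw [add_div_of_lt hlt]
      exact le_dualMode hm
    · exact (add_mod_of_lt hlt).symm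
  induction hxy with
  | single he =>
    obtain ⟨l, -, rfl⟩ := he
    obtain ⟨h1, h2, h3⟩ := key x hx l
    exact ⟨h1, h2, .single h3⟩
  | tail _ he ih =>
    obtain ⟨l, -, rfl⟩ := he
    obtain ⟨h1, h2, h3⟩ := key _ ih.1 l
    exact ⟨h1, ih.2.1.trans h2, ih.2.2.tail h3⟩

/-- Modes never decrease, so mutually accessible states share their mode, and their projections are
mutually accessible in `A`. The flag depends on the mode and on acceptance in `A` only. -/
theorem isWeakTable (h : IsTableOf A δ F) (hA : A.IsWeak) (hn : 0 < n) :
    IsWeakTable (dualTable δ b n (b ^ d) (b ^ (f : ℕ))) (6 * n) (2 * (b ^ d + 1))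
      fun x => dualFlag F n x = 1 where
  pos := by omega
  lt x hx l hl := (h.accessible_of_transGen hx (.single ⟨l, hl, rfl⟩) hn).1
  weak x hx y hy hxy hyx := by
    obtain ⟨-, h1, h2⟩ := h.accessible_of_transGen hx hxy hn
    obtain ⟨-, h3, h4⟩ := h.accessible_of_transGen hy hyx hn
    have := hA _ _ h2 h4
    rw [← h.accept, ← h.accept] at this
    simp only [dualFlag, le_antisymm h1 h3]
    split_ifs
    exacts [Iff.rfl, Iff.rfl, this]

end IsTableOf

theorem dualLetters_le (m i : ℕ) :
    dualLetters b (b ^ d) (b ^ (f : ℕ)) m w i ≤ b ^ d :=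
  dualLetter_le f _ _ _ (Nat.le_of_lt_succ (Nat.mod_lt _ (Nat.succ_pos _)))

theorem dualModes_of_isSwitch {τ : ℕ}
    (hmin : ∀ i < τ, ¬ IsSwitch b (b ^ d) (b ^ (f : ℕ)) (w i))
    (hτ : IsSwitch b (b ^ d) (b ^ (f : ℕ)) (w τ)) {i : ℕ} (hi : τ < i) :
    dualModes b (b ^ d) (b ^ (f : ℕ)) 0 w i = 4 ∧ dualModes b (b ^ d) (b ^ (f : ℕ)) 1 w i = 5 := by
  have h0 := dualModes_zero hmin le_rfl
  have h1 := dualModes_one hmin le_rfl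
  obtain ⟨g1, g2, g3⟩ := hτ
  refine ⟨dualModes_eq_of_isSwitch le_rfl ?_ hi, dualModes_eq_of_isSwitch (by norm_num) ?_ hi⟩
  · rw [dualModes, h0]
    simp [dualMode, g1, g2, g3]
  · rw [dualModes]
    simp only [dualMode, g1, g2, g3, if_true]
    rw [if_pos (by omega), if_neg (by omega)]

/-- Before the first switch both copies read the input letter unchanged. At the switch they read `a`
and `a + 1` in component `f`, and afterwards the modes 4 and 5 force `b - 1` and `0` there. -/
theorem isDualWord_dualLetters {τ : ℕ}
    (hmin : ∀ i < τ, ¬ IsSwitch b (b ^ d) (b ^ (f : ℕ)) (w i))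
    (hτ : IsSwitch b (b ^ d) (b ^ (f : ℕ)) (w τ)) :
    IsDualWord f τ (fun i => letterOfCode b d (dualLetters b (b ^ d) (b ^ (f : ℕ)) 0 w i))
      fun i => letterOfCode b d (dualLetters b (b ^ d) (b ^ (f : ℕ)) 1 w i) := by
  refine ⟨fun i hi => ?_, ?_, fun i hi => ?_⟩
  · have h1 := dualModes_one hmin hi.le
    simp only [dualLetters]
    rw [dualModes_zero hmin hi.le, dualLetter_of_not_isSwitch (by norm_num) (hmin i hi),
      dualLetter_of_not_isSwitch (by omega) (hmin i hi)]
  · have h0 := dualModes_zero hmin le_rfl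
    have h1 := dualModes_one hmin le_rfl
    obtain ⟨g1, g2, g3⟩ := hτ
    obtain ⟨a, ha⟩ := exists_code g1
    rw [ha, code_div_mod] at g3
    refine ⟨a, Function.update a f ⟨a f + 1, g3⟩, ?_, ?_, by simp, fun g hg => by simp [hg]⟩
    · simp only [dualLetters]
      rw [h0, ← letterOfCode_code, ha]
      simp [dualLetter, g2]
    · simp only [dualLetters]
      rw [← letterOfCode_code, ← code_add a f g3, ha]
      congr 1
      simp only [dualLetter, g2, code_div_mod, g3, if_true]
      rw [if_pos (by rw [← ha]; exact g1), if_pos (by omega), if_neg (by omega)]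
  · obtain ⟨h4, h5⟩ := dualModes_of_isSwitch hmin hτ hi
    simp only [dualLetters, h4, h5]
    by_cases hk : w i % (b ^ d + 1) < b ^ d
    · right
      obtain ⟨a, ha⟩ := exists_code hk
      have hb : 0 < b := (Nat.zero_le _).trans_lt (a f).isLt
      refine ⟨Function.update a f ⟨b - 1, by omega⟩, Function.update a f ⟨0, hb⟩, ?_, ?_,
        by simp, by simp, fun g hg => by simp [hg]⟩
      · rw [← letterOfCode_code, ← code_max, dualLetter, if_pos hk, ha, code_div_mod]
        simp
      · rw [← letterOfCode_code, ← code_zero, dualLetter, if_pos hk, ha, code_div_mod]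
        simp
    · left
      simp only [dualLetter, if_neg hk]
      rw [letterOfCode_eq_none_iff]
      omega

/-- In `IsDualWord.exists_switch` this identifies the word read by the second copy from the first
one, without a second computation of letters. -/
theorem IsDualWord.right_unique {τ : ℕ} {u v v' : ℕ → ParLetter b d} (h : IsDualWord f τ u v)
    (h' : IsDualWord f τ u v') : v = v' := by
  have key : ∀ {a a' : Fin d → Fin b}, (a f : ℕ) = a' f → (∀ g ≠ f, a g = a' g) → a = a' := by
    intro a a' h1 h2
    funext g
    by_cases hg : g = f
    · rw [hg]
      exact Fin.ext h1
    · exact h2 g hg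
  obtain ⟨h1, ⟨a, a', h2, h3, h4, h5⟩, h6⟩ := h
  obtain ⟨k1, ⟨c, c', k2, k3, k4, k5⟩, k6⟩ := h'
  funext i
  rcases Nat.lt_trichotomy i τ with hi | rfl | hi
  · rw [← h1 i hi, ← k1 i hi]
  · rw [h2] at k2
    obtain rfl := Option.some.inj k2
    rw [h3, k3, key (h4.trans k4.symm) fun g hg => (h5 g hg).trans (k5 g hg).symm]
  · rcases h6 i hi with ⟨e1, e2⟩ | ⟨a, a', e1, e2, e3, e4, e5⟩
    · rcases k6 i hi with ⟨j1, j2⟩ | ⟨c, c', j1, j2, j3, j4, j5⟩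
      · rw [e2, j2]
      · rw [e1] at j1
        simp at j1
    · rcases k6 i hi with ⟨j1, j2⟩ | ⟨c, c', j1, j2, j3, j4, j5⟩
      · rw [e1] at j1
        simp at j1
      · rw [e1] at j1
        obtain rfl := Option.some.inj j1
        rw [e2, j2, key (e4.trans j4.symm) fun g hg => (e5 g hg).trans (j5 g hg).symm]

/-- The input is the code of `u`, with the switch bit set at position `τ` only. The digit there is
below `b - 1`, because `u'` has a digit larger by one, so the switch is active. -/
theorem IsDualWord.exists_switch {τ : ℕ} {u u' : ℕ → ParLetter b d} (h : IsDualWord f τ u u') :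
    ∃ w : ℕ → ℕ, (∀ i, w i < 2 * (b ^ d + 1)) ∧
      (∀ i < τ, ¬ IsSwitch b (b ^ d) (b ^ (f : ℕ)) (w i)) ∧
      IsSwitch b (b ^ d) (b ^ (f : ℕ)) (w τ) ∧
      (fun i => letterOfCode b d (dualLetters b (b ^ d) (b ^ (f : ℕ)) 0 w i)) = u ∧
      (fun i => letterOfCode b d (dualLetters b (b ^ d) (b ^ (f : ℕ)) 1 w i)) = u' := by
  choose c hc hcu using fun i => exists_letterOfCode_eq (u i)
  set w : ℕ → ℕ := fun i => if i = τ then b ^ d + 1 + c i else c i with hw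
  have hdiv : w τ / (b ^ d + 1) = 1 := by
    rw [hw]
    simp only [if_true]
    rw [Nat.add_div_left _ (Nat.succ_pos _), Nat.div_eq_of_lt (Nat.lt_succ_of_le (hc τ))]
  have hmod : ∀ i, w i % (b ^ d + 1) = c i := fun i => by
    simp only [hw]
    split_ifs
    · rw [Nat.add_mod_left, Nat.mod_eq_of_lt (Nat.lt_succ_of_le (hc i))]
    · rw [Nat.mod_eq_of_lt (Nat.lt_succ_of_le (hc i))]
  have hdiv0 : ∀ i, i ≠ τ → w i / (b ^ d + 1) = 0 := fun i hi => by
    simp only [hw, if_neg hi]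
    exact Nat.div_eq_of_lt (Nat.lt_succ_of_le (hc i))
  have hmin : ∀ i < τ, ¬ IsSwitch b (b ^ d) (b ^ (f : ℕ)) (w i) := fun i hi hs => by
    have := hs.2.1
    rw [hdiv0 i hi.ne] at this
    omega
  have hcode : ∀ i a, u i = some a → c i = (finFunctionFinEquiv a : ℕ) := fun i a ha => by
    have hlt : c i < b ^ d := by
      by_contra hge
      have := letterOfCode_eq_none_iff.mpr (not_lt.mp hge)
      rw [hcu, ha] at this
      simp at this
    obtain ⟨a', ha'⟩ := exists_code hlt
    have := hcu i
    rw [ha, ha', letterOfCode_code] at this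
    rw [ha', Option.some.inj this]
  obtain ⟨h1, ⟨a, a', h2, h3, h4, h5⟩, h6⟩ := id h
  have hτ : IsSwitch b (b ^ d) (b ^ (f : ℕ)) (w τ) := by
    refine ⟨?_, hdiv, ?_⟩
    · rw [hmod, hcode τ a h2]
      exact Fin.isLt _
    · rw [hmod, hcode τ a h2, code_div_mod, ← h4]
      exact Fin.isLt _
  have hu : (fun i => letterOfCode b d (dualLetters b (b ^ d) (b ^ (f : ℕ)) 0 w i)) = u := by
    funext i
    rcases Nat.lt_trichotomy i τ with hi | rfl | hi
    · rw [dualLetters, dualModes_zero hmin hi.le,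
        dualLetter_of_not_isSwitch (by norm_num) (hmin i hi), hmod, hcu]
    · rw [dualLetters, dualModes_zero hmin le_rfl, hmod, ← hcu i]
      simp [dualLetter]
    · rw [dualLetters, (dualModes_of_isSwitch hmin hτ hi).1, hmod]
      rcases h6 i hi with ⟨e1, e2⟩ | ⟨a, a', e1, e2, e3, e4, e5⟩
      · have : ¬ c i < b ^ d := by
          rw [not_lt, ← letterOfCode_eq_none_iff, hcu, e1]
        simp only [dualLetter, if_neg this]
        exact hcu i
      · rw [hcode i a e1]
        simp only [dualLetter, code_div_mod, e3, Nat.sub_self, Nat.zero_mul, Nat.add_zero]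
        split_ifs <;> first | omega | rw [letterOfCode_code, e1]
  refine ⟨w, fun i => ?_, hmin, hτ, hu, ?_⟩
  · have := hc i
    simp only [hw]
    split_ifs <;> omega
  · have hd := isDualWord_dualLetters hmin hτ
    rw [hu] at hd
    exact hd.right_unique h

/-- The test for the component `f`, in terms of the language. -/
theorem IsTableOf.componentTest_iff (h : IsTableOf A δ F) (f : Fin d) {z : Fin d → Fin b}
    (hz : (finFunctionFinEquiv z : ℕ) = 0) :
    RAM.ComponentTest δ F b n (b ^ d) A.init (b ^ (f : ℕ)) ↔
      (∀ u ∈ A.language, ∃ p D, u = starAt p D) ∧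
      (∀ u, consWord (some z) u ∈ A.language ↔ u ∈ A.language) ∧
      ∀ τ u u', IsDualWord f τ u u' → (u ∈ A.language ↔ u' ∈ A.language) := by
  have hB : 0 < b ^ d := (Nat.zero_le _).trans_lt (finFunctionFinEquiv z).isLt
  have hz' : letterOfCode b d 0 = some z := by rw [← hz, letterOfCode_code]
  have hdl : ∀ m sw k, k ≤ b ^ d → dualLetter b (b ^ d) (b ^ (f : ℕ)) m sw k ≤ b ^ d :=
    fun m sw k => dualLetter_le f m sw k
  have hinit := A.init.isLt
  have hδ0 : δ (A.init * (b ^ d + 1)) < n := by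
    have := h.lt _ (index_lt hinit (Nat.zero_le (b ^ d)))
    rwa [add_zero] at this
  have hacc0 : ∀ (q : ℕ) (_ : q < n) (w : ℕ → ℕ),
      TableAccepts (dualTable δ b n (b ^ d) (b ^ (f : ℕ))) (fun x => dualFlag F n x = 1) q w ↔
        TableAccepts (plainTable δ (b ^ d)) (fun q => F q = 1) q
          (dualLetters b (b ^ d) (b ^ (f : ℕ)) 0 w) := fun q hq w => by
    have := tableAccepts_dualTable_of_eventually (F := F) (w := w) h.lt hdl (m := 0) hq
      (.of_forall dualModes_zero_ne)
    rwa [zero_mul, zero_add] at this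
  have hlang : ∀ w : ℕ → ℕ,
      TableAccepts (dualTable δ b n (b ^ d) (b ^ (f : ℕ))) (fun x => dualFlag F n x = 1)
        A.init w ↔
      (fun i => letterOfCode b d (dualLetters b (b ^ d) (b ^ (f : ℕ)) 0 w i)) ∈ A.language :=
    fun w => (hacc0 _ hinit w).trans (h.mem_language_iff (dualLetters_le 0)).symm
  have hcons : ∀ w : ℕ → ℕ,
      TableAccepts (dualTable δ b n (b ^ d) (b ^ (f : ℕ))) (fun x => dualFlag F n x = 1)
        (δ (A.init * (b ^ d + 1))) w ↔ consWord (some z)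
      (fun i => letterOfCode b d (dualLetters b (b ^ d) (b ^ (f : ℕ)) 0 w i)) ∈ A.language := by
    intro w
    have hle : ∀ i, consWord 0 (dualLetters b (b ^ d) (b ^ (f : ℕ)) 0 w) i ≤ b ^ d := by
      rintro (_ | i)
      exacts [Nat.zero_le _, dualLetters_le 0 i]
    have hword : consWord (some z)
        (fun i => letterOfCode b d (dualLetters b (b ^ d) (b ^ (f : ℕ)) 0 w i)) =
        fun i => letterOfCode b d (consWord 0 (dualLetters b (b ^ d) (b ^ (f : ℕ)) 0 w) i) := by
      funext i
      cases i with
      | zero => exact hz'.symm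
      | succ i => rfl
    -- Reading the letter number 0 first moves the given automaton from its initial state to the
    -- state of the second seed.
    rw [hword, h.mem_language_iff hle, hacc0 _ hδ0, ← tableAccepts_tableRun _ (consWord _ _) 1]
    simp only [tableRun, consWord, plainTable, add_zero, add_comm 1]
  have hplain : ∀ (u : ℕ → ParLetter b d), ∃ w : ℕ → ℕ, (∀ i, w i ≤ b ^ d) ∧
      (∀ i, ¬ IsSwitch b (b ^ d) (b ^ (f : ℕ)) (w i)) ∧ (∀ i, w i % (b ^ d + 1) = w i) ∧
      (∀ i, letterOfCode b d (w i) = u i) := by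
    intro u
    choose c hc hcu using fun i => exists_letterOfCode_eq (u i)
    refine ⟨c, hc, fun i hs => ?_, fun i => Nat.mod_eq_of_lt (Nat.lt_succ_of_le (hc i)), hcu⟩
    have := hs.2.1
    rw [Nat.div_eq_of_lt (Nat.lt_succ_of_le (hc i))] at this
    omega
  have hplain0 : ∀ w : ℕ → ℕ, (∀ i, ¬ IsSwitch b (b ^ d) (b ^ (f : ℕ)) (w i)) → ∀ i,
      dualLetters b (b ^ d) (b ^ (f : ℕ)) 0 w i = w i % (b ^ d + 1) := fun w hw i => by
    rw [dualLetters, dualModes_zero (fun j _ => hw j) le_rfl,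
      dualLetter_of_not_isSwitch (by norm_num) (hw i)]
  have hplain1 : ∀ w : ℕ → ℕ, (∀ i, ¬ IsSwitch b (b ^ d) (b ^ (f : ℕ)) (w i)) → ∀ i,
      dualLetters b (b ^ d) (b ^ (f : ℕ)) 1 w i = w i % (b ^ d + 1) := fun w hw i => by
    have := dualModes_one (fun j _ => hw j) (le_refl i)
    rw [dualLetters, dualLetter_of_not_isSwitch (by omega) (hw i)]
  have hstar : ∀ w : ℕ → ℕ, ∀ p, (∀ i, b ^ d ≤ w i % (b ^ d + 1) ↔ i = p) ↔
      ∃ D, (fun i => letterOfCode b d (w i % (b ^ d + 1))) = starAt p D := fun w p => by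
    rw [exists_starAt_iff]
    simp only [letterOfCode_eq_none_iff]
  have hcount : ∀ w : ℕ → ℕ,
      TableAccepts (dualTable δ b n (b ^ d) (b ^ (f : ℕ))) (fun x => dualFlag F n x = 1)
        (n + A.init) w ↔ ∃ᶠ i in atTop, (dualModes b (b ^ d) (b ^ (f : ℕ)) 1 w i ≠ 1 ∧
          dualModes b (b ^ d) (b ^ (f : ℕ)) 1 w i ≠ 3) ∧ F (tableRun (plainTable δ (b ^ d)) A.init
            (dualLetters b (b ^ d) (b ^ (f : ℕ)) 1 w) i) = 1 := fun w => by
    have := tableAccepts_dualTable (F := F) (w := w) h.lt hdl (m := 1) hinit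
    rwa [one_mul] at this
  have hswitch : ∀ w : ℕ → ℕ, ∀ τ, (∀ i < τ, ¬ IsSwitch b (b ^ d) (b ^ (f : ℕ)) (w i)) →
      IsSwitch b (b ^ d) (b ^ (f : ℕ)) (w τ) →
      (TableAccepts (dualTable δ b n (b ^ d) (b ^ (f : ℕ))) (fun x => dualFlag F n x = 1)
        (n + A.init) w ↔
      (fun i => letterOfCode b d (dualLetters b (b ^ d) (b ^ (f : ℕ)) 1 w i)) ∈ A.language) := by
    intro w τ hmin hτ
    have := tableAccepts_dualTable_of_eventually (F := F) (w := w) h.lt hdl (m := 1) hinit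
      ((eventually_gt_atTop τ).mono fun i hi => by
        rw [(dualModes_of_isSwitch hmin hτ hi).2]; norm_num)
    rw [one_mul] at this
    rw [this, h.mem_language_iff (dualLetters_le 1)]
  constructor
  · rintro ⟨ht1, ht2⟩
    refine ⟨fun u hu => ?_, fun u => ?_, fun τ u u' hd => ?_⟩
    -- On an input without switches both copies read `u`, but the counting copy accepts only if it
    -- ends in mode 2.
    · obtain ⟨w, hw, hns, hmod, hwu⟩ := hplain u
      have h0 : (fun i => letterOfCode b d (dualLetters b (b ^ d) (b ^ (f : ℕ)) 0 w i)) = u := by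
        funext i
        rw [hplain0 w hns, hmod, hwu]
      have h1 := (ht1 w fun i => by have := hw i; omega).mp ((hlang w).mpr (h0 ▸ hu))
      rw [hcount] at h1
      obtain ⟨p, hp⟩ := exists_star_of_frequently hns (h1.mono fun i hi => by
        have := dualModes_one (fun j _ => hns j) (le_refl i)
        omega)
      obtain ⟨D, hD⟩ := (hstar w p).mp hp
      refine ⟨p, D, hD ▸ ?_⟩
      funext i
      rw [hmod, hwu]
    · obtain ⟨w, hw, hns, hmod, hwu⟩ := hplain u
      have h0 : (fun i => letterOfCode b d (dualLetters b (b ^ d) (b ^ (f : ℕ)) 0 w i)) = u := by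
        funext i
        rw [hplain0 w hns, hmod, hwu]
      have := ht2 w fun i => by have := hw i; omega
      rwa [hlang, hcons, h0] at this
    · obtain ⟨w, hw, hmin, hτ, rfl, rfl⟩ := hd.exists_switch
      rw [← hlang, ← hswitch w τ hmin hτ]
      exact ht1 w hw
  · rintro ⟨hpar, hzero, hdual⟩
    refine ⟨fun w hw => ?_, fun w hw => ?_⟩
    -- The first active switch fixes a pair of dual words, and later ones have no effect. Without a
    -- switch both copies read the same word, and only the number of stars matters.
    · by_cases hs : ∃ i, IsSwitch b (b ^ d) (b ^ (f : ℕ)) (w i)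
      · classical
        have hmin := fun i (hi : i < Nat.find hs) => Nat.find_min hs hi
        rw [hlang, hswitch w _ hmin (Nat.find_spec hs)]
        exact hdual _ _ _ (isDualWord_dualLetters hmin (Nat.find_spec hs))
      · rw [not_exists] at hs
        have hletters : dualLetters b (b ^ d) (b ^ (f : ℕ)) 0 w =
            dualLetters b (b ^ d) (b ^ (f : ℕ)) 1 w := by
          funext i
          rw [hplain0 w hs, hplain1 w hs]
        have key : ∀ p, (∀ i, b ^ d ≤ w i % (b ^ d + 1) ↔ i = p) →
            (TableAccepts (dualTable δ b n (b ^ d) (b ^ (f : ℕ))) (fun x => dualFlag F n x = 1)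
              A.init w ↔
            TableAccepts (dualTable δ b n (b ^ d) (b ^ (f : ℕ))) (fun x => dualFlag F n x = 1)
              (n + A.init) w) := by
          intro p hp
          have := tableAccepts_dualTable_of_eventually (F := F) (w := w) h.lt hdl (m := 1) hinit
            ((eventually_gt_atTop p).mono fun i hi => by
              rw [dualModes_eq_two hs hp hi]; norm_num)
          rw [one_mul] at this
          rw [this, hacc0 _ hinit, hletters]
        refine ⟨fun ha => ?_, fun ha => ?_⟩
        · obtain ⟨p, hD⟩ := hpar _ ((hlang w).mp ha)
          refine (key p ((hstar w p).mpr ?_)).mp ha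
          simpa only [hplain0 w hs] using hD
        · have h1 := ha
          rw [hcount] at h1
          obtain ⟨p, hp⟩ := exists_star_of_frequently hs (h1.mono fun i hi => by
            have := dualModes_one (fun j _ => hs j) (le_refl i)
            omega)
          exact (key p hp).mpr ha
    · rw [hlang, hcons]
      exact hzero _

/-- The conditions on parallelism and padding are part of every component test, so one component is
needed to have them at all; this is where `0 < d` enters. -/
theorem IsTableOf.isRVA_iff (h : IsTableOf A δ F) (hb : 1 < b) (hd : 0 < d) :
    IsRVA A ↔ ∀ k < d, RAM.ComponentTest δ F b n (b ^ d) A.init (b ^ k) := by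
  have hz : (finFunctionFinEquiv (fun _ : Fin d => (⟨0, by omega⟩ : Fin b)) : ℕ) = 0 := by
    simp
  rw [_root_.isRVA_iff hb (z := fun _ => ⟨0, by omega⟩) fun _ => rfl]
  constructor
  · intro hs k hk
    exact (h.componentTest_iff ⟨k, hk⟩ hz).mpr ⟨hs.parallel, hs.zero, hs.dual _⟩
  · intro ht
    have key := fun f : Fin d => (h.componentTest_iff f hz).mp (ht f f.isLt)
    exact ⟨(key ⟨0, hd⟩).1, (key ⟨0, hd⟩).2.1, fun f => (key f).2.2⟩

end Product


/-! ### The input memory and the final resource bounds -/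

section Input

variable {b d n : ℕ} (A : BuchiAutomaton (ParLetter b d) (Fin n))

theorem inputState_isTableOf : IsTableOf A ((inputState A).arr 0) ((inputState A).arr 1) where
  step q k hk := by
    have hdiv : (q * (b ^ d + 1) + k) / (b ^ d + 1) = q := by
      rw [mul_comm, Nat.mul_add_div (Nat.succ_pos _), Nat.div_eq_of_lt (Nat.lt_succ_of_le hk),
        add_zero]
    have hmod : (q * (b ^ d + 1) + k) % (b ^ d + 1) = k := by
      rw [mul_comm, Nat.mul_add_mod, Nat.mod_eq_of_lt (Nat.lt_succ_of_le hk)]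
    simp only [inputState, hdiv, hmod]
    simp
  accept q := by
    simp [inputState]

theorem inputState_flag_le (i : ℕ) : (inputState A).arr 1 i ≤ 1 := by
  simp only [inputState]
  split_ifs <;> omega

theorem inputState_table_le (i : ℕ) : (inputState A).arr 0 i ≤ n := by
  simp only [inputState]
  split_ifs
  · exact Fin.is_le'
  · exact Nat.zero_le _

theorem inputState_bdd {V : ℕ} (h2 : 2 ≤ V) (hb : b ≤ V) (hd : d ≤ V) (hn : n ≤ V) :
    RAM.Bdd V (inputState A) where
  two_le := h2
  var_le x := by
    match x with
    | 0 => exact hb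
    | 1 => exact hd
    | 2 => exact hn
    | 3 => exact Fin.is_le'.trans hn
    | x + 4 => exact Nat.zero_le _
  arr_le a i := by
    match a with
    | 0 => exact (inputState_table_le A i).trans hn
    | 1 => exact (inputState_flag_le A i).trans (by omega)
    | a + 2 => exact Nat.zero_le _

end Input

/-- Since `6 n ≤ 8 n`, the left side is at most `log₂ n + 4`. With `log 2 > 1/2`, the first summand
is at most `2 log (n + 1)` and the constant 4 at most `8 log (n + 1)`, which gives the factor 10. -/
theorem log_two_le (n : ℕ) (hn : 0 < n) :
    ((Nat.log 2 (6 * n) + 1 : ℕ) : ℝ) ≤ 10 * Real.log (n + 1) := by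
  have h1 : Nat.log 2 (6 * n) ≤ Nat.log 2 n + 3 := by
    calc Nat.log 2 (6 * n) ≤ Nat.log 2 (n * 2 * 2 * 2) := Nat.log_mono_right (by omega)
      _ = Nat.log 2 n + 3 := by
        rw [Nat.log_mul_base (by norm_num) (by omega), Nat.log_mul_base (by norm_num) (by omega),
          Nat.log_mul_base (by norm_num) (by omega)]
  have hl2 : (1 : ℝ) / 2 < Real.log 2 := by linarith [Real.log_two_gt_d9]
  have hpos : (0 : ℝ) < n := Nat.cast_pos.mpr hn
  have h1n : (1 : ℝ) ≤ n := by exact_mod_cast hn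
  have h2 : Real.log 2 ≤ Real.log (n + 1) := Real.log_le_log (by norm_num) (by linarith)
  have h3 : (Nat.log 2 n : ℝ) * Real.log 2 ≤ Real.log (n + 1) := by
    rw [← Real.log_pow]
    refine Real.log_le_log (by positivity) ?_
    have : 2 ^ Nat.log 2 n ≤ n := Nat.pow_log_le_self 2 (by omega)
    have h : ((2 ^ Nat.log 2 n : ℕ) : ℝ) ≤ n := by exact_mod_cast this
    push_cast at h
    linarith
  have h4 : (0 : ℝ) ≤ Nat.log 2 n := Nat.cast_nonneg _
  have h5 : ((Nat.log 2 (6 * n) + 1 : ℕ) : ℝ) ≤ Nat.log 2 n + 4 := by exact_mod_cast (by omega)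
  nlinarith

/-- With `B + 1 ≤ 2 B` the main term has the factor `3010 · 24 = 72240`; the lower terms add 70, and
`log_two_le` multiplies by 10. -/
theorem program_time_le {n d B t : ℕ} (hn : 0 < n) (hB : 1 ≤ B)
    (ht : t ≤ d * (3010 * (6 * n * (2 * (B + 1)) * (Nat.log 2 (6 * n) + 1))) + 20 * d + 50)
    (hd : 1 ≤ d) : (t : ℝ) ≤ 1000000 * (n * Real.log (n + 1) * d * B) := by
  have h1 : t ≤ 72310 * (n * d * B * (Nat.log 2 (6 * n) + 1)) := by
    have e1 : d * (3010 * (6 * n * (2 * (B + 1)) * (Nat.log 2 (6 * n) + 1))) ≤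
        72240 * (n * d * B * (Nat.log 2 (6 * n) + 1)) := by
      calc _ ≤ d * (3010 * (6 * n * (2 * (B + B)) * (Nat.log 2 (6 * n) + 1))) := by gcongr
        _ = _ := by ring
    have e2 : d ≤ n * d * B * (Nat.log 2 (6 * n) + 1) := by
      calc d = 1 * d * 1 * 1 := by ring
        _ ≤ _ := by gcongr <;> omega
    omega
  have h2 : (t : ℝ) ≤ 72310 * ((n * d * B) * ((Nat.log 2 (6 * n) + 1 : ℕ) : ℝ)) := by
    exact_mod_cast h1
  have h3 := mul_le_mul_of_nonneg_left (log_two_le n hn)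
    (by positivity : (0 : ℝ) ≤ n * d * B)
  have h4 : (0 : ℝ) ≤ n * d * B * Real.log (n + 1) :=
    mul_nonneg (by positivity) (Real.log_nonneg (by linarith [(Nat.cast_nonneg n : (0 : ℝ) ≤ n)]))
  linarith

/-- Here `60 ≤ 2 ^ 6 ≤ x ^ 6`, so `60 x ≤ x ^ 7`, and `112 = 7 · 16`. -/
theorem word_bound {x C : ℕ} (hx : 2 ≤ x) (hC : 112 ≤ C) : (60 * x) ^ 16 ≤ x ^ C := by
  have h1 : 60 * x ≤ x ^ 7 := by
    have : 2 ^ 6 ≤ x ^ 6 := Nat.pow_le_pow_left hx 6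
    rw [pow_succ]
    exact Nat.mul_le_mul_right x (by omega)
  calc (60 * x) ^ 16 ≤ (x ^ 7) ^ 16 := Nat.pow_le_pow_left h1 16
    _ = x ^ 112 := by rw [← pow_mul]
    _ ≤ x ^ C := Nat.pow_le_pow_right (by omega) hC

theorem mainTheorem1 :
    ∃ (P : RAM.Cmd) (C : ℕ), ∀ (b d n : ℕ), 2 ≤ b → 1 ≤ d →
      ∀ A : BuchiAutomaton (ParLetter b d) (Fin n), A.IsWeak →
        ∃ (S W t : ℕ) (s : RAM.State),
          RAM.Exec S W P (inputState A) t s ∧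
          (t : ℝ) ≤ C * (n * Real.log (n + 1) * d * b ^ d) ∧
          P.space S ≤ C * (n * b ^ d) ∧
          W ≤ (n * b ^ d) ^ C ∧
          (IsRVA A → s.var 0 = 1) ∧ (¬ IsRVA A → s.var 0 = 0) := by
  -- One constant serves as the factor for time and space and as the exponent for the word size.
  obtain ⟨C, hC, hspace⟩ : ∃ C, 1000000 ≤ C ∧
      RAM.program.vars.card + 24 * RAM.program.arrays.card ≤ C :=
    ⟨_, le_max_left _ _, le_max_right _ _⟩
  refine ⟨RAM.program, C, fun b d n hb hd A hA => ?_⟩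
  have hn : 0 < n := (Nat.zero_le _).trans_lt A.init.isLt
  have hbd : b ≤ b ^ d := Nat.le_self_pow (by omega) b
  have hdb : d ≤ b ^ d := (Nat.lt_pow_self (by omega)).le
  have htab := inputState_isTableOf A
  have hB2 : 2 ≤ b ^ d := hb.trans hbd
  have hx : b ^ d ≤ n * b ^ d := Nat.le_mul_of_pos_left _ hn
  have hnx : n ≤ n * b ^ d := Nat.le_mul_of_pos_right _ (by omega)
  -- With `x = n b ^ d`, the product table has `12 x + 12 n ≤ 24 x` entries, and the required word
  -- bound `12 x + 42 n + 1` is at most `60 x`.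
  have hrun := RAM.runs_program (b := b) (d := d) (n := n) (B := b ^ d) (q₀ := A.init)
    (S := 24 * (n * b ^ d)) (V := 60 * (n * b ^ d)) (s := inputState A) rfl rfl rfl rfl rfl
    A.init.isLt (by omega) rfl htab.lt (fun q _ => inputState_flag_le A q)
    (fun f hf m sw k hk => dualLetter_le (⟨f, hf⟩ : Fin d) m sw k hk)
    (fun f hf => htab.isWeakTable (f := ⟨f, hf⟩) hA hn) (by omega)
    (by
      have : 6 * n * (2 * (b ^ d + 1)) = 12 * (n * b ^ d) + 12 * n := by ring
      omega)
    (by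
      have : 6 * n * (2 * (b ^ d + 1) + 5) = 12 * (n * b ^ d) + 42 * n := by ring
      omega)
  obtain ⟨t, s, hexec, -, ht, hle, hiff⟩ :=
    hrun (inputState_bdd A (by omega) (by omega) (by omega) (by omega))
  rw [← htab.isRVA_iff (by omega) (by omega)] at hiff
  refine ⟨_, _, t, s, hexec, ?_, ?_, word_bound (by omega) (by omega), hiff.mpr, fun h => ?_⟩
  · have h1 := program_time_le hn (by omega) ht hd
    push_cast at h1
    have h2 : (0 : ℝ) ≤ n * Real.log (n + 1) * d * (b : ℝ) ^ d :=
      mul_nonneg (mul_nonneg (mul_nonneg (Nat.cast_nonneg n) (Real.log_nonneg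
        (by linarith [(Nat.cast_nonneg n : (0 : ℝ) ≤ n)]))) (Nat.cast_nonneg d)) (by positivity)
    have h3 : (1000000 : ℝ) ≤ C := by exact_mod_cast hC
    exact h1.trans (mul_le_mul_of_nonneg_right h3 h2)
  · have h1 : RAM.program.vars.card ≤ RAM.program.vars.card * (n * b ^ d) :=
      Nat.le_mul_of_pos_right _ (by omega)
    calc RAM.program.space (24 * (n * b ^ d))
        ≤ RAM.program.vars.card * (n * b ^ d) +
          RAM.program.arrays.card * (24 * (n * b ^ d)) := Nat.add_le_add_right h1 _
      _ = (RAM.program.vars.card + 24 * RAM.program.arrays.card) * (n * b ^ d) := by ring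
      _ ≤ C * (n * b ^ d) := Nat.mul_le_mul_right _ hspace
  · have : s.var 0 ≠ 1 := fun h1 => h (hiff.mp h1)
    omega
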